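/- For a prime $q$ and a real $\eta$, let $\mathrm{Ber}_q(\eta)$ be the distribution on $\mathbb F_q$ with $\Pr[0]=1-\eta+\eta/q$ and $\Pr[x]=\eta/q$ for every $x\neq 0$ (whenever these numbers are nonnegative). For positive integers $n,m,\sigma$ with $\sigma\le n$, an instance of $\mathrm{LPN}^{\approx\sigma}_{q,\eta,n,m}$ is a pair $(A,b)$ with $A\in\mathbb F_q^{m\times n}$ and $b=As+e$, where the secret $s\in\mathbb F_q^n$ is uniform, the entries of $A$ are i.i.d. $\mathrm{Ber}_q\!\big(\tfrac{q\sigma}{(q-1)n}\big)$, the entries of $e$ are i.i.d. $\mathrm{Ber}_q(\eta)$, and $s,A,e$ are independent. A (randomized) algorithm or oracle solves the problem with success probability $\alpha$ if, on input $(A,b)$, it outputs $s$ with probability at least $\alpha$ over the instance and its own randomness. **Theorem.** There are a single randomized oracle algorithm $R$ and a polynomial $p$ such that the following holds. Let $q$ be a prime, let $m,n,k,\sigma$ be positive integers with $\sigma\le n$ and $m\ge 48\,n^3\log q/\sigma^2$, let $\varepsilon>0$, $\delta>6\cdot 2^{-(2n-1)}$, $\eta\in(0,1/8)$, and suppose that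 $$\frac{192}{\delta}\log\!\Big(\frac8\varepsilon\Big)<k<2^{2n-2}\,\varepsilon .$$ (Here $\log$ is the natural logarithm.) Let $\mathcal O$ be any randomized oracle that takes inputs of the format of $\mathrm{LPN}^{\approx k\sigma}_{q,\,1-(1-\eta)^k,\,kn,\,m}$ and uses fresh randomness in each call. Then $R^{\mathcal O}$, given $q,n,m,k,\sigma,\lceil 1/\delta\rceil,\lceil 1/\varepsilon\rceil$ and $(A,b)\in\mathbb F_q^{m\times n}\times\mathbb F_q^m$, always halts within $p(n,m,k,1/\delta,1/\varepsilon)$ steps; and if $\mathcal O$ solves $\mathrm{LPN}^{\approx k\sigma}_{q,\,1-(1-\eta)^k,\,kn,\,m}$ with success probability $\varepsilon$, then $R^{\mathcal O}$ solves $\mathrm{LPN}^{\approx\sigma}_{q,\eta,n,m}$ with success probability $1-\delta$. Here the running time is that of a random access machine with logarithmic cost on natural numbers, which can draw uniform random integers below a given bound, can draw samples of $\mathrm{Ber}_q(\eta)$, and is charged one step for an oracle call (writing the query and reading the answer are charged separately). -/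

import Mathlib

open scoped BigOperators

namespace SparseLPN

noncomputable section

/-! ### The approximately sparse LPN problem over `ZMod q` -/

/-- The mass function of `Ber_q(η)`: a uniform element of `ZMod q` with probability `η`,
and `0` otherwise. -/
def berMass (q : ℕ) (η : ℝ) (x : ZMod q) : ℝ :=
  if x = 0 then (1 - η) + η / q else η / q

theorem sum_berMass (q : ℕ) [NeZero q] (η : ℝ) : ∑ x : ZMod q, berMass q η x = 1 := by
  have hq : (q : ℝ) ≠ 0 := Nat.cast_ne_zero.mpr (NeZero.ne q)
  have h : ∀ x : ZMod q, berMass q η x = (if x = 0 then 1 - η else 0) + η / q := by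
    intro x
    unfold berMass
    split_ifs <;> ring
  simp only [h, Finset.sum_add_distrib, Finset.sum_ite_eq', Finset.mem_univ, if_true,
    Finset.sum_const, Finset.card_univ, ZMod.card, nsmul_eq_mul]
  field_simp
  ring

theorem sum_ofReal_berMass (q : ℕ) [NeZero q] (η : ℝ) (h : ∀ x : ZMod q, 0 ≤ berMass q η x) :
    ∑ x : ZMod q, ENNReal.ofReal (berMass q η x) = 1 := by
  rw [← ENNReal.ofReal_sum_of_nonneg (fun x _ => h x), sum_berMass, ENNReal.ofReal_one]

open Classical in
/-- The distribution `Ber_q(η)` on `ZMod q`, for every real `η` for which the masses above are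
nonnegative (that is, `0 ≤ η ≤ q / (q - 1)`); a point mass at `0` for all other `η`. -/
def berQ (q : ℕ) [NeZero q] (η : ℝ) : PMF (ZMod q) :=
  if h : ∀ x : ZMod q, 0 ≤ berMass q η x then
    PMF.ofFintype (fun x => ENNReal.ofReal (berMass q η x)) (sum_ofReal_berMass q η h)
  else PMF.pure 0

theorem sum_prod_pmf {ι α : Type} [Fintype ι] [DecidableEq ι] [Fintype α] (μ : PMF α) :
    ∑ f : ι → α, ∏ i, μ (f i) = 1 := by
  have h : ∑ a : α, μ a = 1 := by
    have h1 := μ.tsum_coe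
    rwa [tsum_fintype] at h1
  rw [← Fintype.piFinset_univ, ← Finset.prod_univ_sum (fun _ => Finset.univ) (fun _ a => μ a)]
  simp [h]

/-- The law of a family of independent random variables, each with law `μ`. -/
def iid {ι α : Type} [Fintype ι] [DecidableEq ι] [Fintype α] (μ : PMF α) : PMF (ι → α) :=
  PMF.ofFintype (fun f => ∏ i, μ (f i)) (sum_prod_pmf μ)

/-- `m` samples `(a_i, b_i)` of LPN over `ZMod q` in dimension `n` with noise rate `η`, where the
entries of each `a_i` are i.i.d. `Ber_q(qσ / ((q - 1) n))`, together with the uniform secret: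
the law of `(A, A s + e, s)`. -/
def lpn (q : ℕ) [NeZero q] (η : ℝ) (n m σ : ℕ) :
    PMF (Matrix (Fin m) (Fin n) (ZMod q) × (Fin m → ZMod q) × (Fin n → ZMod q)) :=
  (PMF.uniformOfFintype (Fin n → ZMod q)).bind fun s =>
    (iid (iid (berQ q ((q : ℝ) * σ / (((q : ℝ) - 1) * n)))) : PMF (Fin m → Fin n → ZMod q)).bind
      fun a => (iid (berQ q η) : PMF (Fin m → ZMod q)).bind fun e =>
        PMF.pure (Matrix.of a, Matrix.mulVec (Matrix.of a) s + e, s)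

/-- A randomized map that takes `m` samples in dimension `n` to a candidate for the secret. -/
abbrev Solver (q n m : ℕ) : Type :=
  Matrix (Fin m) (Fin n) (ZMod q) → (Fin m → ZMod q) → PMF (Fin n → ZMod q)

/-- The probability, over the instance and the randomness of `S`, that `S` finds the secret. -/
def successProb (q : ℕ) [NeZero q] (η : ℝ) (n m σ : ℕ) (S : Solver q n m) : ℝ :=
  (((lpn q η n m σ).bind fun x =>
    (S x.1 x.2.1).map fun z => decide (z = x.2.2)) true).toReal

/-! ### Randomized oracle programs with logarithmic cost

Programs for a random access machine that works on natural numbers. It has registers `reg x`, and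
arrays `mem a` with cells `mem a i j`. The only loops are `for` loops whose number of rounds is
fixed on entry, so every program halts. -/

/-- `time` is the number of steps done so far. -/
structure State where
  reg : ℕ → ℕ
  mem : ℕ → ℕ → ℕ → ℕ
  time : ℕ

/-- Binary operations; a comparison has the value `1` or `0`. -/
inductive Op
  | add | sub | mul | div | mod | lt | eq

def Op.eval : Op → ℕ → ℕ → ℕ
  | .add, a, b => a + b
  | .sub, a, b => a - b
  | .mul, a, b => a * b
  | .div, a, b => a / b
  | .mod, a, b => a % b
  | .lt, a, b => if a < b then 1 else 0
  | .eq, a, b => if a = b then 1 else 0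

inductive Expr
  | const (c : ℕ)
  | reg (x : ℕ)
  | mem (a : ℕ) (i j : Expr)
  | bin (o : Op) (e f : Expr)

def Expr.eval (s : State) : Expr → ℕ
  | .const c => c
  | .reg x => s.reg x
  | .mem a i j => s.mem a (i.eval s) (j.eval s)
  | .bin o e f => o.eval (e.eval s) (f.eval s)

/-- Every node of an expression costs one step plus the bit length of its value. -/
def Expr.cost (s : State) : Expr → ℕ
  | .const c => 1 + Nat.size c
  | .reg x => 1 + Nat.size (s.reg x)
  | .mem a i j => i.cost s + j.cost s + (1 + Nat.size (s.mem a (i.eval s) (j.eval s)))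
  | .bin o e f => e.cost s + f.cost s + (1 + Nat.size (o.eval (e.eval s) (f.eval s)))

inductive Cmd
  /-- do nothing -/
  | skip
  /-- `reg x := e` -/
  | assign (x : ℕ) (e : Expr)
  /-- `mem a i j := e` -/
  | store (a : ℕ) (i j e : Expr)
  /-- `reg x :=` a uniformly random element of `{0, …, e - 1}` (`0` if `e = 0`) -/
  | unif (x : ℕ) (e : Expr)
  /-- `reg x :=` a fresh sample from the noise distribution of the problem to be solved -/
  | noise (x : ℕ)
  /-- submit the samples held in the arrays `2` (matrix) and `3` (right-hand side, in row `0`) to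
  the oracle, and write its answer into row `0` of the array `4` -/
  | query
  | seq (c d : Cmd)
  /-- run `c` if `e ≠ 0`, and `d` otherwise -/
  | cond (e : Expr) (c d : Cmd)
  /-- run `c` as many times as the value that `e` has on entry -/
  | loop (e : Expr) (c : Cmd)

def State.tick (t : ℕ) (s : State) : State := { s with time := s.time + t }

def State.setReg (x v : ℕ) (s : State) : State := { s with reg := Function.update s.reg x v }

def State.setMem (a i j v : ℕ) (s : State) : State :=
  { s with mem := fun a' i' j' => if a' = a ∧ i' = i ∧ j' = j then v else s.mem a' i' j' }

/-- Row `0` of the array `a`, cells `0, …, l - 1`, read as a vector over `ZMod q`. -/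
def State.readVec (q l a : ℕ) (s : State) : Fin l → ZMod q := fun j => (s.mem a 0 j : ZMod q)

/-- The upper left corner of the array `a`, read as a matrix over `ZMod q`. -/
def State.readMat (q m l a : ℕ) (s : State) : Matrix (Fin m) (Fin l) (ZMod q) :=
  Matrix.of fun i j => (s.mem a i j : ZMod q)

/-- Overwrite row `0` of the array `a`, cells `0, …, l - 1`, by the representatives in
`{0, …, q - 1}` of the entries of a vector. -/
def State.writeVec {q l : ℕ} (a : ℕ) (v : Fin l → ZMod q) (s : State) : State :=
  { s with mem := fun a' i j =>
      if h : a' = a ∧ i = 0 ∧ j < l then (v ⟨j, h.2.2⟩).val else s.mem a' i j }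

/-- The uniform distribution on `{0, …, N - 1}`, and the point mass at `0` if `N = 0`. -/
def unifBelow (N : ℕ) : PMF ℕ :=
  if h : (Finset.range N).Nonempty then PMF.uniformOfFinset (Finset.range N) h else PMF.pure 0

/-- The law of the final state of a program that is started in a given state, where `ν` is the
noise distribution and `O` the oracle, which uses fresh randomness in every call. An elementary
command costs one step, plus the cost of the expressions in it, plus the bit length of a number
that is drawn; an oracle call costs one step; every round of a loop costs one extra step. -/
def Cmd.run {q l m : ℕ} (ν : PMF (ZMod q)) (O : Solver q l m) : Cmd → State → PMF State
  | .skip, s => PMF.pure (s.tick 1)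
  | .assign x e, s => PMF.pure ((s.setReg x (e.eval s)).tick (1 + e.cost s))
  | .store a i j e, s =>
      PMF.pure ((s.setMem a (i.eval s) (j.eval s) (e.eval s)).tick
        (1 + i.cost s + j.cost s + e.cost s))
  | .unif x e, s =>
      (unifBelow (e.eval s)).map fun v => (s.setReg x v).tick (1 + e.cost s + Nat.size v)
  | .noise x, s => ν.map fun v => (s.setReg x v.val).tick (1 + Nat.size v.val)
  | .query, s =>
      (O (s.readMat q m l 2) (s.readVec q m 3)).map fun z => (s.writeVec 4 z).tick 1
  | .seq c d, s => (c.run ν O s).bind fun s' => d.run ν O s'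
  | .cond e c d, s =>
      if e.eval s ≠ 0 then c.run ν O (s.tick (1 + e.cost s))
      else d.run ν O (s.tick (1 + e.cost s))
  | .loop e c, s =>
      (fun p : PMF State => p.bind fun s' => c.run ν O (s'.tick 1))^[e.eval s]
        (PMF.pure (s.tick (1 + e.cost s)))

/-- The initial state: the parameters are in the registers `0, 1, 2, …` (all other registers
hold `0`), the matrix `A` is in the array `0`, the vector `b` is in row `0` of the array `1`, and
all other cells hold `0`. -/
def initState {q n m : ℕ} (params : List ℕ) (A : Matrix (Fin m) (Fin n) (ZMod q))
    (b : Fin m → ZMod q) : State where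
  reg := fun x => params.getD x 0
  mem := fun a i j =>
    if a = 0 then (if h : i < m ∧ j < n then (A ⟨i, h.1⟩ ⟨j, h.2⟩).val else 0)
    else if a = 1 then (if h : i = 0 ∧ j < m then (b ⟨j, h.2⟩).val else 0)
    else 0
  time := 0

/-- The solver computed by a program with an oracle: run it on the given samples, and read its
output off row `0` of the array `5`. -/
def Cmd.toSolver {q l m : ℕ} (P : Cmd) (n : ℕ) (params : List ℕ) (ν : PMF (ZMod q))
    (O : Solver q l m) : Solver q n m :=
  fun A b => (P.run ν O (initState params A b)).map fun s => s.readVec q n 5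

end

end SparseLPN

/-! Put the matrices of `k` independent instances side by side, concatenate their secrets and add
their right-hand sides. Scaling `σ` and `n` by `k` leaves the entry distribution unchanged, and the
sum of `k` samples of `Ber_q(η)` is `Ber_q(1-(1-η)^k)`, so the result is distributed exactly as the
oracle's input (`iid_lpn_map_joinInstances`). The reduction hides the given instance at one position
among fresh ones, takes the corresponding block of the oracle's answer as a candidate, tries every
position `4k⌈1/δ⌉⌈1/ε⌉` times, and keeps the candidate that violates the fewest equations.

Two facts show that this works. The first is a direct product argument (`exists_position`): at some
position all instances but a fraction `log(2/ε)/k` are solved by a single trial with probability at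
least `ε/(2k)`. Repetition then finds the secret up to an error of `δ/2` (`pow_le_half`). The second
is that the secret is usually the unique vector with the fewest errors, so that it is recognized
when found. The proof does not analyse the random matrix. It reads this off the oracle: if `k`
independent secrets can be guessed jointly with probability `ε`, then maximum likelihood guesses one
of them with probability at least `ε^(1/k)`, which leaves little room for ties or better rivals
(`expect_ambiguous_le`). The failure probabilities add up to less than `δ`
(`successProb_reduction`).

The program is treated through laws of views of its state. Frame conditions and loop rules reduce it
to a Markov chain on the best candidate (`reduction_law`), and everything probabilistic concerns
that chain. The running time comes from a syntactic criterion: the number of operations is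
polynomial in the parameters, and each operation lengthens the stored numbers by boundedly many bits
(`Cmd.time_le`). The lower bound on `m` enters there, as it gives `q ≤ 2^m`. -/

namespace SparseLPN

/-! ### Running time of syntactically tame programs -/

/-- The number of nodes of an expression, where a constant `c` counts as `c + 1` nodes. -/
def Expr.nodes : Expr → ℕ
  | .const c => c + 1
  | .reg _ => 1
  | .mem _ i j => i.nodes + j.nodes + 1
  | .bin _ e f => e.nodes + f.nodes + 1

/-- All numbers held by the state are at most `2 ^ L`. -/
def State.Bdd (L : ℕ) (s : State) : Prop :=
  (∀ x, s.reg x ≤ 2 ^ L) ∧ ∀ a i j, s.mem a i j ≤ 2 ^ L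

theorem State.Bdd.mono {L L' : ℕ} {s : State} (h : s.Bdd L) (hL : L ≤ L') : s.Bdd L' :=
  ⟨fun x => (h.1 x).trans (Nat.pow_le_pow_right (by norm_num) hL),
    fun a i j => (h.2 a i j).trans (Nat.pow_le_pow_right (by norm_num) hL)⟩

theorem two_pow_add_le (a b : ℕ) : 2 ^ a + 2 ^ b ≤ 2 ^ (a + b + 1) := by
  have h1 : 2 ^ a ≤ 2 ^ (a + b) := Nat.pow_le_pow_right (by norm_num) (by omega)
  have h2 : 2 ^ b ≤ 2 ^ (a + b) := Nat.pow_le_pow_right (by norm_num) (by omega)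
  rw [pow_succ]; omega

theorem Op.eval_le (o : Op) {a b A B : ℕ} (ha : a ≤ 2 ^ A) (hb : b ≤ 2 ^ B) :
    o.eval a b ≤ 2 ^ (A + B + 1) := by
  have h2 : 2 ^ A ≤ 2 ^ (A + B + 1) := Nat.pow_le_pow_right (by norm_num) (by omega)
  have h3 : 1 ≤ 2 ^ (A + B + 1) := Nat.one_le_two_pow
  cases o
  · exact (Nat.add_le_add ha hb).trans (two_pow_add_le A B)
  · exact (Nat.sub_le a b).trans (ha.trans h2)
  · refine (Nat.mul_le_mul ha hb).trans ?_
    rw [← pow_add]; exact Nat.pow_le_pow_right (by norm_num) (by omega)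
  · exact (Nat.div_le_self a b).trans (ha.trans h2)
  · exact (Nat.mod_le a b).trans (ha.trans h2)
  · simp only [Op.eval]; split_ifs <;> omega
  · simp only [Op.eval]; split_ifs <;> omega

/-- Bit lengths at most add up, products included. A constant `c` has at most `c` bits since `c <
2^c`, which is why it counts as `c + 1` nodes. This crude bound serves for costs only, not for
stored values, where it would compound. -/
theorem Expr.eval_le {L : ℕ} {s : State} (h : s.Bdd L) (e : Expr) :
    e.eval s ≤ 2 ^ (e.nodes * (L + 1)) := by
  induction e with
  | const c =>
    have h1 : c < 2 ^ c := Nat.lt_two_pow_self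
    have h2 : 2 ^ c ≤ 2 ^ ((c + 1) * (L + 1)) :=
      Nat.pow_le_pow_right (by norm_num) (by nlinarith)
    exact h1.le.trans h2
  | reg x => exact (h.1 x).trans (Nat.pow_le_pow_right (by norm_num) (by simp [Expr.nodes]))
  | mem a i j _ _ =>
    refine (h.2 a _ _).trans (Nat.pow_le_pow_right (by norm_num) ?_)
    simp only [Expr.nodes]; nlinarith
  | bin o e f ihe ihf =>
    refine (o.eval_le ihe ihf).trans (Nat.pow_le_pow_right (by norm_num) ?_)
    simp only [Expr.nodes]; nlinarith

theorem size_le_of_le_two_pow {a A : ℕ} (h : a ≤ 2 ^ A) : Nat.size a ≤ A + 1 :=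
  Nat.size_le.2 (h.trans_lt (Nat.pow_lt_pow_right (by norm_num) (by omega)))

/-- Quadratic in the number of nodes, because each node is charged the bit length of its value,
which may itself be proportional to the number of nodes below it. -/
theorem Expr.cost_le {L : ℕ} {s : State} (h : s.Bdd L) (e : Expr) :
    e.cost s ≤ 3 * e.nodes ^ 2 * (L + 1) := by
  have key : ∀ e : Expr, Nat.size (e.eval s) ≤ e.nodes * (L + 1) + 1 :=
    fun e => size_le_of_le_two_pow (e.eval_le h)
  induction e with
  | const c =>
    have := key (.const c)
    simp only [Expr.cost, Expr.eval, Expr.nodes] at *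
    nlinarith [Nat.zero_le (c * L), Nat.zero_le (c * c * L), Nat.zero_le (c * c)]
  | reg x =>
    have := key (.reg x)
    simp only [Expr.cost, Expr.eval, Expr.nodes] at *
    nlinarith
  | mem a i j ihi ihj =>
    have := key (.mem a i j)
    simp only [Expr.cost, Expr.eval, Expr.nodes] at *
    nlinarith [Nat.zero_le (i.nodes * j.nodes * (L + 1)), Nat.zero_le (i.nodes * (L + 1)),
      Nat.zero_le (j.nodes * (L + 1))]
  | bin o i j ihi ihj =>
    have := key (.bin o i j)
    simp only [Expr.cost, Expr.eval, Expr.nodes] at *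
    nlinarith [Nat.zero_le (i.nodes * j.nodes * (L + 1)), Nat.zero_le (i.nodes * (L + 1)),
      Nat.zero_le (j.nodes * (L + 1))]

/-- Expressions whose bit length exceeds that of the registers and cells by a constant only. -/
def Expr.tame : Expr → Bool
  | .const _ => true
  | .reg _ => true
  | .mem _ _ _ => true
  | .bin o e f =>
    match o with
    | .add => e.tame && f.tame
    | .sub => e.tame
    | .mod => match f with
      | .reg 0 => true
      | _ => false
    | .lt => true
    | .eq => true
    | _ => false

/-- Growth is additive in `L` here, so it stays under control over many rounds of a loop. A
remainder modulo `reg 0`, a comparison and a cell are bounded whatever stands inside them, so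
products may occur there. -/
theorem Expr.eval_le_of_tame {L : ℕ} {s : State} (h : s.Bdd L) (h0 : 0 < s.reg 0) (e : Expr)
    (he : e.tame = true) : e.eval s ≤ 2 ^ (L + e.nodes) := by
  induction e with
  | const c =>
    have h1 : c < 2 ^ c := Nat.lt_two_pow_self
    exact h1.le.trans (Nat.pow_le_pow_right (by norm_num) (by simp only [Expr.nodes]; omega))
  | reg x => exact (h.1 x).trans (Nat.pow_le_pow_right (by norm_num) (by simp [Expr.nodes]))
  | mem a i j _ _ => exact (h.2 a _ _).trans (Nat.pow_le_pow_right (by norm_num) (by omega))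
  | bin o e f ihe ihf =>
    have hone : 1 ≤ 2 ^ (L + (e.nodes + f.nodes + 1)) := Nat.one_le_two_pow
    cases o with
    | add =>
      simp only [Expr.tame, Bool.and_eq_true] at he
      have h1 := ihe he.1
      have h2 := ihf he.2
      have h3 : 2 ^ (L + e.nodes) ≤ 2 ^ (L + (e.nodes + f.nodes)) :=
        Nat.pow_le_pow_right (by norm_num) (by omega)
      have h4 : 2 ^ (L + f.nodes) ≤ 2 ^ (L + (e.nodes + f.nodes)) :=
        Nat.pow_le_pow_right (by norm_num) (by omega)
      have h5 : 2 ^ (L + (e.nodes + f.nodes + 1)) = 2 ^ (L + (e.nodes + f.nodes)) * 2 := by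
        rw [← pow_succ]; rfl
      simp only [Expr.eval, Op.eval, Expr.nodes]
      omega
    | sub =>
      simp only [Expr.tame] at he
      exact (Nat.sub_le _ _).trans ((ihe he).trans
        (Nat.pow_le_pow_right (by norm_num) (by simp only [Expr.nodes]; omega)))
    | mul => simp [Expr.tame] at he
    | div => simp [Expr.tame] at he
    | mod =>
      have hf : f = .reg 0 := by
        simp only [Expr.tame] at he
        split at he
        · rfl
        · simp at he
      subst hf
      -- Positivity of `reg 0` is essential: `a % 0 = a` would not be bounded.
      exact (Nat.mod_lt _ h0).le.trans ((h.1 0).trans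
        (Nat.pow_le_pow_right (by norm_num) (by omega)))
    | lt => simp only [Expr.eval, Op.eval, Expr.nodes]; split_ifs <;> omega
    | eq => simp only [Expr.eval, Op.eval, Expr.nodes]; split_ifs <;> omega

/-- Products of constants and of the registers `1, …, 6`. -/
def Expr.isParam : Expr → Bool
  | .const _ => true
  | .reg x => decide (1 ≤ x ∧ x ≤ 6)
  | .mem _ _ _ => false
  | .bin o e f =>
    match o with
    | .mul => e.isParam && f.isParam
    | _ => false

theorem Expr.eval_le_of_isParam {N : ℕ} {s : State} (hN : 2 ≤ N)
    (h : ∀ x, 1 ≤ x → x ≤ 6 → s.reg x ≤ N) (e : Expr) (he : e.isParam = true) :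
    e.eval s ≤ N ^ e.nodes := by
  induction e with
  | const c =>
    have h1 : c < 2 ^ c := Nat.lt_two_pow_self
    exact h1.le.trans ((Nat.pow_le_pow_left hN c).trans
      (Nat.pow_le_pow_right (by omega) (by simp [Expr.nodes])))
  | reg x =>
    simp only [Expr.isParam, decide_eq_true_eq] at he
    simpa [Expr.nodes, Expr.eval] using h x he.1 he.2
  | mem a i j _ _ => simp [Expr.isParam] at he
  | bin o e f ihe ihf =>
    cases o <;> simp only [Expr.isParam, Bool.and_eq_true, Bool.false_eq_true] at he
    refine (Nat.mul_le_mul (ihe he.1) (ihf he.2)).trans ?_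
    rw [← pow_add]
    exact Nat.pow_le_pow_right (by omega) (by simp [Expr.nodes])

/-- Programs that store tame expressions only, do not change the registers `0, …, 6`, and whose
loops have a number of rounds that is a product of parameters. -/
def Cmd.tame : Cmd → Bool
  | .skip => true
  | .assign x e => decide (7 ≤ x) && e.tame
  | .store _ _ _ e => e.tame
  | .unif x e => decide (7 ≤ x) && e.tame
  | .noise x => decide (7 ≤ x)
  | .query => true
  | .seq c d => c.tame && d.tame
  | .cond _ c d => c.tame && d.tame
  | .loop e c => e.isParam && c.tame

/-- A bound for the number of operations of a program whose parameters are at most `N`. -/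
def Cmd.ops (N : ℕ) : Cmd → ℕ
  | .skip => 1
  | .assign _ e => 1 + e.nodes + 3 * e.nodes ^ 2
  | .store _ i j e => 1 + e.nodes + 3 * i.nodes ^ 2 + 3 * j.nodes ^ 2 + 3 * e.nodes ^ 2
  | .unif _ e => 2 + e.nodes + 3 * e.nodes ^ 2
  | .noise _ => 2
  | .query => 1
  | .seq c d => c.ops N + d.ops N
  | .cond e c d => 1 + 3 * e.nodes ^ 2 + c.ops N + d.ops N
  | .loop e c => 1 + 3 * e.nodes ^ 2 + N ^ e.nodes * (c.ops N + 1)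

/-- A loop multiplies the bound of its body by a power of `N` whose exponent is fixed by the syntax,
so the degree depends on the program alone. -/
theorem Cmd.exists_ops_le (c : Cmd) : ∃ a b : ℕ, ∀ N, 1 ≤ N → c.ops N ≤ a * N ^ b := by
  have const : ∀ t : ℕ, ∃ a b : ℕ, ∀ N, 1 ≤ N → t ≤ a * N ^ b := fun t => ⟨t, 0, by simp⟩
  have add : ∀ {f g : ℕ → ℕ}, (∃ a b : ℕ, ∀ N, 1 ≤ N → f N ≤ a * N ^ b) →
      (∃ a b : ℕ, ∀ N, 1 ≤ N → g N ≤ a * N ^ b) →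
      ∃ a b : ℕ, ∀ N, 1 ≤ N → f N + g N ≤ a * N ^ b := by
    rintro f g ⟨a, b, h⟩ ⟨a', b', h'⟩
    refine ⟨a + a', b + b', fun N hN => ?_⟩
    have h1 : N ^ b ≤ N ^ (b + b') := Nat.pow_le_pow_right hN (by omega)
    have h2 : N ^ b' ≤ N ^ (b + b') := Nat.pow_le_pow_right hN (by omega)
    calc f N + g N ≤ a * N ^ b + a' * N ^ b' := Nat.add_le_add (h N hN) (h' N hN)
      _ ≤ a * N ^ (b + b') + a' * N ^ (b + b') := by gcongr
      _ = _ := by ring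
  induction c with
  | skip => exact const _
  | assign x e => exact const _
  | store a i j e => exact const _
  | unif x e => exact const _
  | noise x => exact const _
  | query => exact const _
  | seq c d hc hd => exact add hc hd
  | cond e c d hc hd => exact add (add (const _) hc) hd
  | loop e c hc =>
    refine add (const _) ?_
    obtain ⟨a, b, h⟩ := add hc (const 1)
    refine ⟨a, b + e.nodes, fun N hN => ?_⟩
    calc N ^ e.nodes * (c.ops N + 1) ≤ N ^ e.nodes * (a * N ^ b) := by gcongr; exact h N hN
      _ = _ := by ring

theorem mem_support_unifBelow {N v : ℕ} (hv : v ∈ (unifBelow N).support) : v ≤ N := by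
  unfold unifBelow at hv
  split_ifs at hv with h
  · rw [PMF.support_uniformOfFinset] at hv
    exact (Finset.mem_range.1 hv).le
  · simp at hv
    omega

/-- One more round of a loop: after `A` operations the numbers have `L + A` bits, and the round adds
one step for itself and `G` operations of its body. -/
theorem time_step {A G L : ℕ} : A * (L + A + 1) + 1 + G * (L + A + G + 1) ≤
    (A + (G + 1)) * (L + (A + (G + 1)) + 1) := by nlinarith [Nat.zero_le (G * L)]

section
variable {q l m : ℕ} [NeZero q] {ν : PMF (ZMod q)} {O : Solver q l m}

/-- Three claims are carried through the induction together: the bit length grows by at most one per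
operation, the parameters survive (so the modulus and the loop bounds stay the same), and hence each
operation costs at most the final bit length. `L` must vary, since a second command starts from the
longer numbers left by the first. -/
theorem Cmd.time_le {N : ℕ} (hN : 2 ≤ N) (c : Cmd) (hc : c.tame = true) (L : ℕ) (s : State)
    (hs : s.Bdd L) (h0 : s.reg 0 = q) (hp : ∀ x, 1 ≤ x → x ≤ 6 → s.reg x ≤ N) :
    ∀ s' ∈ (c.run ν O s).support, s'.Bdd (L + c.ops N) ∧ (∀ x, x ≤ 6 → s'.reg x = s.reg x) ∧
      s'.time ≤ s.time + c.ops N * (L + c.ops N + 1) := by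
  have hq : 0 < q := Nat.pos_of_ne_zero (NeZero.ne q)
  have hval : ∀ {L : ℕ} {s : State}, s.Bdd L → s.reg 0 = q → ∀ v : ZMod q, v.val ≤ 2 ^ L := by
    intro L s hs h0 v
    have := hs.1 0
    have := ZMod.val_lt v
    omega
  have hset : ∀ {s : State} {x v t L L' : ℕ}, s.Bdd L → L ≤ L' → v ≤ 2 ^ L' →
      ((s.setReg x v).tick t).Bdd L' := by
    intro s x v t L L' hs hL hv
    refine ⟨fun y => ?_, (hs.mono hL).2⟩
    by_cases hy : y = x
    · subst hy; simpa [State.tick, State.setReg] using hv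
    · simpa [State.tick, State.setReg, hy] using (hs.mono hL).1 y
  have hreg : ∀ {s : State} {x v t : ℕ}, 7 ≤ x → ∀ y, y ≤ 6 →
      ((s.setReg x v).tick t).reg y = s.reg y := by
    intro s x v t hx y hy
    have : y ≠ x := by omega
    simp [State.tick, State.setReg, this]
  induction c generalizing L s with
  | skip =>
    intro s' hs'
    simp only [Cmd.run, PMF.support_pure, Set.mem_singleton_iff] at hs'
    subst hs'
    exact ⟨hs.mono (by omega), fun _ _ => rfl, by simp only [State.tick, Cmd.ops]; omega⟩
  | assign x e =>
    intro s' hs'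
    simp only [Cmd.run, PMF.support_pure, Set.mem_singleton_iff] at hs'
    simp only [Cmd.tame, Bool.and_eq_true, decide_eq_true_eq] at hc
    subst hs'
    refine ⟨hset hs (by omega) ((e.eval_le_of_tame hs (by omega) hc.2).trans
      (Nat.pow_le_pow_right (by norm_num) ?_)), hreg hc.1, ?_⟩
    · simp only [Cmd.ops]; omega
    · have := e.cost_le hs
      simp only [State.tick, State.setReg, Cmd.ops]
      nlinarith [Nat.zero_le (e.nodes ^ 2), Nat.zero_le (e.nodes * L)]
  | store a i j e =>
    intro s' hs'
    simp only [Cmd.run, PMF.support_pure, Set.mem_singleton_iff] at hs'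
    simp only [Cmd.tame] at hc
    subst hs'
    refine ⟨⟨(hs.mono (by omega)).1, fun a' i' j' => ?_⟩, fun _ _ => rfl, ?_⟩
    · simp only [State.tick, State.setMem]
      split_ifs
      · exact (e.eval_le_of_tame hs (by omega) hc).trans
          (Nat.pow_le_pow_right (by norm_num) (by simp only [Cmd.ops]; omega))
      · exact (hs.mono (by omega)).2 a' i' j'
    · have h1 := e.cost_le hs
      have h2 := i.cost_le hs
      have h3 := j.cost_le hs
      have h4 : 1 + 3 * i.nodes ^ 2 * (L + 1) + 3 * j.nodes ^ 2 * (L + 1)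
          + 3 * e.nodes ^ 2 * (L + 1) ≤
          (1 + e.nodes + 3 * i.nodes ^ 2 + 3 * j.nodes ^ 2 + 3 * e.nodes ^ 2) * (L + 1) := by
        nlinarith [Nat.zero_le (e.nodes * L)]
      have h5 := Nat.mul_le_mul_left
        (1 + e.nodes + 3 * i.nodes ^ 2 + 3 * j.nodes ^ 2 + 3 * e.nodes ^ 2)
        (show L + 1 ≤ L + (Cmd.store a i j e).ops N + 1 by omega)
      simp only [State.tick, State.setMem, Cmd.ops] at *
      omega
  | unif x e =>
    intro s' hs'
    simp only [Cmd.run, PMF.support_map, Set.mem_image] at hs'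
    simp only [Cmd.tame, Bool.and_eq_true, decide_eq_true_eq] at hc
    obtain ⟨v, hv, rfl⟩ := hs'
    have hv' : v ≤ 2 ^ (L + e.nodes) :=
      (mem_support_unifBelow hv).trans (e.eval_le_of_tame hs (by omega) hc.2)
    refine ⟨hset hs (by omega) (hv'.trans
      (Nat.pow_le_pow_right (by norm_num) ?_)), hreg hc.1, ?_⟩
    · simp only [Cmd.ops]; omega
    · have h1 := e.cost_le hs
      have h2 := size_le_of_le_two_pow hv'
      simp only [State.tick, State.setReg, Cmd.ops]
      nlinarith [Nat.zero_le (e.nodes ^ 2), Nat.zero_le (e.nodes * L)]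
  | noise x =>
    intro s' hs'
    simp only [Cmd.run, PMF.support_map, Set.mem_image] at hs'
    simp only [Cmd.tame, decide_eq_true_eq] at hc
    obtain ⟨v, hv, rfl⟩ := hs'
    refine ⟨hset hs (by omega) ((hval hs h0 v).trans
      (Nat.pow_le_pow_right (by norm_num) (by omega))), hreg hc, ?_⟩
    have h2 := size_le_of_le_two_pow (hval hs h0 v)
    simp only [State.tick, State.setReg, Cmd.ops]
    omega
  | query =>
    intro s' hs'
    simp only [Cmd.run, PMF.support_map, Set.mem_image] at hs'
    obtain ⟨z, hz, rfl⟩ := hs'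
    refine ⟨⟨(hs.mono (by omega)).1, fun a' i' j' => ?_⟩, fun _ _ => rfl, ?_⟩
    · simp only [State.tick, State.writeVec]
      split_ifs
      · exact (hval hs h0 _).trans (Nat.pow_le_pow_right (by norm_num) (by omega))
      · exact (hs.mono (by omega)).2 a' i' j'
    · simp only [State.tick, State.writeVec, Cmd.ops]; omega
  | seq c d ihc ihd =>
    intro s' hs'
    simp only [Cmd.run, PMF.mem_support_bind_iff] at hs'
    simp only [Cmd.tame, Bool.and_eq_true] at hc
    obtain ⟨s₁, h₁, h₂⟩ := hs'
    obtain ⟨b1, p1, t1⟩ := ihc hc.1 L s hs h0 hp s₁ h₁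
    obtain ⟨b2, p2, t2⟩ := ihd hc.2 _ s₁ b1 (by rw [p1 0 (by omega), h0])
      (fun x hx hx' => by rw [p1 x hx']; exact hp x hx hx') s' h₂
    refine ⟨b2.mono (by simp only [Cmd.ops]; omega),
      fun x hx => (p2 x hx).trans (p1 x hx), ?_⟩
    simp only [Cmd.ops]
    nlinarith [Nat.zero_le (c.ops N * d.ops N)]
  | cond e c d ihc ihd =>
    intro s' hs'
    simp only [Cmd.tame, Bool.and_eq_true] at hc
    have h1 := e.cost_le hs
    simp only [Cmd.run] at hs'
    split_ifs at hs'
    · obtain ⟨b1, p1, t1⟩ := ihc hc.1 L (s.tick (1 + e.cost s)) hs h0 hp s' hs'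
      refine ⟨b1.mono (by simp only [Cmd.ops]; omega), p1, ?_⟩
      simp only [Cmd.ops, State.tick] at *
      nlinarith [Nat.zero_le (c.ops N * d.ops N), Nat.zero_le (c.ops N * e.nodes ^ 2),
        Nat.zero_le (d.ops N * L), Nat.zero_le (e.nodes ^ 2 * e.nodes ^ 2),
        Nat.zero_le (e.nodes ^ 2 * c.ops N), Nat.zero_le (e.nodes ^ 2 * d.ops N)]
    · obtain ⟨b1, p1, t1⟩ := ihd hc.2 L (s.tick (1 + e.cost s)) hs h0 hp s' hs'
      refine ⟨b1.mono (by simp only [Cmd.ops]; omega), p1, ?_⟩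
      simp only [Cmd.ops, State.tick] at *
      nlinarith [Nat.zero_le (c.ops N * d.ops N), Nat.zero_le (c.ops N * e.nodes ^ 2),
        Nat.zero_le (c.ops N * L), Nat.zero_le (e.nodes ^ 2 * e.nodes ^ 2),
        Nat.zero_le (e.nodes ^ 2 * c.ops N), Nat.zero_le (e.nodes ^ 2 * d.ops N)]
  | loop e c ih =>
    simp only [Cmd.tame, Bool.and_eq_true] at hc
    have h1 := e.cost_le hs
    have hv := e.eval_le_of_isParam hN hp hc.1
    -- The summand `1` in `c.ops N + 1` pays for the step charged per round.
    have key : ∀ j : ℕ, ∀ s' ∈ ((fun p : PMF State =>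
        p.bind fun s' => c.run ν O (s'.tick 1))^[j] (PMF.pure (s.tick (1 + e.cost s)))).support,
        s'.Bdd (L + (1 + 3 * e.nodes ^ 2 + j * (c.ops N + 1))) ∧
        (∀ x, x ≤ 6 → s'.reg x = s.reg x) ∧
        s'.time ≤ s.time + (1 + 3 * e.nodes ^ 2 + j * (c.ops N + 1)) *
          (L + (1 + 3 * e.nodes ^ 2 + j * (c.ops N + 1)) + 1) := by
      intro j
      induction j with
      | zero =>
        intro s' hs'
        simp only [Function.iterate_zero, id, PMF.support_pure, Set.mem_singleton_iff] at hs'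
        subst hs'
        refine ⟨State.Bdd.mono (L := L) (s := s.tick _) hs (by omega), fun _ _ => rfl, ?_⟩
        simp only [State.tick]
        nlinarith [Nat.zero_le (e.nodes ^ 2 * e.nodes ^ 2)]
      | succ j ihj =>
        intro s' hs'
        rw [Function.iterate_succ_apply', PMF.mem_support_bind_iff] at hs'
        obtain ⟨s₁, h₁, h₂⟩ := hs'
        obtain ⟨b1, p1, t1⟩ := ihj s₁ h₁
        obtain ⟨b2, p2, t2⟩ := ih hc.2 _ (s₁.tick 1) b1
          (by rw [← h0]; exact p1 0 (by omega))
          (fun x hx hx' => by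
            have := hp x hx hx'
            rw [← p1 x hx'] at this
            exact this) s' h₂
        have hj : 1 + 3 * e.nodes ^ 2 + (j + 1) * (c.ops N + 1) =
            1 + 3 * e.nodes ^ 2 + j * (c.ops N + 1) + (c.ops N + 1) := by ring
        rw [hj]
        refine ⟨b2.mono (by omega), fun x hx => (p2 x hx).trans (p1 x hx), ?_⟩
        have h3 := time_step (A := 1 + 3 * e.nodes ^ 2 + j * (c.ops N + 1)) (G := c.ops N) (L := L)
        simp only [State.tick] at t2
        omega
    intro s' hs'
    obtain ⟨b1, p1, t1⟩ := key _ s' hs'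
    have h5 : 1 + 3 * e.nodes ^ 2 + e.eval s * (c.ops N + 1) ≤ (Cmd.loop e c).ops N := by
      simp only [Cmd.ops]
      gcongr
    refine ⟨b1.mono (by omega), p1, t1.trans ?_⟩
    gcongr

end

/-! ### Reasoning about the support of a run -/

theorem bind_congr_support {α β : Type*} {p : PMF α} {f g : α → PMF β}
    (h : ∀ a ∈ p.support, f a = g a) : p.bind f = p.bind g := by
  ext b
  rw [PMF.bind_apply, PMF.bind_apply]
  refine tsum_congr fun a => ?_
  by_cases ha : p a = 0
  · simp [ha]
  · rw [h a ((p.mem_support_iff a).2 ha)]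

theorem map_congr_support {α β : Type*} {p : PMF α} {f g : α → β}
    (h : ∀ a ∈ p.support, f a = g a) : p.map f = p.map g := by
  rw [← PMF.bind_pure_comp, ← PMF.bind_pure_comp]
  exact bind_congr_support fun a ha => by simp [h a ha]

/-- The composition rule for views: if what follows an intermediate state depends, as far as the
final view `h` is concerned, only on its view `g`, then the two laws compose as a law followed by a
kernel. -/
theorem map_bind_eq_bind_map {α α' β β' : Type*} {p : PMF α} {f : α → PMF α'} {g : α → β}
    {h : α' → β'} {κ : β → PMF β'} (H : ∀ a ∈ p.support, (f a).map h = κ (g a)) :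
    (p.bind f).map h = (p.map g).bind κ := by
  rw [PMF.map_bind, PMF.bind_map]
  exact bind_congr_support H

/-- The registers that a program may change. -/
def Cmd.regs : Cmd → List ℕ
  | .skip => []
  | .assign x _ => [x]
  | .store _ _ _ _ => []
  | .unif x _ => [x]
  | .noise x => [x]
  | .query => []
  | .seq c d => c.regs ++ d.regs
  | .cond _ c d => c.regs ++ d.regs
  | .loop _ c => c.regs

/-- The arrays that a program may change. -/
def Cmd.arrs : Cmd → List ℕ
  | .skip => []
  | .assign _ _ => []
  | .store a _ _ _ => [a]
  | .unif _ _ => []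
  | .noise _ => []
  | .query => [4]
  | .seq c d => c.arrs ++ d.arrs
  | .cond _ c d => c.arrs ++ d.arrs
  | .loop _ c => c.arrs

/-- The two states differ only in registers and arrays that the program may change. -/
structure Frame (c : Cmd) (s s' : State) : Prop where
  reg : ∀ x, x ∉ c.regs → s'.reg x = s.reg x
  mem : ∀ a, a ∉ c.arrs → s'.mem a = s.mem a

theorem Frame.trans {c : Cmd} {s s' s'' : State} (h : Frame c s s') (h' : Frame c s' s'') :
    Frame c s s'' :=
  ⟨fun x hx => (h'.reg x hx).trans (h.reg x hx), fun a ha => (h'.mem a ha).trans (h.mem a ha)⟩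

theorem Frame.mono {c d : Cmd} {s s' : State} (h : Frame c s s') (hr : c.regs ⊆ d.regs)
    (ha : c.arrs ⊆ d.arrs) : Frame d s s' :=
  ⟨fun x hx => h.reg x fun h' => hx (hr h'), fun a h'' => h.mem a fun h' => h'' (ha h')⟩

/-- `for x := 0, …, e - 1 do c`. -/
def Cmd.forLoop (x : ℕ) (e : Expr) (c : Cmd) : Cmd :=
  .seq (.assign x (.const 0)) (.loop e (.seq c (.assign x (.bin .add (.reg x) (.const 1)))))

section
variable {q l m : ℕ} (ν : PMF (ZMod q)) (O : Solver q l m)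

/-- The lists `regs` and `arrs` are syntactic, so for concrete programs the side conditions of a
frame are settled by `decide`. -/
theorem frame_of_mem_support {c : Cmd} {s s' : State} (h : s' ∈ (c.run ν O s).support) :
    Frame c s s' := by
  have hset : ∀ (x v t : ℕ) (s : State) (y : ℕ), y ∉ [x] →
      ((s.setReg x v).tick t).reg y = s.reg y := by
    intro x v t s y hy
    rw [List.mem_singleton] at hy
    simp [State.tick, State.setReg, hy]
  induction c generalizing s s' with
  | skip =>
    simp only [Cmd.run, PMF.support_pure, Set.mem_singleton_iff] at h
    subst h
    exact ⟨fun _ _ => rfl, fun _ _ => rfl⟩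
  | assign x e =>
    simp only [Cmd.run, PMF.support_pure, Set.mem_singleton_iff] at h
    subst h
    exact ⟨hset _ _ _ _, fun _ _ => rfl⟩
  | store a i j e =>
    simp only [Cmd.run, PMF.support_pure, Set.mem_singleton_iff] at h
    subst h
    refine ⟨fun _ _ => rfl, fun a' ha => ?_⟩
    simp only [Cmd.arrs, List.mem_singleton] at ha
    funext i' j'
    simp [State.tick, State.setMem, ha]
  | unif x e =>
    simp only [Cmd.run, PMF.support_map, Set.mem_image] at h
    obtain ⟨v, -, rfl⟩ := h
    exact ⟨hset _ _ _ _, fun _ _ => rfl⟩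
  | noise x =>
    simp only [Cmd.run, PMF.support_map, Set.mem_image] at h
    obtain ⟨v, -, rfl⟩ := h
    exact ⟨hset _ _ _ _, fun _ _ => rfl⟩
  | query =>
    simp only [Cmd.run, PMF.support_map, Set.mem_image] at h
    obtain ⟨v, -, rfl⟩ := h
    refine ⟨fun _ _ => rfl, fun a' ha => ?_⟩
    simp only [Cmd.arrs, List.mem_singleton] at ha
    funext i' j'
    simp [State.tick, State.writeVec, ha]
  | seq c d ihc ihd =>
    simp only [Cmd.run, PMF.mem_support_bind_iff] at h
    obtain ⟨s₁, h₁, h₂⟩ := h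
    exact ((ihc h₁).mono (by simp [Cmd.regs]) (by simp [Cmd.arrs])).trans
      ((ihd h₂).mono (by simp [Cmd.regs]) (by simp [Cmd.arrs]))
  | cond e c d ihc ihd =>
    simp only [Cmd.run] at h
    split_ifs at h
    · exact ⟨((ihc h).mono (by simp [Cmd.regs]) (by simp [Cmd.arrs]) :
        Frame (.cond e c d) _ _).reg, ((ihc h).mono (by simp [Cmd.regs])
          (by simp [Cmd.arrs]) : Frame (.cond e c d) _ _).mem⟩
    · exact ⟨((ihd h).mono (by simp [Cmd.regs]) (by simp [Cmd.arrs]) :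
        Frame (.cond e c d) _ _).reg, ((ihd h).mono (by simp [Cmd.regs])
          (by simp [Cmd.arrs]) : Frame (.cond e c d) _ _).mem⟩
  | loop e c ih =>
    simp only [Cmd.run] at h
    generalize e.eval s = N at h
    induction N generalizing s' with
    | zero =>
      simp only [Function.iterate_zero, id, PMF.support_pure, Set.mem_singleton_iff] at h
      subst h
      exact ⟨fun _ _ => rfl, fun _ _ => rfl⟩
    | succ N ihN =>
      rw [Function.iterate_succ_apply', PMF.mem_support_bind_iff] at h
      obtain ⟨s₁, h₁, h₂⟩ := h
      have h3 := ih h₂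
      exact (ihN h₁).trans ⟨h3.reg, h3.mem⟩

/-- Every possible final state satisfies `Q`. -/
def Ensures (c : Cmd) (s : State) (Q : State → Prop) : Prop :=
  ∀ s' ∈ (c.run ν O s).support, Q s'

variable {ν O}

theorem Ensures.mono {c : Cmd} {s : State} {Q Q' : State → Prop} (h : Ensures ν O c s Q)
    (H : ∀ s', Frame c s s' → Q s' → Q' s') : Ensures ν O c s Q' :=
  fun s' hs' => H s' (frame_of_mem_support ν O hs') (h s' hs')

theorem Ensures.seq {c d : Cmd} {s : State} {Q Q' : State → Prop} (h : Ensures ν O c s Q)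
    (H : ∀ s', Frame c s s' → Q s' → Ensures ν O d s' Q') : Ensures ν O (.seq c d) s Q' := by
  intro s' hs'
  simp only [Cmd.run, PMF.mem_support_bind_iff] at hs'
  obtain ⟨s₁, h₁, h₂⟩ := hs'
  exact H s₁ (frame_of_mem_support ν O h₁) (h s₁ h₁) s' h₂

theorem Ensures.assign {x : ℕ} {e : Expr} {s : State} {Q : State → Prop}
    (h : ∀ t, Q ((s.setReg x (e.eval s)).tick t)) : Ensures ν O (.assign x e) s Q := by
  intro s' hs'
  simp only [Cmd.run, PMF.support_pure, Set.mem_singleton_iff] at hs'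
  exact hs' ▸ h _

theorem Ensures.store {a : ℕ} {i j e : Expr} {s : State} {Q : State → Prop}
    (h : ∀ t, Q ((s.setMem a (i.eval s) (j.eval s) (e.eval s)).tick t)) :
    Ensures ν O (.store a i j e) s Q := by
  intro s' hs'
  simp only [Cmd.run, PMF.support_pure, Set.mem_singleton_iff] at hs'
  exact hs' ▸ h _

theorem Ensures.cond {e : Expr} {c d : Cmd} {s : State} {Q : State → Prop}
    (h₁ : e.eval s ≠ 0 → ∀ t, Ensures ν O c (s.tick t) Q)
    (h₂ : e.eval s = 0 → ∀ t, Ensures ν O d (s.tick t) Q) : Ensures ν O (.cond e c d) s Q := by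
  intro s' hs'
  simp only [Cmd.run] at hs'
  split_ifs at hs' with h
  · exact h₁ h _ s' hs'
  · exact h₂ (not_not.1 h) _ s' hs'

variable (ν O) in
/-- The law of the state after `j` rounds of a `for` loop. -/
noncomputable def forPartial (x : ℕ) (e : Expr) (c : Cmd) (s : State) (j : ℕ) : PMF State :=
  (fun p : PMF State => p.bind fun s' =>
    (Cmd.seq c (.assign x (.bin .add (.reg x) (.const 1)))).run ν O (s'.tick 1))^[j]
    (PMF.pure (((s.setReg x 0).tick (1 + Expr.cost s (.const 0))).tick
      (1 + e.cost ((s.setReg x 0).tick (1 + Expr.cost s (.const 0))))))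

/-- The number of rounds is evaluated after the counter has been reset and the clock has advanced,
whence the form of `hN`. -/
theorem run_forLoop {x : ℕ} {e : Expr} {c : Cmd} {s : State} {N : ℕ}
    (hN : ∀ t, e.eval ((s.setReg x 0).tick t) = N) :
    (Cmd.forLoop x e c).run ν O s = forPartial ν O x e c s N := by
  rw [← hN (1 + Expr.cost s (.const 0))]
  simp only [Cmd.forLoop, Cmd.run, PMF.pure_bind, Expr.eval]
  rfl

theorem forPartial_succ {x : ℕ} {e : Expr} {c : Cmd} {s : State} {j : ℕ} :
    forPartial ν O x e c s (j + 1) = (forPartial ν O x e c s j).bind fun s₁ =>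
      (c.run ν O (s₁.tick 1)).map fun s₂ => (s₂.setReg x (s₂.reg x + 1)).tick
        (1 + Expr.cost s₂ (.bin .add (.reg x) (.const 1))) := by
  rw [forPartial, Function.iterate_succ_apply']
  refine congrArg _ (funext fun s₁ => ?_)
  simp only [Cmd.run, ← PMF.bind_pure_comp]
  rfl

/-- The two states agree up to the clock and the register `x`. -/
def EqOff (x : ℕ) (s s' : State) : Prop :=
  s'.mem = s.mem ∧ ∀ y, y ≠ x → s'.reg y = s.reg y

theorem eqOff_tick (x t : ℕ) (s : State) : EqOff x s (s.tick t) := ⟨rfl, fun _ _ => rfl⟩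

theorem eqOff_setReg_tick (x v t : ℕ) (s : State) : EqOff x s ((s.setReg x v).tick t) :=
  ⟨rfl, fun y hy => by simp [State.tick, State.setReg, hy]⟩

theorem frame_forLoop_of_eqOff {x : ℕ} {e : Expr} {c : Cmd} {s s' : State} (h : EqOff x s s') :
    Frame (.forLoop x e c) s s' :=
  ⟨fun y hy => h.2 y fun hxy => hy (by simp [Cmd.forLoop, Cmd.regs, hxy]),
    fun a _ => by rw [h.1]⟩

theorem frame_forLoop_of_frame {x : ℕ} {e : Expr} {c : Cmd} {s s' : State} (h : Frame c s s') :
    Frame (.forLoop x e c) s s' :=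
  h.mono (by simp [Cmd.forLoop, Cmd.regs]) (by simp [Cmd.forLoop, Cmd.arrs])

/-- Between two runs of the body only the clock and the counter change, and `hI` makes the invariant
blind to both. Since the body leaves `x` alone, the counter equals the number of rounds done. -/
theorem forPartial_invariant {x : ℕ} {e : Expr} {c : Cmd} {s : State} {N : ℕ}
    {I : ℕ → State → Prop} (hx : x ∉ c.regs)
    (hI : ∀ j s s', EqOff x s s' → I j s → I j s') (h0 : I 0 s)
    (hs : ∀ j < N, ∀ s', Frame (.forLoop x e c) s s' → s'.reg x = j → I j s' →
      Ensures ν O c s' (I (j + 1))) :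
    ∀ j ≤ N, ∀ s' ∈ (forPartial ν O x e c s j).support,
      s'.reg x = j ∧ Frame (.forLoop x e c) s s' ∧ I j s' := by
  intro j
  induction j with
  | zero =>
    intro _ s' hs'
    simp only [forPartial, Function.iterate_zero, id, PMF.support_pure,
      Set.mem_singleton_iff] at hs'
    subst hs'
    have h1 : EqOff x s (((s.setReg x 0).tick (1 + Expr.cost s (.const 0))).tick
      (1 + e.cost ((s.setReg x 0).tick (1 + Expr.cost s (.const 0))))) :=
      ⟨rfl, fun y hy => by simp [State.tick, State.setReg, hy]⟩
    exact ⟨by simp [State.tick, State.setReg], frame_forLoop_of_eqOff h1, hI _ _ _ h1 h0⟩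
  | succ j ih =>
    intro hj s' hs'
    rw [forPartial_succ, PMF.mem_support_bind_iff] at hs'
    obtain ⟨s₁, h₁, h₂⟩ := hs'
    rw [PMF.support_map, Set.mem_image] at h₂
    obtain ⟨s₂, h₂, rfl⟩ := h₂
    obtain ⟨r1, f1, i1⟩ := ih (by omega) s₁ h₁
    have f2 : Frame (.forLoop x e c) s (s₁.tick 1) :=
      f1.trans (frame_forLoop_of_eqOff (eqOff_tick x 1 s₁))
    have i2 := hs j (by omega) (s₁.tick 1) f2 r1 (hI _ _ _ (eqOff_tick x 1 s₁) i1) s₂ h₂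
    have f3 := frame_of_mem_support ν O h₂
    have h4 := eqOff_setReg_tick x (s₂.reg x + 1)
      (1 + Expr.cost s₂ (.bin .add (.reg x) (.const 1))) s₂
    refine ⟨?_, (f2.trans (frame_forLoop_of_frame f3)).trans (frame_forLoop_of_eqOff h4),
      hI _ _ _ h4 i2⟩
    have : s₂.reg x = j := by rw [f3.reg x hx]; exact r1
    simp [State.tick, State.setReg, this]

theorem Ensures.forLoop {x : ℕ} {e : Expr} {c : Cmd} {s : State} {N : ℕ} {I : ℕ → State → Prop}
    (hN : ∀ t, e.eval ((s.setReg x 0).tick t) = N) (hx : x ∉ c.regs)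
    (hI : ∀ j s s', EqOff x s s' → I j s → I j s') (h0 : I 0 s)
    (hs : ∀ j < N, ∀ s', Frame (.forLoop x e c) s s' → s'.reg x = j → I j s' →
      Ensures ν O c s' (I (j + 1))) :
    Ensures ν O (.forLoop x e c) s (I N) := by
  intro s' hs'
  rw [run_forLoop hN] at hs'
  exact (forPartial_invariant hx hI h0 hs N le_rfl s' hs').2.2

/-! ### Laws of views of the final state -/

theorem iid_apply {ι α : Type} [Fintype ι] [DecidableEq ι] [Fintype α] (μ : PMF α) (f : ι → α) :
    iid μ f = ∏ i, μ (f i) := rfl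

theorem iid_fin_succ {β : Type} [Fintype β] (μ : PMF β) (j : ℕ) :
    (iid μ : PMF (Fin (j + 1) → β)) = (iid μ : PMF (Fin j → β)).bind fun f =>
      μ.map fun b => (Fin.snoc f b : Fin (j + 1) → β) := by
  ext g
  rw [PMF.bind_apply, tsum_eq_single (Fin.init g), PMF.map_apply, tsum_eq_single (g (Fin.last j)),
    if_pos (by simp), iid_apply, iid_apply, Fin.prod_univ_castSucc]
  · rfl
  · intro b hb
    rw [if_neg]
    intro h
    exact hb (by rw [h]; simp)
  · intro f hf
    rw [PMF.map_apply, ENNReal.tsum_eq_zero.2, mul_zero]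
    intro b
    rw [if_neg]
    intro h
    exact hf (by rw [h]; simp)

/-- Round `j` gives its own view the law `μ` from every state it can start in, and does not disturb
the earlier views. The new view is therefore independent of the earlier ones, and `iid_fin_succ`
appends it. -/
theorem map_forLoop_iid {β : Type} [Fintype β] {x : ℕ} {e : Expr} {c : Cmd} {s : State} {N : ℕ}
    (μ : PMF β) (v : ℕ → State → β) (hN : ∀ t, e.eval ((s.setReg x 0).tick t) = N)
    (hx : x ∉ c.regs) (hv : ∀ j s s', EqOff x s s' → v j s' = v j s)
    (hs : ∀ j < N, ∀ s', Frame (.forLoop x e c) s s' → s'.reg x = j →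
      (c.run ν O s').map (v j) = μ ∧ Ensures ν O c s' fun s'' => ∀ i < j, v i s'' = v i s') :
    ((Cmd.forLoop x e c).run ν O s).map (fun s' (i : Fin N) => v i s') = iid μ := by
  rw [run_forLoop hN]
  have hinv := forPartial_invariant (ν := ν) (O := O) (x := x) (e := e) (c := c) (s := s) (N := N)
    (I := fun _ _ => True) hx (fun _ _ _ _ h => h) trivial
    (fun _ _ _ _ _ _ _ _ => trivial)
  have key : ∀ j ≤ N, (forPartial ν O x e c s j).map (fun s' (i : Fin j) => v i s') = iid μ := by
    intro j
    induction j with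
    | zero =>
      intro _
      -- There is only one law on a one-point type.
      have : ∀ p p' : PMF (Fin 0 → β), p = p' := by
        intro p p'
        have hp : ∀ p : PMF (Fin 0 → β), p default = 1 := fun p => by
          rw [PMF.apply_eq_one_iff]
          exact (p.support_nonempty).eq_univ.trans (by ext; simp [Unique.eq_default])
        ext f
        rw [Unique.eq_default f, hp, hp]
      exact this _ _
    | succ j ih =>
      intro hj
      rw [iid_fin_succ, ← ih (by omega), forPartial_succ]
      refine map_bind_eq_bind_map fun s₁ h₁ => ?_
      obtain ⟨r1, f1, -⟩ := hinv j (by omega) s₁ h₁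
      obtain ⟨hm, he⟩ := hs j (by omega) (s₁.tick 1)
        (f1.trans (frame_forLoop_of_eqOff (eqOff_tick x 1 s₁))) r1
      rw [← hm, PMF.map_comp, PMF.map_comp]
      refine map_congr_support fun s₂ h₂ => ?_
      have h4 := eqOff_setReg_tick x (s₂.reg x + 1)
        (1 + Expr.cost s₂ (.bin .add (.reg x) (.const 1))) s₂
      funext i
      refine Fin.lastCases ?_ (fun i => ?_) i
      · simp only [Function.comp_apply, Fin.val_last, Fin.snoc_last]
        exact hv _ _ _ h4
      · simp only [Function.comp_apply, Fin.val_castSucc, Fin.snoc_castSucc]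
        rw [hv _ _ _ h4, he s₂ h₂ i i.2, hv _ _ _ (eqOff_tick x 1 s₁)]
  exact key N le_rfl

/-- Compose the first `j` members of a sequence of kernels. -/
noncomputable def iterKernel {α : Type} (K : ℕ → α → PMF α) (a : α) : ℕ → PMF α
  | 0 => PMF.pure a
  | j + 1 => (iterKernel K a j).bind (K j)

/-- If each round acts on the view through a kernel, the view is a Markov chain, no matter what the
rest of the state does. -/
theorem map_forLoop_kernel {α : Type} {x : ℕ} {e : Expr} {c : Cmd} {s : State} {N : ℕ}
    (K : ℕ → α → PMF α) (v : State → α) (hN : ∀ t, e.eval ((s.setReg x 0).tick t) = N)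
    (hx : x ∉ c.regs) (hv : ∀ s s', EqOff x s s' → v s' = v s)
    (hs : ∀ j < N, ∀ s', Frame (.forLoop x e c) s s' → s'.reg x = j →
      (c.run ν O s').map v = K j (v s')) :
    ((Cmd.forLoop x e c).run ν O s).map v = iterKernel K (v s) N := by
  rw [run_forLoop hN]
  have hinv := forPartial_invariant (ν := ν) (O := O) (x := x) (e := e) (c := c) (s := s) (N := N)
    (I := fun _ _ => True) hx (fun _ _ _ _ h => h) trivial
    (fun _ _ _ _ _ _ _ _ => trivial)
  have key : ∀ j ≤ N, (forPartial ν O x e c s j).map v = iterKernel K (v s) j := by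
    intro j
    induction j with
    | zero =>
      intro _
      simp only [forPartial, Function.iterate_zero, id, PMF.pure_map, iterKernel]
      rw [hv s]
      exact ⟨rfl, fun y hy => by simp [State.tick, State.setReg, hy]⟩
    | succ j ih =>
      intro hj
      rw [iterKernel, ← ih (by omega), forPartial_succ]
      refine map_bind_eq_bind_map fun s₁ h₁ => ?_
      obtain ⟨r1, f1, -⟩ := hinv j (by omega) s₁ h₁
      have hm := hs j (by omega) (s₁.tick 1)
        (f1.trans (frame_forLoop_of_eqOff (eqOff_tick x 1 s₁))) r1
      rw [← hv _ _ (eqOff_tick x 1 s₁), ← hm, PMF.map_comp]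
      exact map_congr_support fun s₂ _ => hv _ _ (eqOff_setReg_tick _ _ _ _)
  exact key N le_rfl

end

/-! ### The laws of the elementary samplers -/

theorem pmf_ext_toReal {α : Type*} {p p' : PMF α} (h : ∀ x, (p x).toReal = (p' x).toReal) :
    p = p' :=
  PMF.ext fun x => (ENNReal.toReal_eq_toReal_iff' (p.apply_ne_top x) (p'.apply_ne_top x)).1 (h x)

theorem berQ_apply_toReal {q : ℕ} [NeZero q] {η : ℝ} (h : ∀ x : ZMod q, 0 ≤ berMass q η x)
    (x : ZMod q) : (berQ q η x).toReal = berMass q η x := by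
  rw [berQ, dif_pos h, PMF.ofFintype_apply, ENNReal.toReal_ofReal (h x)]

theorem unifBelow_apply (N v : ℕ) (hN : 0 < N) :
    unifBelow N v = if v < N then (N : ENNReal)⁻¹ else 0 := by
  have h : (Finset.range N).Nonempty := ⟨0, Finset.mem_range.2 hN⟩
  rw [unifBelow, dif_pos h, PMF.uniformOfFinset_apply]
  simp

theorem unifBelow_map_cast (q : ℕ) [NeZero q] :
    (unifBelow q).map (Nat.cast : ℕ → ZMod q) = PMF.uniformOfFintype (ZMod q) := by
  have hq : 0 < q := Nat.pos_of_ne_zero (NeZero.ne q)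
  ext x
  rw [PMF.map_apply, tsum_eq_single x.val, if_pos (by simp), unifBelow_apply _ _ hq,
    if_pos (ZMod.val_lt x), PMF.uniformOfFintype_apply, ZMod.card]
  intro v hv
  split_ifs with h
  · rw [unifBelow_apply _ _ hq, if_neg]
    intro hlt
    exact hv (by rw [h, ZMod.val_natCast_of_lt hlt])
  · rfl

/-- The shift by one maps `{0, …, q - 2}` bijectively onto the nonzero residues. -/
theorem unifBelow_pred_map_succ (q : ℕ) (hq : 2 ≤ q) (x : ZMod q) :
    (unifBelow (q - 1)).map (fun v => ((v + 1 : ℕ) : ZMod q)) x =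
      if x = 0 then 0 else ((q - 1 : ℕ) : ENNReal)⁻¹ := by
  have : NeZero q := ⟨by omega⟩
  have hq1 : 0 < q - 1 := by omega
  rw [PMF.map_apply]
  split_ifs with hx
  · rw [ENNReal.tsum_eq_zero]
    intro v
    split_ifs with h
    · rw [unifBelow_apply _ _ hq1, if_neg]
      intro hlt
      have h1 := congrArg ZMod.val h
      rw [hx, ZMod.val_natCast_of_lt (by omega)] at h1
      simp at h1
    · rfl
  · have hx0 : x.val ≠ 0 := fun h => hx ((ZMod.val_eq_zero x).1 h)
    have hxq := ZMod.val_lt x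
    rw [tsum_eq_single (x.val - 1), if_pos, unifBelow_apply _ _ hq1, if_pos (by omega)]
    · rw [Nat.sub_add_cancel (by omega)]; simp
    · intro v hv
      split_ifs with h
      · rw [unifBelow_apply _ _ hq1, if_neg]
        intro hlt
        have h1 := congrArg ZMod.val h
        rw [ZMod.val_natCast_of_lt (by omega)] at h1
        omega
      · rfl

/-- The rate `qσ / ((q - 1) n)` gives nonnegative masses. -/
theorem berMass_sparse {q n σ : ℕ} (hq : 2 ≤ q) (hn : 0 < n) (x : ZMod q) :
    berMass q ((q : ℝ) * σ / (((q : ℝ) - 1) * n)) x =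
      if x = 0 then ((n : ℝ) - σ) / n else σ / (((q : ℝ) - 1) * n) := by
  have hq' : (2 : ℝ) ≤ q := by exact_mod_cast hq
  have h1 : (q : ℝ) - 1 ≠ 0 := by linarith
  have h2 : (q : ℝ) ≠ 0 := by linarith
  have h3 : (n : ℝ) ≠ 0 := by positivity
  unfold berMass
  split_ifs
  · field_simp; ring
  · field_simp

/-- The rate may exceed `1` (for `σ = n` it is `q/(q-1)`), so this rests on `σ ≤ n` and not on the
rate being a probability. -/
theorem berMass_sparse_nonneg {q n σ : ℕ} (hq : 2 ≤ q) (hn : 0 < n) (hσ : σ ≤ n) (x : ZMod q) :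
    0 ≤ berMass q ((q : ℝ) * σ / (((q : ℝ) - 1) * n)) x := by
  have hq' : (2 : ℝ) ≤ q := by exact_mod_cast hq
  have h1 : (0 : ℝ) ≤ (q : ℝ) - 1 := by linarith
  have h2 : (0 : ℝ) ≤ (n : ℝ) - σ := by rw [sub_nonneg]; exact_mod_cast hσ
  rw [berMass_sparse hq hn]
  split_ifs <;> positivity

/-- The entry distribution is sampled exactly with uniform integers: a number below `n` is smaller
than `σ` with probability `σ/n`, and in that case a uniform nonzero residue is drawn. -/
theorem unifBelow_bind_sparse {q n σ : ℕ} [NeZero q] (hq : 2 ≤ q) (hn : 0 < n) (hσ : σ ≤ n) :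
    ((unifBelow n).bind fun u => if u < σ then
      (unifBelow (q - 1)).map (fun v => ((v + 1 : ℕ) : ZMod q)) else PMF.pure 0) =
      berQ q ((q : ℝ) * σ / (((q : ℝ) - 1) * n)) := by
  have hq' : (2 : ℝ) ≤ q := by exact_mod_cast hq
  have h1 : (q : ℝ) - 1 ≠ 0 := by linarith
  have h3 : (n : ℝ) ≠ 0 := by positivity
  refine pmf_ext_toReal fun x => ?_
  rw [berQ_apply_toReal (berMass_sparse_nonneg hq hn hσ), berMass_sparse hq hn, PMF.bind_apply,
    tsum_eq_sum (s := Finset.range n)]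
  · rw [ENNReal.toReal_sum]
    · have hterm : ∀ u ∈ Finset.range n, (unifBelow n u * (if u < σ then
          (unifBelow (q - 1)).map (fun v => ((v + 1 : ℕ) : ZMod q)) else PMF.pure 0) x).toReal =
          (n : ℝ)⁻¹ * (if u < σ then (if x = 0 then 0 else ((q : ℝ) - 1)⁻¹)
            else (if x = 0 then 1 else 0)) := by
        intro u hu
        rw [unifBelow_apply _ _ hn, if_pos (Finset.mem_range.1 hu), ENNReal.toReal_mul,
          ENNReal.toReal_inv, ENNReal.toReal_natCast]
        congr 1
        split_ifs with h2 h3 h3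
        · rw [unifBelow_pred_map_succ q hq, if_pos h3]; simp
        · rw [unifBelow_pred_map_succ q hq, if_neg h3, ENNReal.toReal_inv,
            ENNReal.toReal_natCast, Nat.cast_sub (by omega), Nat.cast_one]
        · simp [h3, PMF.pure_apply]
        · simp [h3, PMF.pure_apply]
      rw [Finset.sum_congr rfl hterm, ← Finset.mul_sum, Finset.sum_ite]
      have hc1 : ((Finset.range n).filter (· < σ)).card = σ := by
        have : (Finset.range n).filter (· < σ) = Finset.range σ := by
          ext u; simp only [Finset.mem_filter, Finset.mem_range]; omega
        rw [this, Finset.card_range]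
      have hc2 : ((Finset.range n).filter (fun u => ¬ u < σ)).card = n - σ := by
        have h := Finset.card_filter_add_card_filter_not (s := Finset.range n) (· < σ)
        rw [hc1, Finset.card_range] at h
        omega
      rw [Finset.sum_const, Finset.sum_const, hc1, hc2, nsmul_eq_mul, nsmul_eq_mul,
        Nat.cast_sub hσ]
      split_ifs <;> field_simp <;> ring
    · intro u _
      exact ENNReal.mul_ne_top (PMF.apply_ne_top _ _) (PMF.apply_ne_top _ _)
  · intro u hu
    rw [unifBelow_apply _ _ hn, if_neg (by simpa using hu), zero_mul]

/-- `reg 10 :=` a sample of the entry distribution of the matrix. -/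
def sampleSparse : Cmd :=
  .seq (.unif 10 (.reg 1)) (.cond (.bin .lt (.reg 10) (.reg 4))
    (.seq (.unif 10 (.bin .sub (.reg 0) (.const 1)))
      (.assign 10 (.bin .add (.reg 10) (.const 1))))
    (.assign 10 (.const 0)))

section
variable {q l m : ℕ} [NeZero q] {ν : PMF (ZMod q)} {O : Solver q l m}

theorem sampleSparse_law {n σ : ℕ} (hq : 2 ≤ q) (hn : 0 < n) (hσ : σ ≤ n) {s : State}
    (h0 : s.reg 0 = q) (h1 : s.reg 1 = n) (h4 : s.reg 4 = σ) :
    (sampleSparse.run ν O s).map (fun s' => (s'.reg 10 : ZMod q)) =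
      berQ q ((q : ℝ) * σ / (((q : ℝ) - 1) * n)) := by
  rw [← unifBelow_bind_sparse hq hn hσ]
  simp only [sampleSparse, Cmd.run, Expr.eval, h1, PMF.bind_map, PMF.map_bind]
  congr 1
  funext u
  have hlt : ∀ t, Op.lt.eval (((s.setReg 10 u).tick t).reg 10) (((s.setReg 10 u).tick t).reg 4) =
      if u < σ then 1 else 0 := by
    intro t
    simp [State.tick, State.setReg, h4, Op.eval]
  simp only [Function.comp_apply]
  by_cases hu : u < σ
  · rw [if_pos hu, if_pos (by rw [hlt, if_pos hu]; exact one_ne_zero), PMF.map_bind,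
      ← PMF.bind_pure_comp]
    have : ∀ t t', Op.sub.eval ((((s.setReg 10 u).tick t).tick t').reg 0) 1 = q - 1 := by
      intro t t'
      simp [State.tick, State.setReg, h0, Op.eval]
    rw [this]
    congr 1
    funext v
    simp [PMF.pure_map, State.tick, State.setReg, Op.eval]
  · rw [if_neg hu, if_neg (by rw [hlt, if_neg hu]; simp), PMF.pure_map]
    simp [State.tick, State.setReg]

theorem unif_law {s : State} (h0 : s.reg 0 = q) :
    ((Cmd.unif 10 (.reg 0)).run ν O s).map (fun s' => (s'.reg 10 : ZMod q)) =
      PMF.uniformOfFintype (ZMod q) := by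
  rw [← unifBelow_map_cast]
  simp only [Cmd.run, Expr.eval, h0, PMF.map_comp]
  congr 1

theorem noise_law {s : State} :
    ((Cmd.noise 10).run ν O s).map (fun s' => (s'.reg 10 : ZMod q)) = ν := by
  simp only [Cmd.run, PMF.map_comp]
  convert PMF.map_id ν
  funext v
  simp [State.tick, State.setReg]

/-! ### Filling arrays with samples -/

/-- Fill a row of the array `a` with samples. -/
def fillRow (a : ℕ) (r C : Expr) (S : Cmd) : Cmd :=
  .forLoop 9 C (.seq S (.store a r (.reg 9) (.reg 10)))

/-- Fill the array `a` with samples. -/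
def fillMat (a : ℕ) (R C : Expr) (S : Cmd) : Cmd :=
  .forLoop 8 R (fillRow a (.reg 8) C S)

/-- The row index may depend on the registers up to `8`, so that `reg 8` can be the row counter of
`fillMat`. The registers `9` and `10` hold the column counter and the current sample. -/
theorem fillRow_law {a : ℕ} {r C : Expr} {S : Cmd} {μ : PMF (ZMod q)} {s : State} {i NC : ℕ}
    (hreg : S.regs ⊆ [10]) (harr : S.arrs = [])
    (hr : ∀ s', (∀ x ≤ 8, s'.reg x = s.reg x) → r.eval s' = i)
    (hC : ∀ s', (∀ x ≤ 6, s'.reg x = s.reg x) → C.eval s' = NC)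
    (hS : ∀ s', (∀ x ≤ 6, s'.reg x = s.reg x) →
      (S.run ν O s').map (fun s' => (s'.reg 10 : ZMod q)) = μ) :
    ((fillRow a r C S).run ν O s).map (fun s' (j : Fin NC) => (s'.mem a i j : ZMod q)) =
      iid μ := by
  have hnotin : ∀ x, x ≠ 10 → x ∉ S.regs := fun x hx h => hx (List.mem_singleton.1 (hreg h))
  refine map_forLoop_iid μ (fun j s' => (s'.mem a i j : ZMod q)) ?_ ?_ ?_ ?_
  · intro t
    refine hC _ fun x hx => ?_
    simp [State.tick, State.setReg, show x ≠ 9 by omega]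
  · simpa [Cmd.regs] using hnotin 9 (by norm_num)
  · intro j s s' h
    simp only [h.1]
  · intro j _ s' hf hj
    have hpar : ∀ x ≤ 8, s'.reg x = s.reg x := fun x hx => hf.reg x (by
      simp only [Cmd.forLoop, Cmd.regs, List.mem_append, List.mem_singleton, List.append_nil, not_or]
      exact ⟨by omega, hnotin x (by omega), by omega⟩)
    have hstore : ∀ s₁ ∈ (S.run ν O s').support, ∀ t : ℕ, ∀ j' : ℕ,
        (((s₁.setMem a (r.eval s₁) ((Expr.reg 9).eval s₁) ((Expr.reg 10).eval s₁)).tick t).mem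
          a i j') = if j' = j then s₁.reg 10 else s'.mem a i j' := by
      intro s₁ h₁ t j'
      have hf1 := frame_of_mem_support ν O h₁
      have h9 : s₁.reg 9 = j := (hf1.reg 9 (hnotin 9 (by norm_num))).trans hj
      have hri : r.eval s₁ = i := hr s₁ fun x hx =>
        (hf1.reg x (hnotin x (by omega))).trans (hpar x hx)
      simp only [State.tick, State.setMem, hri, Expr.eval, h9, true_and]
      split_ifs with h
      · rfl
      · rw [hf1.mem a (by simp [harr])]
    constructor
    · rw [← hS s' fun x hx => hpar x (by omega)]
      simp only [Cmd.run]
      rw [PMF.map_bind, ← PMF.bind_pure_comp]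
      refine bind_congr_support fun s₁ h₁ => ?_
      rw [PMF.pure_map, hstore s₁ h₁, if_pos rfl]
      rfl
    · intro s'' hs'' j' hj'
      simp only [Cmd.run, PMF.mem_support_bind_iff, PMF.support_pure,
        Set.mem_singleton_iff] at hs''
      obtain ⟨s₁, h₁, rfl⟩ := hs''
      rw [hstore s₁ h₁, if_neg (by omega)]

theorem fillMat_law {a : ℕ} {R C : Expr} {S : Cmd} {μ : PMF (ZMod q)} {s : State} {NR NC : ℕ}
    (hreg : S.regs ⊆ [10]) (harr : S.arrs = [])
    (hR : ∀ s', (∀ x ≤ 6, s'.reg x = s.reg x) → R.eval s' = NR)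
    (hC : ∀ s', (∀ x ≤ 6, s'.reg x = s.reg x) → C.eval s' = NC)
    (hS : ∀ s', (∀ x ≤ 6, s'.reg x = s.reg x) →
      (S.run ν O s').map (fun s' => (s'.reg 10 : ZMod q)) = μ) :
    ((fillMat a R C S).run ν O s).map
      (fun s' (i : Fin NR) (j : Fin NC) => (s'.mem a i j : ZMod q)) = iid (iid μ) := by
  have hnotin : ∀ x, x ≠ 10 → x ∉ S.regs := fun x hx h => hx (List.mem_singleton.1 (hreg h))
  have hnotin' : ∀ x, x ≤ 8 → x ∉ (fillRow a (.reg 8) C S).regs := by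
    intro x hx
    simp only [fillRow, Cmd.forLoop, Cmd.regs, List.mem_append, List.mem_singleton, List.append_nil,
      not_or]
    exact ⟨by omega, hnotin x (by omega), by omega⟩
  refine map_forLoop_iid (iid μ) (fun i s' (j : Fin NC) => (s'.mem a i j : ZMod q)) ?_ ?_ ?_ ?_
  · intro t
    refine hR _ fun x hx => ?_
    simp [State.tick, State.setReg, show x ≠ 8 by omega]
  · exact hnotin' 8 le_rfl
  · intro j s s' h
    simp only [h.1]
  · intro i _ s' hf hi
    have hpar : ∀ x ≤ 6, s'.reg x = s.reg x := fun x hx => hf.reg x (by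
      have := hnotin' x (by omega)
      rw [Cmd.forLoop]
      simp only [Cmd.regs, List.mem_append, List.mem_singleton, not_or]
      exact ⟨by omega, this, by omega⟩)
    have hpar' : ∀ {s'' : State}, (∀ x ≤ 6, s''.reg x = s'.reg x) → ∀ x ≤ 6, s''.reg x = s.reg x :=
      fun h x hx => (h x hx).trans (hpar x hx)
    constructor
    · exact fillRow_law hreg harr (fun s'' h => (h 8 le_rfl).trans hi)
        (fun s'' h => hC s'' (hpar' h)) (fun s'' h => hS s'' (hpar' h))
    -- A frame speaks of whole arrays only. That the earlier rows survive needs the invariant that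
    -- every store goes to row `reg 8`, which is `i`.
    · refine Ensures.forLoop (N := NC) (I := fun _ s'' => ∀ i' < i,
        (fun (j : Fin NC) => (s''.mem a i' j : ZMod q)) =
        fun (j : Fin NC) => (s'.mem a i' j : ZMod q)) ?_ ?_ ?_ ?_ ?_
      · intro t
        refine hC _ fun x hx => ?_
        rw [← hpar x hx]
        simp [State.tick, State.setReg, show x ≠ 9 by omega]
      · simpa [Cmd.regs] using hnotin 9 (by norm_num)
      · intro j s s' h hI
        simpa only [h.1] using hI
      · exact fun _ _ => rfl
      · intro j _ s₀ hf₀ hj₀ hI s'' hs''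
        simp only [Cmd.run, PMF.mem_support_bind_iff, PMF.support_pure,
          Set.mem_singleton_iff] at hs''
        obtain ⟨s₁, h₁, rfl⟩ := hs''
        have hf1 := frame_of_mem_support ν O h₁
        have h8 : s₁.reg 8 = i := by
          rw [hf1.reg 8 (hnotin 8 (by norm_num)), hf₀.reg 8 (hnotin' 8 le_rfl), hi]
        intro i' hi'
        rw [← hI i' hi']
        funext j'
        simp only [State.tick, State.setMem, Expr.eval, h8, true_and]
        rw [if_neg (by omega), hf1.mem a (by simp [harr])]

end

/-! ### The reduction -/

/-- The dimension of the oracle's problem. -/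
def dimExpr : Expr := .bin .mul (.reg 3) (.reg 1)

/-- The column with number `reg 9` of the block `reg 7`. -/
def blockExpr : Expr := .bin .add (.reg 9) (.bin .mul (.reg 7) (.reg 1))

/-- Sample `k` fresh instances: their matrices form the array `2`, their secrets the array `6`, and
the columns of the array `7` are their noise vectors. -/
def sampleAll : Cmd :=
  .seq (fillMat 2 (.reg 2) dimExpr sampleSparse)
    (.seq (fillRow 6 (.const 0) dimExpr (.unif 10 (.reg 0)))
      (fillMat 7 (.reg 2) (.reg 3) (.noise 10)))

/-- Replace the matrix of the instance `reg 7` by the given one. -/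
def overwrite : Cmd :=
  .forLoop 8 (.reg 2) (.forLoop 9 (.reg 1)
    (.store 2 (.reg 8) blockExpr (.mem 0 (.reg 8) (.reg 9))))

/-- Replace the secret of the instance `reg 7` by zero. -/
def clearSecret : Cmd :=
  .forLoop 9 (.reg 1) (.store 6 (.const 0) blockExpr (.const 0))

/-- Replace the noise of the instance `reg 7` by zero. -/
def clearNoise : Cmd :=
  .forLoop 8 (.reg 2) (.store 7 (.reg 8) (.reg 7) (.const 0))

/-- `reg x := (reg x + e) mod q`. -/
def accumulate (x : ℕ) (e : Expr) : Cmd :=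
  .assign x (.bin .mod (.bin .add (.reg x) e) (.reg 0))

/-- Write the right-hand side of the query into the array `3`. -/
def computeRhs : Cmd :=
  .forLoop 8 (.reg 2)
    (.seq (.assign 10 (.mem 1 (.const 0) (.reg 8)))
      (.seq (.forLoop 9 dimExpr (accumulate 10
          (.bin .mul (.mem 2 (.reg 8) (.reg 9)) (.mem 6 (.const 0) (.reg 9)))))
        (.seq (.forLoop 9 (.reg 3) (accumulate 10 (.mem 7 (.reg 8) (.reg 9))))
          (.store 3 (.const 0) (.reg 8) (.reg 10)))))

/-- Count in the registers `12` and `13` the equations violated by the block `reg 7` of the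
oracle's answer and by the best candidate so far. -/
def countErrors : Cmd :=
  .seq (.assign 12 (.const 0)) (.seq (.assign 13 (.const 0))
    (.forLoop 8 (.reg 2)
      (.seq (.assign 10 (.const 0)) (.seq (.assign 11 (.const 0))
        (.seq (.forLoop 9 (.reg 1) (.seq
            (accumulate 10 (.bin .mul (.mem 0 (.reg 8) (.reg 9)) (.mem 4 (.const 0) blockExpr)))
            (accumulate 11 (.bin .mul (.mem 0 (.reg 8) (.reg 9)) (.mem 5 (.const 0) (.reg 9))))))
          (.seq (.assign 12 (.bin .add (.reg 12)
              (.bin .sub (.const 1) (.bin .eq (.reg 10) (.mem 1 (.const 0) (.reg 8))))))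
            (.assign 13 (.bin .add (.reg 13)
              (.bin .sub (.const 1) (.bin .eq (.reg 11) (.mem 1 (.const 0) (.reg 8))))))))))))

/-- Keep the better one of the two candidates in the array `5`. -/
def keepBetter : Cmd :=
  .seq countErrors (.cond (.bin .lt (.reg 12) (.reg 13))
    (.forLoop 9 (.reg 1) (.store 5 (.const 0) (.reg 9) (.mem 4 (.const 0) blockExpr))) .skip)

/-- Hide the given instance among `k - 1` fresh ones, query the oracle, and extract a candidate. -/
def trial : Cmd :=
  .seq sampleAll (.seq overwrite (.seq clearSecret (.seq clearNoise (.seq computeRhs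
    (.seq .query keepBetter)))))

/-- The reduction: for every position repeat the trial `4 k ⌈1/δ⌉ ⌈1/ε⌉` times. -/
def reduction : Cmd :=
  .forLoop 7 (.reg 3) (.forLoop 14
    (.bin .mul (.const 4) (.bin .mul (.reg 3) (.bin .mul (.reg 5) (.reg 6)))) trial)

/-- Products occur only under a remainder modulo `q`, inside indices, and as numbers of rounds. -/
theorem reduction_tame : reduction.tame = true := by decide

/-! ### Specifications of the steps of a trial -/

/-- The registers and arrays that describe the input are in place. -/
structure Ready {q n m : ℕ} (k σ : ℕ) (A : Matrix (Fin m) (Fin n) (ZMod q)) (b : Fin m → ZMod q)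
    (s : State) : Prop where
  reg0 : s.reg 0 = q
  reg1 : s.reg 1 = n
  reg2 : s.reg 2 = m
  reg3 : s.reg 3 = k
  reg4 : s.reg 4 = σ
  mem0 : ∀ (r : Fin m) (j : Fin n), s.mem 0 r j = (A r j).val
  mem1 : ∀ r : Fin m, s.mem 1 0 r = (b r).val

theorem Ready.frame {q n m k σ : ℕ} {A : Matrix (Fin m) (Fin n) (ZMod q)} {b : Fin m → ZMod q}
    {s s' : State} {c : Cmd} (h : Ready k σ A b s) (hf : Frame c s s')
    (hr : ∀ x ≤ 4, x ∉ c.regs) (h0 : 0 ∉ c.arrs) (h1 : 1 ∉ c.arrs) : Ready k σ A b s' where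
  reg0 := (hf.reg 0 (hr 0 (by norm_num))).trans h.reg0
  reg1 := (hf.reg 1 (hr 1 (by norm_num))).trans h.reg1
  reg2 := (hf.reg 2 (hr 2 (by norm_num))).trans h.reg2
  reg3 := (hf.reg 3 (hr 3 (by norm_num))).trans h.reg3
  reg4 := (hf.reg 4 (hr 4 (by norm_num))).trans h.reg4
  mem0 := by rw [hf.mem 0 h0]; exact h.mem0
  mem1 := by rw [hf.mem 1 h1]; exact h.mem1

/-- The law of the numbers drawn in a trial. -/
noncomputable def sampleLaw {q : ℕ} [NeZero q] (χ ν : PMF (ZMod q)) (m l k : ℕ) :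
    PMF ((Fin m → Fin l → ZMod q) × (Fin l → ZMod q) × (Fin m → Fin k → ZMod q)) :=
  (iid (iid χ)).bind fun M => (iid (PMF.uniformOfFintype (ZMod q))).bind fun t =>
    (iid (iid ν)).map fun W => (M, t, W)

section
variable {q n m k σ : ℕ} {ν : PMF (ZMod q)} {O : Solver q (k * n) m}
  {A : Matrix (Fin m) (Fin n) (ZMod q)} {b : Fin m → ZMod q}

theorem overwrite_spec {i : ℕ} {s : State} (h : Ready k σ A b s) (hi : s.reg 7 = i) :
    Ensures ν O overwrite s fun s' => ∀ r c, s'.mem 2 r c =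
      if r < m ∧ i * n ≤ c ∧ c < i * n + n then s.mem 0 r (c - i * n) else s.mem 2 r c := by
  refine Ensures.forLoop (N := m) (I := fun J s' => ∀ r c, s'.mem 2 r c =
      if r < J ∧ i * n ≤ c ∧ c < i * n + n then s.mem 0 r (c - i * n) else s.mem 2 r c)
    ?_ (by decide) ?_ ?_ ?_
  · intro t; simp [Expr.eval, State.tick, State.setReg, h.reg2]
  · intro j s₁ s₂ he hI; simpa only [he.1] using hI
  · simp
  · intro J _ s₁ hf₁ hJ hI
    have h1 := h.frame hf₁ (by decide) (by decide) (by decide)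
    have hi1 : s₁.reg 7 = i := (hf₁.reg 7 (by decide)).trans hi
    have hm1 := hf₁.mem 0 (by decide)
    refine (Ensures.forLoop (N := n) (I := fun K s' => ∀ r c, s'.mem 2 r c =
      if r = J ∧ i * n ≤ c ∧ c < i * n + K then s.mem 0 r (c - i * n) else s₁.mem 2 r c)
      ?_ (by decide) ?_ ?_ ?_).mono ?_
    · intro t; simp [Expr.eval, State.tick, State.setReg, h1.reg1]
    · intro j s₁ s₂ he hI; simpa only [he.1] using hI
    · intro r c
      rw [if_neg (by omega)]
    · intro K _ s₂ hf₂ hK hI2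
      refine Ensures.store fun t r c => ?_
      have e8 : s₂.reg 8 = J := (hf₂.reg 8 (by decide)).trans hJ
      have e7 : s₂.reg 7 = i := (hf₂.reg 7 (by decide)).trans hi1
      have e1 : s₂.reg 1 = n := (hf₂.reg 1 (by decide)).trans h1.reg1
      have em : s₂.mem 0 = s.mem 0 := (hf₂.mem 0 (by decide)).trans hm1
      simp only [State.tick, State.setMem, Expr.eval, Op.eval, blockExpr, e8, e7, e1, hK, em, hI2,
        true_and]
      generalize i * n = P
      by_cases hc : r = J ∧ c = K + P
      · rw [if_pos hc, if_pos (by omega), hc.1, hc.2, Nat.add_sub_cancel]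
      · rw [if_neg hc]
        exact if_congr (by omega) rfl rfl
    · intro s₂ _ h2 r c
      rw [h2, hI]
      generalize i * n = P
      by_cases hr : r = J
      · by_cases hc : P ≤ c ∧ c < P + n
        · rw [if_pos ⟨hr, hc⟩, if_pos ⟨by omega, hc⟩]
        · rw [if_neg (by tauto), if_neg (by tauto), if_neg (by tauto)]
      · rw [if_neg (by tauto)]
        exact if_congr (by omega) rfl rfl

theorem clearSecret_spec {i : ℕ} {s : State} (h : Ready k σ A b s) (hi : s.reg 7 = i) :
    Ensures ν O clearSecret s fun s' => ∀ c, s'.mem 6 0 c =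
      if i * n ≤ c ∧ c < i * n + n then 0 else s.mem 6 0 c := by
  refine Ensures.forLoop (N := n) (I := fun K s' => ∀ c, s'.mem 6 0 c =
    if i * n ≤ c ∧ c < i * n + K then 0 else s.mem 6 0 c) ?_ (by decide) ?_ ?_ ?_
  · intro t; simp [Expr.eval, State.tick, State.setReg, h.reg1]
  · intro j s₁ s₂ he hI; simpa only [he.1] using hI
  · intro c
    rw [if_neg (by omega)]
  · intro K _ s₂ hf₂ hK hI2
    refine Ensures.store fun t c => ?_
    have e7 : s₂.reg 7 = i := (hf₂.reg 7 (by decide)).trans hi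
    have e1 : s₂.reg 1 = n := (hf₂.reg 1 (by decide)).trans h.reg1
    simp only [State.tick, State.setMem, Expr.eval, Op.eval, blockExpr, e7, e1, hK, hI2,
      true_and]
    generalize i * n = P
    by_cases hc : c = K + P
    · rw [if_pos hc, if_pos (by omega)]
    · rw [if_neg hc]
      exact if_congr (by omega) rfl rfl

theorem clearNoise_spec {i : ℕ} {s : State} (h : Ready k σ A b s) (hi : s.reg 7 = i) :
    Ensures ν O clearNoise s fun s' => ∀ r j, s'.mem 7 r j =
      if r < m ∧ j = i then 0 else s.mem 7 r j := by
  refine Ensures.forLoop (N := m) (I := fun J s' => ∀ r j, s'.mem 7 r j =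
    if r < J ∧ j = i then 0 else s.mem 7 r j) ?_ (by decide) ?_ ?_ ?_
  · intro t; simp [Expr.eval, State.tick, State.setReg, h.reg2]
  · intro j s₁ s₂ he hI; simpa only [he.1] using hI
  · simp
  · intro K _ s₂ hf₂ hK hI2
    refine Ensures.store fun t r j => ?_
    have e7 : s₂.reg 7 = i := (hf₂.reg 7 (by decide)).trans hi
    simp only [State.tick, State.setMem, Expr.eval, e7, hK, hI2, true_and]
    by_cases hc : r = K ∧ j = i
    · rw [if_pos hc, if_pos (by omega)]
    · rw [if_neg hc]
      exact if_congr (by omega) rfl rfl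

variable [NeZero q]

theorem sampleAll_law (hq : 2 ≤ q) (hn : 0 < n) (hσ : σ ≤ n) {s : State}
    (h : Ready k σ A b s) :
    (sampleAll.run ν O s).map (fun s' =>
      ((fun i j => (s'.mem 2 i j : ZMod q) : Fin m → Fin (k * n) → ZMod q),
       (fun j => (s'.mem 6 0 j : ZMod q) : Fin (k * n) → ZMod q),
       (fun i j => (s'.mem 7 i j : ZMod q) : Fin m → Fin k → ZMod q))) =
      sampleLaw (berQ q ((q : ℝ) * σ / (((q : ℝ) - 1) * n))) ν m (k * n) k := by
  have hpar : ∀ {s₁ s' : State}, (∀ x ≤ 6, s₁.reg x = s.reg x) →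
      (∀ x ≤ 6, s'.reg x = s₁.reg x) → ∀ x ≤ 6, s'.reg x = s.reg x :=
    fun h h' x hx => (h' x hx).trans (h x hx)
  have hdim : ∀ s' : State, (∀ x ≤ 6, s'.reg x = s.reg x) → dimExpr.eval s' = k * n := by
    intro s' h'
    simp only [dimExpr, Expr.eval, Op.eval, h' 1 (by norm_num), h' 3 (by norm_num), h.reg1, h.reg3]
  have hm : ∀ s' : State, (∀ x ≤ 6, s'.reg x = s.reg x) → (Expr.reg 2).eval s' = m :=
    fun s' h' => (h' 2 (by norm_num)).trans h.reg2
  have hk : ∀ s' : State, (∀ x ≤ 6, s'.reg x = s.reg x) → (Expr.reg 3).eval s' = k :=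
    fun s' h' => (h' 3 (by norm_num)).trans h.reg3
  have law1 := fillMat_law (ν := ν) (O := O) (a := 2) (S := sampleSparse) (s := s)
    (by decide) (by decide) hm hdim
    (fun s' h' => sampleSparse_law hq hn hσ ((h' 0 (by norm_num)).trans h.reg0)
      ((h' 1 (by norm_num)).trans h.reg1) ((h' 4 (by norm_num)).trans h.reg4))
  rw [sampleLaw, sampleAll, Cmd.run, ← law1]
  -- The law of each of the remaining two arrays does not depend on the arrays filled before, and
  -- the frames keep those intact; this gives independence.
  refine map_bind_eq_bind_map fun s₁ h₁ => ?_
  have f1 := frame_of_mem_support ν O h₁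
  have p1 : ∀ x ≤ 6, s₁.reg x = s.reg x := fun x hx => f1.reg x (by revert x; decide)
  have law2 := fillRow_law (ν := ν) (O := O) (a := 6) (S := .unif 10 (.reg 0)) (s := s₁)
    (r := .const 0) (i := 0) (C := dimExpr) (NC := k * n) (by decide) (by decide)
    (fun _ _ => rfl) (fun s' h' => hdim s' (hpar p1 h'))
    (fun s' h' => unif_law ((h' 0 (by norm_num)).trans ((p1 0 (by norm_num)).trans h.reg0)))
  rw [Cmd.run, ← law2]
  refine map_bind_eq_bind_map fun s₂ h₂ => ?_
  have f2 := frame_of_mem_support ν O h₂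
  have p2 : ∀ x ≤ 6, s₂.reg x = s₁.reg x := fun x hx => f2.reg x (by revert x; decide)
  have law3 := fillMat_law (ν := ν) (O := O) (a := 7) (S := .noise 10) (s := s₂)
    (R := .reg 2) (C := .reg 3) (NR := m) (NC := k) (by decide) (by decide)
    (fun s' h' => hm s' (hpar (hpar p1 p2) h')) (fun s' h' => hk s' (hpar (hpar p1 p2) h'))
    (fun s' _ => noise_law)
  rw [← law3, PMF.map_comp]
  refine map_congr_support fun s₃ h₃ => ?_
  have f3 := frame_of_mem_support ν O h₃
  simp only [Function.comp_apply, f3.mem 2 (by decide), f3.mem 6 (by decide),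
    f2.mem 2 (by decide)]

/-- The bound by `q` is recorded because the error count compares representatives as natural
numbers. -/
theorem accumulate_spec {x : ℕ} {e : Expr} {s : State} (h0 : s.reg 0 = q) :
    Ensures ν O (accumulate x e) s fun s' =>
      (s'.reg x : ZMod q) = (s.reg x : ZMod q) + (e.eval s : ZMod q) ∧ s'.reg x < q := by
  refine Ensures.assign fun t => ?_
  simp only [State.tick, State.setReg, Function.update_self, Expr.eval, Op.eval, h0,
    ZMod.natCast_mod, Nat.cast_add, true_and]
  exact Nat.mod_lt _ (Nat.pos_of_ne_zero (NeZero.ne q))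

/-- In a trial the secret and the noise at the position of the given instance have been cleared, so
that block contributes only `b` (array `1`), while the fresh blocks contribute their own right-hand
sides. -/
theorem computeRhs_spec {s : State} (h : Ready k σ A b s) :
    Ensures ν O computeRhs s fun s' => ∀ r < m, (s'.mem 3 0 r : ZMod q) =
      (s.mem 1 0 r : ZMod q) + ∑ c ∈ Finset.range (k * n),
        (s.mem 2 r c : ZMod q) * (s.mem 6 0 c : ZMod q) +
        ∑ j ∈ Finset.range k, (s.mem 7 r j : ZMod q) := by
  refine Ensures.forLoop (N := m) (I := fun J s' => ∀ r < J, (s'.mem 3 0 r : ZMod q) =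
      (s.mem 1 0 r : ZMod q) + ∑ c ∈ Finset.range (k * n),
        (s.mem 2 r c : ZMod q) * (s.mem 6 0 c : ZMod q) +
        ∑ j ∈ Finset.range k, (s.mem 7 r j : ZMod q)) ?_ (by decide) ?_ ?_ ?_
  · intro t; simp [Expr.eval, State.tick, State.setReg, h.reg2]
  · intro j s₁ s₂ he hI; simpa only [he.1] using hI
  · simp
  · intro J _ s₁ f1 hJ hI
    have h1 := h.frame f1 (by decide) (by decide) (by decide)
    have m1 := f1.mem 1 (by decide)
    have m2 := f1.mem 2 (by decide)
    have m6 := f1.mem 6 (by decide)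
    have m7 := f1.mem 7 (by decide)
    refine Ensures.seq (Q := fun s' => s'.reg 10 = s.mem 1 0 J)
      (Ensures.assign fun t => by simp [State.tick, State.setReg, Expr.eval, hJ, m1])
      fun s₂ f2 e2 => ?_
    have h2 := h1.frame f2 (by decide) (by decide) (by decide)
    refine Ensures.seq (Q := fun s' => (s'.reg 10 : ZMod q) =
      (s.mem 1 0 J : ZMod q) + ∑ c ∈ Finset.range (k * n),
        (s.mem 2 J c : ZMod q) * (s.mem 6 0 c : ZMod q))
      (Ensures.forLoop (N := k * n) (I := fun K s' => (s'.reg 10 : ZMod q) =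
        (s.mem 1 0 J : ZMod q) + ∑ c ∈ Finset.range K,
        (s.mem 2 J c : ZMod q) * (s.mem 6 0 c : ZMod q)) ?_ (by decide) ?_ ?_ ?_)
      fun s₃ f3 e3 => ?_
    · intro t
      simp [dimExpr, Expr.eval, Op.eval, State.tick, State.setReg, h2.reg1, h2.reg3]
    · intro j s₁ s₂ he hI; simpa only [he.2 10 (by norm_num)] using hI
    · simp [e2]
    · intro K _ s' f' hK hI'
      have h' := h2.frame f' (by decide) (by decide) (by decide)
      refine (accumulate_spec h'.reg0).mono fun s'' _ e'' => ?_
      rw [e''.1, hI', Finset.sum_range_succ, ← add_assoc]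
      simp only [Expr.eval, Op.eval, hK, f'.mem 2 (by decide), f2.mem 2 (by decide), m2,
        f'.mem 6 (by decide), f2.mem 6 (by decide), m6, f'.reg 8 (by decide), f2.reg 8 (by decide),
        hJ, Nat.cast_mul]
    have h3 := h2.frame f3 (by decide) (by decide) (by decide)
    refine Ensures.seq (Q := fun s' => (s'.reg 10 : ZMod q) =
      (s.mem 1 0 J : ZMod q) + ∑ c ∈ Finset.range (k * n),
        (s.mem 2 J c : ZMod q) * (s.mem 6 0 c : ZMod q) +
        ∑ j ∈ Finset.range k, (s.mem 7 J j : ZMod q))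
      (Ensures.forLoop (N := k) (I := fun K s' => (s'.reg 10 : ZMod q) =
        (s.mem 1 0 J : ZMod q) + ∑ c ∈ Finset.range (k * n),
        (s.mem 2 J c : ZMod q) * (s.mem 6 0 c : ZMod q) +
        ∑ j ∈ Finset.range K, (s.mem 7 J j : ZMod q)) ?_ (by decide) ?_ ?_ ?_)
      fun s₄ f4 e4 => ?_
    · intro t
      simp [Expr.eval, State.tick, State.setReg, h3.reg3]
    · intro j s₁ s₂ he hI; simpa only [he.2 10 (by norm_num)] using hI
    · simp [e3]
    · intro K _ s' f' hK hI'
      have h' := h3.frame f' (by decide) (by decide) (by decide)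
      refine (accumulate_spec h'.reg0).mono fun s'' _ e'' => ?_
      rw [e''.1, hI', Finset.sum_range_succ, ← add_assoc]
      simp only [Expr.eval, hK, f'.mem 7 (by decide), f3.mem 7 (by decide), f2.mem 7 (by decide),
        m7, f'.reg 8 (by decide), f3.reg 8 (by decide), f2.reg 8 (by decide), hJ]
    refine Ensures.store fun t r hr => ?_
    have e8 : s₄.reg 8 = J := by
      rw [f4.reg 8 (by decide), f3.reg 8 (by decide), f2.reg 8 (by decide), hJ]
    simp only [State.tick, State.setMem, Expr.eval, e8, true_and]
    split_ifs with hrJ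
    · rw [hrJ]; exact e4
    · rw [f4.mem 3 (by decide), f3.mem 3 (by decide), f2.mem 3 (by decide)]
      exact hI r (by omega)

end

/-! ### The laws of a trial and of the whole reduction -/

theorem map_bind_eq_of_support {α β γ : Type*} {p : PMF α} {f : α → PMF β} {g : β → γ}
    {p' : PMF γ} (H : ∀ a ∈ p.support, (f a).map g = p') : (p.bind f).map g = p' := by
  rw [PMF.map_bind, bind_congr_support H, PMF.bind_const]

theorem map_eq_pure_of_support {α β : Type*} {p : PMF α} {f : α → β} {b : β}
    (H : ∀ a ∈ p.support, f a = b) : p.map f = PMF.pure b := by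
  rw [map_congr_support H]
  exact PMF.map_const p b

/-- The better one of two candidates. -/
def better {q n m : ℕ} (A : Matrix (Fin m) (Fin n) (ZMod q)) (b : Fin m → ZMod q)
    (z z' : Fin n → ZMod q) : Fin n → ZMod q :=
  if hammingDist (A.mulVec z) b < hammingDist (A.mulVec z') b then z else z'

/-- The block with number `i` of a vector. -/
def block {α : Type*} {k n : ℕ} (i : Fin k) (z : Fin (k * n) → α) : Fin n → α :=
  fun j => z (finProdFinEquiv (i, j))

/-- Replace the columns of the block `i` of the matrix by those of `A`. -/
def hideMat {q n m k : ℕ} (i : Fin k) (A : Matrix (Fin m) (Fin n) (ZMod q))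
    (M : Fin m → Fin (k * n) → ZMod q) : Matrix (Fin m) (Fin (k * n)) (ZMod q) :=
  Matrix.of fun r c => if c.divNat = i then A r c.modNat else M r c

/-- The right-hand side of the query in which the instance `i` is the given one. -/
def hideRhs {q n m k : ℕ} (i : Fin k) (A : Matrix (Fin m) (Fin n) (ZMod q)) (b : Fin m → ZMod q)
    (ω : (Fin m → Fin (k * n) → ZMod q) × (Fin (k * n) → ZMod q) × (Fin m → Fin k → ZMod q)) :
    Fin m → ZMod q :=
  fun r => b r + ∑ c, hideMat i A ω.1 r c * (if c.divNat = i then 0 else ω.2.1 c) +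
    ∑ j, if j = i then 0 else ω.2.2 r j

/-- The law of the best candidate after a trial. -/
noncomputable def trialKernel {q n m k : ℕ} [NeZero q] (χ ν : PMF (ZMod q))
    (O : Solver q (k * n) m) (A : Matrix (Fin m) (Fin n) (ZMod q)) (b : Fin m → ZMod q) (i : Fin k)
    (z : Fin n → ZMod q) : PMF (Fin n → ZMod q) :=
  (sampleLaw χ ν m (k * n) k).bind fun ω =>
    (O (hideMat i A ω.1) (hideRhs i A b ω)).map fun y => better A b (block i y) z

theorem mem_block_iff {n i c : ℕ} (hn : 0 < n) : i * n ≤ c ∧ c < i * n + n ↔ c / n = i := by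
  rw [Nat.div_eq_iff hn]
  constructor <;> rintro ⟨h1, h2⟩ <;> constructor <;> omega

theorem sub_eq_mod_of_div {n i c : ℕ} (h : c / n = i) : c - i * n = c % n := by
  have h1 := Nat.div_add_mod c n
  rw [h, mul_comm] at h1
  omega

section
variable {q n m k σ : ℕ} [NeZero q] {ν : PMF (ZMod q)} {O : Solver q (k * n) m}
  {A : Matrix (Fin m) (Fin n) (ZMod q)} {b : Fin m → ZMod q}

/-- Both numbers are reduced modulo `q`, so they are equal exactly if their residues are. -/
theorem countErrors_step {x v v' t : ℕ} {s : State} {w : ZMod q} (hw : w.val = v')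
    (hv : s.reg x = v) (hvq : v < q) :
    Op.add.eval t (Op.sub.eval 1 (Op.eq.eval (s.reg x) v')) =
      t + if (v : ZMod q) ≠ w then 1 else 0 := by
  have : v = v' ↔ (v : ZMod q) = w := by
    subst hw
    constructor
    · intro h; rw [h]; simp
    · intro h; rw [← h, ZMod.val_natCast_of_lt hvq]
  simp only [Op.eval, hv, this]
  split_ifs <;> simp_all

theorem countErrors_spec {s : State} (i : Fin k) (h : Ready k σ A b s) (hi : s.reg 7 = i) :
    Ensures ν O countErrors s fun s' =>
      s'.reg 12 = hammingDist (A.mulVec (block i (s.readVec q (k * n) 4))) b ∧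
      s'.reg 13 = hammingDist (A.mulVec (s.readVec q n 5)) b := by
  have hcard : ∀ z : Fin n → ZMod q, hammingDist (A.mulVec z) b =
      ∑ r : Fin m, if A.mulVec z r ≠ b r then 1 else 0 := fun z => by
    rw [hammingDist, Finset.card_filter]
  set z := block i (s.readVec q (k * n) 4) with hz
  set z' := s.readVec q n 5 with hz'
  rw [hcard, hcard]
  -- The error indicator is extended by `0` beyond the last equation, so that partial sums over
  -- `range` can serve as a loop invariant.
  let E : (Fin n → ZMod q) → ℕ → ℕ := fun z r =>
    if hr : r < m then (if A.mulVec z ⟨r, hr⟩ ≠ b ⟨r, hr⟩ then 1 else 0) else 0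
  have hE : ∀ z, (∑ r : Fin m, if A.mulVec z r ≠ b r then 1 else 0) =
      ∑ r ∈ Finset.range m, E z r := fun z => by
    rw [Finset.sum_range]
    exact Finset.sum_congr rfl fun r _ => by simp only [E, r.2, dif_pos]
  rw [hE, hE]
  refine Ensures.seq (Q := fun s' => s'.reg 12 = 0)
    (Ensures.assign fun t => by simp [State.tick, State.setReg, Expr.eval]) fun s₁ f₁ e₁ => ?_
  refine Ensures.seq (Q := fun s' => s'.reg 13 = 0)
    (Ensures.assign fun t => by simp [State.tick, State.setReg, Expr.eval]) fun s₂ f₂ e₂ => ?_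
  have h1 := h.frame f₁ (by decide) (by decide) (by decide)
  have h2 := h1.frame f₂ (by decide) (by decide) (by decide)
  refine Ensures.forLoop (N := m) (I := fun J s' => s'.reg 12 = ∑ r ∈ Finset.range J, E z r ∧
    s'.reg 13 = ∑ r ∈ Finset.range J, E z' r) ?_ (by decide) ?_ ?_ ?_
  · intro t; simp [Expr.eval, State.tick, State.setReg, h2.reg2]
  · intro j s₁ s₂ he hI
    simpa only [he.2 12 (by norm_num), he.2 13 (by norm_num)] using hI
  · simp [f₂.reg 12 (by decide), e₁, e₂]
  · intro J hJm s₃ f₃ hJ hI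
    have h3 := h2.frame f₃ (by decide) (by decide) (by decide)
    have hq : 0 < q := Nat.pos_of_ne_zero (NeZero.ne q)
    refine Ensures.seq (Q := fun s' => s'.reg 10 = 0)
      (Ensures.assign fun t => by simp [State.tick, State.setReg, Expr.eval]) fun s₄ f₄ e₄ => ?_
    refine Ensures.seq (Q := fun s' => s'.reg 11 = 0)
      (Ensures.assign fun t => by simp [State.tick, State.setReg, Expr.eval]) fun s₅ f₅ e₅ => ?_
    have h4 := h3.frame f₄ (by decide) (by decide) (by decide)
    have h5 := h4.frame f₅ (by decide) (by decide) (by decide)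
    refine Ensures.seq (Q := fun s' =>
      (s'.reg 10 : ZMod q) = A.mulVec z ⟨J, hJm⟩ ∧ s'.reg 10 < q ∧
      (s'.reg 11 : ZMod q) = A.mulVec z' ⟨J, hJm⟩ ∧ s'.reg 11 < q)
      ((Ensures.forLoop (N := n) (I := fun K s' =>
        (s'.reg 10 : ZMod q) = ∑ j ∈ Finset.range K,
          (s.mem 0 J j : ZMod q) * (s.mem 4 0 (j + i * n) : ZMod q) ∧ s'.reg 10 < q ∧
        (s'.reg 11 : ZMod q) = ∑ j ∈ Finset.range K,
          (s.mem 0 J j : ZMod q) * (s.mem 5 0 j : ZMod q) ∧ s'.reg 11 < q)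
          ?_ (by decide) ?_ ?_ ?_).mono ?_) fun s₆ f₆ e₆ => ?_
    · intro t; simp [Expr.eval, State.tick, State.setReg, h5.reg1]
    · intro j s₁ s₂ he hI
      simpa only [he.2 10 (by norm_num), he.2 11 (by norm_num)] using hI
    · simp [f₅.reg 10 (by decide), e₄, e₅, hq]
    · intro K _ s' f' hK hI'
      have h' := h5.frame f' (by decide) (by decide) (by decide)
      have em0 : s'.mem 0 = s.mem 0 := by
        rw [f'.mem 0 (by decide), f₅.mem 0 (by decide), f₄.mem 0 (by decide), f₃.mem 0 (by decide),
          f₂.mem 0 (by decide), f₁.mem 0 (by decide)]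
      have em4 : s'.mem 4 = s.mem 4 := by
        rw [f'.mem 4 (by decide), f₅.mem 4 (by decide), f₄.mem 4 (by decide), f₃.mem 4 (by decide),
          f₂.mem 4 (by decide), f₁.mem 4 (by decide)]
      have em5 : s'.mem 5 = s.mem 5 := by
        rw [f'.mem 5 (by decide), f₅.mem 5 (by decide), f₄.mem 5 (by decide), f₃.mem 5 (by decide),
          f₂.mem 5 (by decide), f₁.mem 5 (by decide)]
      have e8 : s'.reg 8 = J := by
        rw [f'.reg 8 (by decide), f₅.reg 8 (by decide), f₄.reg 8 (by decide), hJ]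
      have e7 : s'.reg 7 = i := by
        rw [f'.reg 7 (by decide), f₅.reg 7 (by decide), f₄.reg 7 (by decide), f₃.reg 7 (by decide),
          f₂.reg 7 (by decide), f₁.reg 7 (by decide), hi]
      refine Ensures.seq (accumulate_spec h'.reg0) fun s₆ f₆ e₆ => ?_
      refine (accumulate_spec ((f₆.reg 0 (by decide)).trans h'.reg0)).mono fun s₇ f₇ e₇ => ?_
      refine ⟨?_, by rw [f₇.reg 10 (by decide)]; exact e₆.2, ?_, e₇.2⟩
      · rw [f₇.reg 10 (by decide), e₆.1, hI'.1, Finset.sum_range_succ]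
        simp only [Expr.eval, Op.eval, blockExpr, em0, em4, e8, e7, hK, h'.reg1, Nat.cast_mul]
      · rw [e₇.1, f₆.reg 11 (by decide), hI'.2.2.1, Finset.sum_range_succ]
        simp only [Expr.eval, Op.eval, f₆.mem 0 (by decide), f₆.mem 5 (by decide),
          f₆.reg 8 (by decide), f₆.reg 9 (by decide), em0, em5, e8, hK, Nat.cast_mul]
    · intro s' _ hI'
      have hA : ∀ j : Fin n, (s.mem 0 J j : ZMod q) = A ⟨J, hJm⟩ j := fun j => by
        rw [h.mem0 ⟨J, hJm⟩ j]; simp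
      refine ⟨?_, hI'.2.1, ?_, hI'.2.2.2⟩
      · rw [hI'.1, Finset.sum_range]
        refine Finset.sum_congr rfl fun j _ => ?_
        rw [hA, hz]
        simp only [block, State.readVec, finProdFinEquiv_apply_val, mul_comm n]
      · rw [hI'.2.2.1, Finset.sum_range]
        refine Finset.sum_congr rfl fun j _ => ?_
        rw [hA]
        rfl
    have h6 := h5.frame f₆ (by decide) (by decide) (by decide)
    have hb : ∀ {c : Cmd} {s' : State}, Frame c s₆ s' → 1 ∉ c.arrs → 8 ∉ c.regs →
        s'.mem 1 0 (s'.reg 8) = (b ⟨J, hJm⟩).val := by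
      intro c s' hf h1 h8
      rw [hf.mem 1 h1, hf.reg 8 h8, f₆.reg 8 (by decide), f₅.reg 8 (by decide), f₄.reg 8 (by decide),
        hJ]
      exact h6.mem1 ⟨J, hJm⟩
    have e12 : s₆.reg 12 = ∑ r ∈ Finset.range J, E z r := by
      rw [f₆.reg 12 (by decide), f₅.reg 12 (by decide), f₄.reg 12 (by decide), hI.1]
    have e13 : s₆.reg 13 = ∑ r ∈ Finset.range J, E z' r := by
      rw [f₆.reg 13 (by decide), f₅.reg 13 (by decide), f₄.reg 13 (by decide), hI.2]
    refine Ensures.seq (Q := fun s' => s'.reg 12 = ∑ r ∈ Finset.range (J + 1), E z r)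
      (Ensures.assign fun t => ?_) fun s₇ f₇ e₇ => Ensures.assign fun t => ⟨?_, ?_⟩
    · simp only [State.tick, State.setReg, Function.update_self, Expr.eval]
      rw [hb (c := .skip) ⟨fun _ _ => rfl, fun _ _ => rfl⟩ (by decide) (by decide)]
      rw [countErrors_step rfl rfl e₆.2.1, Finset.sum_range_succ, e12, e₆.1]
      simp only [E, hJm, dif_pos]
    · simpa [State.tick, State.setReg] using e₇
    · simp only [State.tick, State.setReg, Function.update_self, Expr.eval]
      rw [hb f₇ (by decide) (by decide)]
      rw [countErrors_step rfl (f₇.reg 11 (by decide)) e₆.2.2.2,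
        Finset.sum_range_succ, f₇.reg 13 (by decide), e13, e₆.2.2.1]
      simp only [E, hJm, dif_pos]

theorem keepBetter_spec {s : State} (i : Fin k) (h : Ready k σ A b s) (hi : s.reg 7 = i) :
    Ensures ν O keepBetter s fun s' =>
      s'.readVec q n 5 = better A b (block i (s.readVec q (k * n) 4)) (s.readVec q n 5) := by
  refine Ensures.seq (countErrors_spec i h hi) fun s₁ f₁ e₁ => ?_
  have h1 := h.frame f₁ (by decide) (by decide) (by decide)
  have hlt : (Expr.bin .lt (.reg 12) (.reg 13)).eval s₁ = if
      hammingDist (A.mulVec (block i (s.readVec q (k * n) 4))) b <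
      hammingDist (A.mulVec (s.readVec q n 5)) b then 1 else 0 := by
    simp only [Expr.eval, Op.eval, e₁.1, e₁.2]
  refine Ensures.cond (fun hne t => ?_) fun heq t => ?_
  · have hb : better A b (block i (s.readVec q (k * n) 4)) (s.readVec q n 5) =
        block i (s.readVec q (k * n) 4) := by
      rw [better, if_pos]
      by_contra hcon
      exact hne (by rw [hlt, if_neg hcon])
    rw [hb]
    refine (Ensures.forLoop (N := n) (I := fun K s' => ∀ j < K,
      s'.mem 5 0 j = s.mem 4 0 (j + i * n)) ?_ (by decide) ?_ ?_ ?_).mono ?_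
    · intro t; simp [Expr.eval, State.tick, State.setReg, h1.reg1]
    · intro j s₁ s₂ he hI; simpa only [he.1] using hI
    · simp
    · intro K _ s₂ f₂ hK hI
      refine Ensures.store fun t' j hj => ?_
      have e7 : s₂.reg 7 = i := (f₂.reg 7 (by decide)).trans ((f₁.reg 7 (by decide)).trans hi)
      have e1 : s₂.reg 1 = n := (f₂.reg 1 (by decide)).trans h1.reg1
      have em : s₂.mem 4 = s.mem 4 := (f₂.mem 4 (by decide)).trans (f₁.mem 4 (by decide))
      simp only [State.tick, State.setMem, Expr.eval, Op.eval, blockExpr, e7, e1, hK, em, true_and]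
      split_ifs with hjK
      · rw [hjK]
      · exact hI j (by omega)
    · intro s' _ hs'
      funext j
      simp only [State.readVec, block, hs' j j.2, finProdFinEquiv_apply_val, mul_comm n]
  · have hb : better A b (block i (s.readVec q (k * n) 4)) (s.readVec q n 5) =
        s.readVec q n 5 := by
      rw [better, if_neg]
      intro hcon
      rw [hlt, if_pos hcon] at heq
      exact one_ne_zero heq
    rw [hb]
    intro s' hs'
    simp only [Cmd.run, PMF.support_pure, Set.mem_singleton_iff] at hs'
    subst hs'
    funext j
    simp only [State.readVec, State.tick, f₁.mem 5 (by decide)]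

/-- Once the answer is fixed, `keepBetter` acts deterministically on the array `5`, so the new
candidate is an image of the oracle's law. -/
theorem query_keepBetter_law {s : State} (i : Fin k) (h : Ready k σ A b s) (hi : s.reg 7 = i) :
    ((Cmd.seq .query keepBetter).run ν O s).map (State.readVec q n 5) =
      (O (s.readMat q m (k * n) 2) (s.readVec q m 3)).map fun y =>
        better A b (block i y) (s.readVec q n 5) := by
  rw [Cmd.run, Cmd.run, PMF.bind_map, PMF.map_bind, ← PMF.bind_pure_comp]
  congr 1
  funext y
  have hf : Frame .query s ((s.writeVec 4 y).tick 1) := by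
    refine ⟨fun _ _ => rfl, fun a ha => ?_⟩
    have ha4 : a ≠ 4 := by simpa [Cmd.arrs] using ha
    funext i' j'
    simp [State.tick, State.writeVec, ha4]
  have h4 : ((s.writeVec 4 y).tick 1).readVec q (k * n) 4 = y := by
    funext j
    simp [State.readVec, State.tick, State.writeVec]
  have h5 : ((s.writeVec 4 y).tick 1).readVec q n 5 = s.readVec q n 5 := by
    funext j
    simp only [State.readVec, hf.mem 5 (by decide)]
  have hspec := keepBetter_spec (ν := ν) (O := O) i
    (h.frame hf (by decide) (by decide) (by decide)) hi
  rw [h4, h5] at hspec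
  exact map_eq_pure_of_support hspec

/-- Only the sampling and the query are random. The four commands between them have deterministic
specifications and drop out by `map_bind_eq_of_support`. -/
theorem trial_law (hq : 2 ≤ q) (hn : 0 < n) (hσ : σ ≤ n) {s : State} (i : Fin k)
    (h : Ready k σ A b s) (hi : s.reg 7 = i) :
    (trial.run ν O s).map (State.readVec q n 5) =
      trialKernel (berQ q ((q : ℝ) * σ / (((q : ℝ) - 1) * n))) ν O A b i (s.readVec q n 5) := by
  rw [trial, Cmd.run, trialKernel, ← sampleAll_law (ν := ν) (O := O) hq hn hσ h]
  refine map_bind_eq_bind_map fun s₁ h₁ => ?_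
  have f₁ := frame_of_mem_support ν O h₁
  have r₁ := h.frame f₁ (by decide) (by decide) (by decide)
  have i₁ : s₁.reg 7 = i := (f₁.reg 7 (by decide)).trans hi
  rw [Cmd.run]
  refine map_bind_eq_of_support fun s₂ h₂ => ?_
  have f₂ := frame_of_mem_support ν O h₂
  have r₂ := r₁.frame f₂ (by decide) (by decide) (by decide)
  have i₂ : s₂.reg 7 = i := (f₂.reg 7 (by decide)).trans i₁
  have e₂ := overwrite_spec r₁ i₁ s₂ h₂
  rw [Cmd.run]
  refine map_bind_eq_of_support fun s₃ h₃ => ?_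
  have f₃ := frame_of_mem_support ν O h₃
  have r₃ := r₂.frame f₃ (by decide) (by decide) (by decide)
  have i₃ : s₃.reg 7 = i := (f₃.reg 7 (by decide)).trans i₂
  have e₃ := clearSecret_spec r₂ i₂ s₃ h₃
  rw [Cmd.run]
  refine map_bind_eq_of_support fun s₄ h₄ => ?_
  have f₄ := frame_of_mem_support ν O h₄
  have r₄ := r₃.frame f₄ (by decide) (by decide) (by decide)
  have i₄ : s₄.reg 7 = i := (f₄.reg 7 (by decide)).trans i₃
  have e₄ := clearNoise_spec r₃ i₃ s₄ h₄
  rw [Cmd.run]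
  refine map_bind_eq_of_support fun s₅ h₅ => ?_
  have f₅ := frame_of_mem_support ν O h₅
  have r₅ := r₄.frame f₅ (by decide) (by decide) (by decide)
  have i₅ : s₅.reg 7 = i := (f₅.reg 7 (by decide)).trans i₄
  have e₅ := computeRhs_spec r₄ s₅ h₅
  have m2 : ∀ (r : Fin m) (c : Fin (k * n)), (s₂.mem 2 r c : ZMod q) =
      hideMat i A (fun i j => (s₁.mem 2 i j : ZMod q)) r c := by
    intro r c
    have hdiv : c.divNat = i ↔ (c : ℕ) / n = i := by rw [Fin.ext_iff, Fin.coe_divNat]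
    rw [e₂]
    simp only [mem_block_iff hn, hideMat, Matrix.of_apply]
    by_cases hc : (c : ℕ) / n = i
    · rw [if_pos ⟨r.2, hc⟩, if_pos (hdiv.2 hc), sub_eq_mod_of_div hc]
      have := r₁.mem0 r c.modNat
      rw [Fin.coe_modNat] at this
      rw [this, ZMod.natCast_zmod_val]
    · rw [if_neg (by tauto), if_neg (by rwa [hdiv])]
  have m6 : ∀ c : Fin (k * n), (s₃.mem 6 0 c : ZMod q) =
      if c.divNat = i then 0 else (s₁.mem 6 0 c : ZMod q) := by
    intro c
    have hdiv : c.divNat = i ↔ (c : ℕ) / n = i := by rw [Fin.ext_iff, Fin.coe_divNat]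
    rw [e₃, f₂.mem 6 (by decide)]
    simp only [mem_block_iff hn, hdiv, Nat.cast_ite, Nat.cast_zero]
  have m7 : ∀ (r : Fin m) (j : Fin k), (s₄.mem 7 r j : ZMod q) =
      if j = i then 0 else (s₁.mem 7 r j : ZMod q) := by
    intro r j
    rw [e₄, f₃.mem 7 (by decide), f₂.mem 7 (by decide)]
    simp only [r.2, true_and, Fin.ext_iff, Nat.cast_ite, Nat.cast_zero]
  have hmat : s₅.readMat q m (k * n) 2 = hideMat i A (fun i j => (s₁.mem 2 i j : ZMod q)) := by
    ext r c
    rw [← m2]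
    simp only [State.readMat, Matrix.of_apply, f₅.mem 2 (by decide), f₄.mem 2 (by decide),
      f₃.mem 2 (by decide)]
  have hrhs : s₅.readVec q m 3 = hideRhs i A b
      ((fun i j => (s₁.mem 2 i j : ZMod q) : Fin m → Fin (k * n) → ZMod q),
       (fun j => (s₁.mem 6 0 j : ZMod q) : Fin (k * n) → ZMod q),
       (fun i j => (s₁.mem 7 i j : ZMod q) : Fin m → Fin k → ZMod q)) := by
    funext r
    rw [State.readVec, e₅ r r.2, r₄.mem1, ZMod.natCast_zmod_val, Finset.sum_range,
      Finset.sum_range, hideRhs]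
    simp only [← m2, ← m6, ← m7, f₄.mem 2 (by decide), f₃.mem 2 (by decide),
      f₄.mem 6 (by decide)]
  have hbest : s₅.readVec q n 5 = s.readVec q n 5 := by
    funext j
    simp only [State.readVec, f₅.mem 5 (by decide), f₄.mem 5 (by decide), f₃.mem 5 (by decide),
      f₂.mem 5 (by decide), f₁.mem 5 (by decide)]
  rw [query_keepBetter_law i r₅ i₅, hmat, hrhs, hbest]

/-- The law of the best candidate after all trials at the position `i`. -/
noncomputable def positionKernel (χ ν : PMF (ZMod q)) (O : Solver q (k * n) m)
    (A : Matrix (Fin m) (Fin n) (ZMod q)) (b : Fin m → ZMod q) (T i : ℕ) (z : Fin n → ZMod q) :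
    PMF (Fin n → ZMod q) :=
  if h : i < k then iterKernel (fun _ => trialKernel χ ν O A b ⟨i, h⟩) z T else PMF.pure z

/-- The best candidate so far is a Markov chain under both nested loops. It starts at `0`, since the
array `5` is empty at the beginning. -/
theorem reduction_law (hq : 2 ≤ q) (hn : 0 < n) (hσ : σ ≤ n) (D E : ℕ) :
    reduction.toSolver n [q, n, m, k, σ, D, E] ν O A b =
      iterKernel (positionKernel (berQ q ((q : ℝ) * σ / (((q : ℝ) - 1) * n))) ν O A b
        (4 * (k * (D * E)))) 0 k := by
  set s : State := initState [q, n, m, k, σ, D, E] A b with hs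
  have h : Ready k σ A b s := by
    refine ⟨rfl, rfl, rfl, rfl, rfl, fun r j => ?_, fun r => ?_⟩
    · simp [hs, initState]
    · simp [hs, initState]
  have h0 : s.readVec q n 5 = 0 := by
    funext j
    simp [hs, initState, State.readVec]
  rw [Cmd.toSolver, ← hs, reduction, ← h0]
  refine map_forLoop_kernel (x := 7) _ (State.readVec q n 5) ?_ (by decide) ?_ ?_
  · intro t; simp [Expr.eval, State.tick, State.setReg, h.reg3]
  · intro s s' he; funext j; simp only [State.readVec, he.1]
  · intro i hik s₁ f₁ hi
    have r₁ := h.frame f₁ (by decide) (by decide) (by decide)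
    rw [positionKernel, dif_pos hik]
    refine map_forLoop_kernel (x := 14) (fun _ => trialKernel _ ν O A b ⟨i, hik⟩)
      (State.readVec q n 5) ?_ (by decide) ?_ ?_
    · intro t
      have e5 : s₁.reg 5 = D := f₁.reg 5 (by decide)
      have e6 : s₁.reg 6 = E := f₁.reg 6 (by decide)
      simp [Expr.eval, Op.eval, State.tick, State.setReg, r₁.reg3, e5, e6]
    · intro s s' he; funext j; simp only [State.readVec, he.1]
    · intro j _ s₂ f₂ _
      exact trial_law hq hn hσ ⟨i, hik⟩ (r₁.frame f₂ (by decide) (by decide) (by decide))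
        ((f₂.reg 7 (by decide)).trans hi)

end

/-! ### Expectations over finite probability spaces -/

/-- The expectation of a real function under a law on a finite type. -/
noncomputable def expect {α : Type} [Fintype α] (p : PMF α) (f : α → ℝ) : ℝ :=
  ∑ x, (p x).toReal * f x

section
variable {α β : Type} [Fintype α] [Fintype β]

theorem sum_toReal (p : PMF α) : ∑ x, (p x).toReal = 1 := by
  have h := p.tsum_coe
  rw [tsum_fintype] at h
  rw [← ENNReal.toReal_sum fun x _ => p.apply_ne_top x, h, ENNReal.toReal_one]

theorem expect_const (p : PMF α) (c : ℝ) : expect p (fun _ => c) = c := by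
  rw [expect, ← Finset.sum_mul, sum_toReal, one_mul]

theorem expect_mono {p : PMF α} {f g : α → ℝ} (h : ∀ x, f x ≤ g x) : expect p f ≤ expect p g :=
  Finset.sum_le_sum fun x _ => mul_le_mul_of_nonneg_left (h x) ENNReal.toReal_nonneg

theorem expect_nonneg {p : PMF α} {f : α → ℝ} (h : ∀ x, 0 ≤ f x) : 0 ≤ expect p f :=
  Finset.sum_nonneg fun x _ => mul_nonneg ENNReal.toReal_nonneg (h x)

theorem expect_add (p : PMF α) (f g : α → ℝ) :
    expect p (fun x => f x + g x) = expect p f + expect p g := by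
  simp only [expect, mul_add, Finset.sum_add_distrib]

theorem expect_sub (p : PMF α) (f g : α → ℝ) :
    expect p (fun x => f x - g x) = expect p f - expect p g := by
  simp only [expect, mul_sub, Finset.sum_sub_distrib]

theorem expect_mul_left (p : PMF α) (c : ℝ) (f : α → ℝ) :
    expect p (fun x => c * f x) = c * expect p f := by
  simp only [expect, Finset.mul_sum]
  exact Finset.sum_congr rfl fun x _ => by ring

theorem expect_sum {ι : Type} [Fintype ι] (p : PMF α) (f : ι → α → ℝ) :
    expect p (fun x => ∑ i, f i x) = ∑ i, expect p (f i) := by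
  simp only [expect, Finset.mul_sum]
  exact Finset.sum_comm

theorem expect_pure [DecidableEq α] (a : α) (f : α → ℝ) : expect (PMF.pure a) f = f a := by
  rw [expect, Finset.sum_eq_single a]
  · simp
  · intro x _ hx; simp [hx]
  · simp

theorem expect_bind (p : PMF α) (κ : α → PMF β) (f : β → ℝ) :
    expect (p.bind κ) f = expect p fun a => expect (κ a) f := by
  simp only [expect, PMF.bind_apply, tsum_fintype]
  simp_rw [ENNReal.toReal_sum fun a _ => ENNReal.mul_ne_top (PMF.apply_ne_top p a)
    (PMF.apply_ne_top (κ a) _), ENNReal.toReal_mul, Finset.sum_mul, Finset.mul_sum]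
  rw [Finset.sum_comm]
  exact Finset.sum_congr rfl fun x _ => Finset.sum_congr rfl fun y _ => by ring

theorem expect_map [DecidableEq β] (p : PMF α) (g : α → β) (f : β → ℝ) :
    expect (p.map g) f = expect p fun a => f (g a) := by
  rw [← PMF.bind_pure_comp, expect_bind]
  simp only [Function.comp_apply, expect_pure]

theorem map_apply_of_injective {α β : Type*} (p : PMF α) {f : α → β} (hf : Function.Injective f)
    (a : α) : p.map f (f a) = p a := by
  rw [PMF.map_apply, tsum_eq_single a, if_pos rfl]
  intro a' ha'
  rw [if_neg fun h => ha' (hf h).symm]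

end

/-! ### Families of independent samples -/

section
variable {ι X Y : Type} [Fintype ι] [DecidableEq ι] [Fintype X]

theorem iid_apply_toReal (p : PMF X) (y : ι → X) :
    (iid p y).toReal = ∏ i, (p (y i)).toReal := by
  rw [iid_apply, ENNReal.toReal_prod]

theorem expect_iid_prod (p : PMF X) (f : ι → X → ℝ) :
    expect (iid p) (fun y : ι → X => ∏ i, f i (y i)) = ∏ i, expect p (f i) := by
  classical
  simp only [expect, iid_apply_toReal]
  rw [Finset.prod_univ_sum, Fintype.piFinset_univ]
  exact Finset.sum_congr rfl fun y _ => by rw [Finset.prod_mul_distrib]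

theorem iid_map [Fintype Y] (p : PMF X) (f : X → Y) :
    (iid p : PMF (ι → X)).map (fun y i => f (y i)) = iid (p.map f) := by
  classical
  ext h
  rw [PMF.map_apply, iid_apply, tsum_fintype]
  simp_rw [PMF.map_apply, tsum_fintype]
  rw [Finset.prod_univ_sum, Fintype.piFinset_univ]
  refine Finset.sum_congr rfl fun y _ => ?_
  by_cases hy : h = fun i => f (y i)
  · rw [if_pos hy, iid_apply]
    exact Finset.prod_congr rfl fun i _ => by rw [if_pos (congrFun hy i)]
  · rw [if_neg hy]
    obtain ⟨i, hi⟩ := Function.ne_iff.1 hy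
    exact (Finset.prod_eq_zero (Finset.mem_univ i) (if_neg hi)).symm

/-- Resampling one member of the family does not change the law. -/
theorem expect_resample [DecidableEq X] (p : PMF X) (i : ι) (h : (ι → X) → ℝ) :
    (expect p fun x => expect (iid p) fun y => h (Function.update y i x)) =
      expect (iid p) h := by
  have hw : ∀ (x : X) (y : ι → X), (p (y i)).toReal * ∏ j, (p (Function.update y i x j)).toReal =
      (p x).toReal * ∏ j, (p (y j)).toReal := by
    intro x y
    rw [← Finset.mul_prod_erase _ _ (Finset.mem_univ i),
      ← Finset.mul_prod_erase _ (fun j => (p (y j)).toReal) (Finset.mem_univ i),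
      Function.update_self, Finset.prod_congr rfl (g := fun j => (p (y j)).toReal)]
    · ring
    · intro j hj
      rw [Function.update_of_ne (Finset.ne_of_mem_erase hj)]
  -- Exchanging `x` with the coordinate `i` of `y` preserves the product weight, by `hw`.
  have hinv : Function.Involutive
      (fun z : X × (ι → X) => (z.2 i, Function.update z.2 i z.1)) := by
    rintro ⟨x, y⟩
    simp
  calc (expect p fun x => expect (iid p) fun y => h (Function.update y i x))
      = ∑ z : X × (ι → X), (p z.1).toReal * ((∏ j, (p (z.2 j)).toReal) *
          h (Function.update z.2 i z.1)) := by
        simp only [expect, iid_apply_toReal, Fintype.sum_prod_type, Finset.mul_sum]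
    _ = ∑ z : X × (ι → X), (p z.1).toReal * ((∏ j, (p (z.2 j)).toReal) * h z.2) := by
        refine Fintype.sum_equiv (hinv.toPerm _) _ _ fun z => ?_
        simp only [Function.Involutive.coe_toPerm]
        rw [← mul_assoc, ← mul_assoc, hw]
    _ = expect (iid p) h := by
        rw [Fintype.sum_prod_type]
        simp only [← Finset.mul_sum, ← Finset.sum_mul, sum_toReal, one_mul, expect,
          iid_apply_toReal]

end

/-! ### The direct product argument -/

/-- If a task on `k` independent samples succeeds with probability `ε`, and its success implies the
success of every one of `k` subtasks, then for some subtask the samples that make it succeed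
with probability less than `ε / (2 k)` have probability at most `log (2 / ε) / k`. -/
theorem exists_position {X : Type} [Fintype X] [DecidableEq X] (p : PMF X) {k : ℕ} (hk : 0 < k)
    (succ : (Fin k → X) → ℝ) (part : Fin k → (Fin k → X) → ℝ) (h1 : ∀ y, succ y ≤ 1)
    (h2 : ∀ i y, succ y ≤ part i y) (h0 : ∀ i y, 0 ≤ part i y) {ε : ℝ} (hε : 0 < ε)
    (h : ε ≤ expect (iid p) succ) :
    ∃ i, expect p (fun x => if expect (iid p) (fun y => part i (Function.update y i x)) <
      ε / (2 * k) then 1 else 0) ≤ Real.log (2 / ε) / k := by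
  have hk' : (0 : ℝ) < k := by exact_mod_cast hk
  set P : Fin k → X → ℝ := fun i x => expect (iid p) fun y => part i (Function.update y i x)
    with hP
  set bad : Fin k → X → ℝ := fun i x => if P i x < ε / (2 * k) then 1 else 0 with hbad
  have hb0 : ∀ i x, 0 ≤ bad i x := fun i x => by simp only [hbad]; split_ifs <;> norm_num
  have hb1 : ∀ i x, bad i x ≤ 1 := fun i x => by simp only [hbad]; split_ifs <;> norm_num
  -- If no coordinate is bad, the product is `1`. If the coordinate `i` is bad, success is at most
  -- `part i y`, which the sum contains.
  have hpoint : ∀ y, succ y ≤ ∏ i, (1 - bad i (y i)) + ∑ i, bad i (y i) * part i y := by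
    intro y
    have hsum0 : ∀ i ∈ Finset.univ, 0 ≤ bad i (y i) * part i y :=
      fun i _ => mul_nonneg (hb0 _ _) (h0 _ _)
    by_cases hy : ∃ i, bad i (y i) = 1
    · obtain ⟨i, hi⟩ := hy
      have hge := Finset.single_le_sum hsum0 (Finset.mem_univ i)
      have hprod : 0 ≤ ∏ i, (1 - bad i (y i)) :=
        Finset.prod_nonneg fun i _ => sub_nonneg.2 (hb1 _ _)
      rw [hi, one_mul] at hge
      linarith [h2 i y]
    · have hz : ∀ i, bad i (y i) = 0 := fun i => by
        by_contra hne
        refine hy ⟨i, ?_⟩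
        simp only [hbad] at hne ⊢
        split_ifs at hne ⊢ <;> simp_all
      have : ∏ i, (1 - bad i (y i)) = 1 := by simp [hz]
      linarith [h1 y, Finset.sum_nonneg hsum0]
  -- Resampling the coordinate `i` exposes `P i x`, which is below `ε / (2 * k)` at bad `x`. Over
  -- all `k` coordinates this loses at most `ε / 2`.
  have hpart : ∀ i, expect (iid p) (fun y => bad i (y i) * part i y) ≤ ε / (2 * k) := by
    intro i
    rw [← expect_resample p i]
    calc _ ≤ expect p fun _ => ε / (2 * k) := expect_mono fun x => ?_
      _ = _ := expect_const _ _
    simp only [Function.update_self, expect_mul_left]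
    change bad i x * P i x ≤ _
    simp only [hbad]
    split_ifs with hx
    · linarith
    · rw [zero_mul]; positivity
  have hmain : ε / 2 ≤ ∏ i, (1 - expect p (bad i)) := by
    have e1 := h.trans (expect_mono hpoint)
    rw [expect_add, expect_sum, expect_iid_prod p fun i x => 1 - bad i x] at e1
    have e2 : ∑ i, expect (iid p) (fun y => bad i (y i) * part i y) ≤ ∑ _i : Fin k, ε / (2 * k) :=
      Finset.sum_le_sum fun i _ => hpart i
    have e3 : ∑ _i : Fin k, ε / (2 * k) = ε / 2 := by
      rw [Finset.sum_const, Finset.card_univ, Fintype.card_fin, nsmul_eq_mul]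
      field_simp
    simp only [expect_sub, expect_const] at e1
    linarith
  have hβ1 : ∀ i, expect p (bad i) ≤ 1 := fun i =>
    (expect_mono (hb1 i)).trans (expect_const p 1).le
  -- By `1 - β ≤ exp (-β)` the bad probabilities sum to at most `log (2 / ε)`, so the smallest of
  -- them is at most the average.
  have hexp : ε / 2 ≤ Real.exp (-∑ i, expect p (bad i)) := by
    refine hmain.trans ?_
    rw [← Finset.sum_neg_distrib, Real.exp_sum]
    refine Finset.prod_le_prod (fun i _ => sub_nonneg.2 (hβ1 i)) fun i _ => ?_
    linarith [Real.add_one_le_exp (-expect p (bad i))]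
  have hlog : ∑ i, expect p (bad i) ≤ Real.log (2 / ε) := by
    have h3 := (Real.log_le_iff_le_exp (by positivity)).2 hexp
    have h4 : Real.log (2 / ε) = -Real.log (ε / 2) := by
      rw [← Real.log_inv, inv_div]
    linarith
  by_contra hcon
  push Not at hcon
  have : Nonempty (Fin k) := ⟨⟨0, hk⟩⟩
  have hlt : ∑ _i : Fin k, Real.log (2 / ε) / k < ∑ i, expect p (bad i) :=
    Finset.sum_lt_sum_of_nonempty Finset.univ_nonempty fun i _ => hcon i
  rw [Finset.sum_const, Finset.card_univ, Fintype.card_fin, nsmul_eq_mul,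
    mul_div_cancel₀ _ hk'.ne'] at hlt
  linarith

/-- If `k` independent secrets can be found from independent observations with probability `ε`,
then a secret is rarely not the unique most likely one given its observation. -/
theorem expect_ambiguous_le {Obs S : Type} [Fintype Obs] [Fintype S] [Nonempty S]
    (p : PMF (Obs × S)) {k : ℕ} (hk : 0 < k) (O : (Fin k → Obs) → PMF (Fin k → S)) {ε : ℝ}
    (hε : 0 < ε)
    (h : ε ≤ expect (iid p) fun y => (O (fun i => (y i).1) fun i => (y i).2).toReal)
    (E : Obs × S → Prop) [DecidablePred E]
    (hE : ∀ o s, E (o, s) → ∃ s', s' ≠ s ∧ p (o, s) ≤ p (o, s')) :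
    expect p (fun x => if E x then 1 else 0) ≤ 2 * (Real.log (1 / ε) / k) := by
  classical
  have hk' : (0 : ℝ) < k := by exact_mod_cast hk
  set g : Obs → S → ℝ := fun o s => (p (o, s)).toReal with hg
  have hg0 : ∀ o s, 0 ≤ g o s := fun o s => ENNReal.toReal_nonneg
  -- `d o` is the most likely secret given `o`, and `P` the probability that guessing it is correct.
  choose d hd using fun o => Finite.exists_max (g o)
  set P : ℝ := ∑ o, g o (d o) with hPdef
  have htot : ∑ o, ∑ s, g o s = 1 := by
    rw [← Fintype.sum_prod_type', ← sum_toReal p]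
  -- No joint strategy, randomized or not, beats guessing the most likely secret in each coordinate.
  have hpow : ε ≤ P ^ k := by
    refine h.trans ?_
    have e1 : (expect (iid p) fun y => (O (fun i => (y i).1) fun i => (y i).2).toReal) =
        ∑ o : Fin k → Obs, ∑ s : Fin k → S, (∏ i, g (o i) (s i)) * (O o s).toReal := by
      rw [← Fintype.sum_prod_type', expect]
      refine Fintype.sum_equiv (Equiv.arrowProdEquivProdArrow (Fin k) (fun _ => Obs) fun _ => S)
        _ _ fun y => ?_
      rw [iid_apply_toReal]
      rfl
    rw [e1]
    calc _ ≤ ∑ o : Fin k → Obs, ∑ s : Fin k → S, (∏ i, g (o i) (d (o i))) * (O o s).toReal := by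
          refine Finset.sum_le_sum fun o _ => Finset.sum_le_sum fun s _ => ?_
          exact mul_le_mul_of_nonneg_right
            (Finset.prod_le_prod (fun i _ => hg0 _ _) fun i _ => hd _ _) ENNReal.toReal_nonneg
      _ = ∑ o : Fin k → Obs, ∏ i, g (o i) (d (o i)) := by
          simp only [← Finset.mul_sum, sum_toReal, mul_one]
      _ = P ^ k := by
          rw [hPdef, ← Fintype.piFinset_univ,
            ← Finset.prod_univ_sum (fun _ => Finset.univ) fun (_ : Fin k) o => g o (d o),
            Finset.prod_const, Finset.card_univ, Fintype.card_fin]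
  have hP0 : 0 < P := by
    have : 0 ≤ P := Finset.sum_nonneg fun o _ => hg0 _ _
    rcases this.eq_or_lt with h0 | h0
    · rw [← h0, zero_pow hk.ne'] at hpow
      linarith
    · exact h0
  have hlog : 1 - P ≤ Real.log (1 / ε) / k := by
    have e1 := Real.log_le_log hε hpow
    rw [Real.log_pow] at e1
    have e2 := Real.log_le_sub_one_of_pos hP0
    rw [le_div_iff₀ hk', one_div, Real.log_inv]
    nlinarith
  -- For each observation, the mass of `E` is at most twice the mass off `d o`: if `E` holds at `d
  -- o`, a rival at least as likely lies off `d o`; otherwise all of `E` lies off `d o`.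
  have hmain : expect p (fun x => if E x then 1 else 0) ≤ 2 * (1 - P) := by
    have hP1 : 1 - P = ∑ o, (∑ s, g o s - g o (d o)) := by
      rw [Finset.sum_sub_distrib, htot, hPdef]
    rw [expect, Fintype.sum_prod_type, hP1, Finset.mul_sum]
    refine Finset.sum_le_sum fun o _ => ?_
    have hsplit : ∑ s, g o s = g o (d o) + ∑ s ∈ Finset.univ.erase (d o), g o s :=
      (Finset.add_sum_erase _ _ (Finset.mem_univ _)).symm
    have hrest0 : 0 ≤ ∑ s ∈ Finset.univ.erase (d o), g o s :=
      Finset.sum_nonneg fun s _ => hg0 _ _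
    have hterm : ∀ s, (p (o, s)).toReal * (if E (o, s) then 1 else 0) ≤ g o s := by
      intro s
      split_ifs
      · rw [mul_one]
      · rw [mul_zero]; exact hg0 _ _
    by_cases hd' : E (o, d o)
    · obtain ⟨s', hs', hle⟩ := hE o (d o) hd'
      have e1 : g o (d o) ≤ g o s' :=
        (ENNReal.toReal_le_toReal (p.apply_ne_top _) (p.apply_ne_top _)).2 hle
      have e2 : g o s' ≤ ∑ s ∈ Finset.univ.erase (d o), g o s :=
        Finset.single_le_sum (fun s _ => hg0 o s) (Finset.mem_erase.2 ⟨hs', Finset.mem_univ _⟩)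
      have e3 := Finset.sum_le_sum fun s (_ : s ∈ Finset.univ) => hterm s
      linarith
    · rw [← Finset.add_sum_erase _ _ (Finset.mem_univ (d o)), if_neg hd', mul_zero, zero_add]
      have e3 := Finset.sum_le_sum fun s (_ : s ∈ Finset.univ.erase (d o)) => hterm s
      linarith
  linarith

/-! ### Sums of noise -/

theorem berMass_nonneg {q : ℕ} {η : ℝ} (h0 : 0 ≤ η) (h1 : η ≤ 1) (x : ZMod q) :
    0 ≤ berMass q η x := by
  have : 0 ≤ 1 - η := sub_nonneg.2 h1
  unfold berMass
  split_ifs <;> positivity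

/-- A sample is `0`, or with probability `η` uniform. A sum is uniform as soon as one summand is, so
the sum is forced to be `0` only with probability `(1 - a) * (1 - b)`. -/
theorem berQ_add {q : ℕ} [NeZero q] {a b : ℝ} (ha0 : 0 ≤ a) (ha1 : a ≤ 1) (hb0 : 0 ≤ b)
    (hb1 : b ≤ 1) : ((berQ q a).bind fun x => (berQ q b).map fun y => x + y) =
      berQ q (1 - (1 - a) * (1 - b)) := by
  have hab : 0 ≤ (1 - a) * (1 - b) := mul_nonneg (by linarith) (by linarith)
  have hab1 : (1 - a) * (1 - b) ≤ 1 := by nlinarith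
  refine pmf_ext_toReal fun y => ?_
  rw [berQ_apply_toReal (berMass_nonneg (by linarith) (by linarith)), PMF.bind_apply, tsum_fintype,
    ENNReal.toReal_sum fun x _ => ENNReal.mul_ne_top (PMF.apply_ne_top _ _) (PMF.apply_ne_top _ _)]
  have hterm : ∀ x : ZMod q, (berQ q a x * (berQ q b).map (fun y => x + y) y).toReal =
      (if x = 0 then 1 - a else 0) * berMass q b (y - x) + a / q * berMass q b (y - x) := by
    intro x
    have e1 : (berQ q b).map (fun y => x + y) y = berQ q b (y - x) := by
      conv_lhs => rw [← add_sub_cancel x y]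
      exact map_apply_of_injective _ (add_right_injective x) _
    rw [e1, ENNReal.toReal_mul, berQ_apply_toReal (berMass_nonneg ha0 ha1),
      berQ_apply_toReal (berMass_nonneg hb0 hb1), ← add_mul]
    congr 1
    unfold berMass
    split_ifs <;> ring
  rw [Finset.sum_congr rfl fun x _ => hterm x, Finset.sum_add_distrib, ← Finset.mul_sum,
    Fintype.sum_equiv (Equiv.subLeft y) (fun x => berMass q b (y - x)) (berMass q b)
      (fun _ => rfl), sum_berMass]
  simp only [ite_mul, zero_mul, Finset.sum_ite_eq', Finset.mem_univ, if_true, sub_zero]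
  unfold berMass
  split_ifs <;> ring

theorem iid_berQ_map_sum {q : ℕ} [NeZero q] {η : ℝ} (h0 : 0 ≤ η) (h1 : η ≤ 1) (k : ℕ) :
    (iid (berQ q η) : PMF (Fin k → ZMod q)).map (fun w => ∑ i, w i) =
      berQ q (1 - (1 - η) ^ k) := by
  induction k with
  | zero =>
    have e : (fun w : Fin 0 → ZMod q => ∑ i, w i) = Function.const _ 0 := by
      funext w; simp
    rw [e, PMF.map_const]
    refine pmf_ext_toReal fun x => ?_
    rw [pow_zero, sub_self, berQ_apply_toReal (berMass_nonneg le_rfl zero_le_one), berMass,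
      PMF.pure_apply]
    split_ifs <;> simp
  | succ k ih =>
    have hk0 : 0 ≤ (1 - η) ^ k := pow_nonneg (by linarith) k
    have hk1 : (1 - η) ^ k ≤ 1 := pow_le_one₀ (by linarith) (by linarith)
    have e : 1 - (1 - η) ^ (k + 1) = 1 - (1 - (1 - (1 - η) ^ k)) * (1 - η) := by ring
    rw [e, ← berQ_add (by linarith) (by linarith) h0 h1, ← ih, iid_fin_succ]
    refine map_bind_eq_bind_map fun f _ => ?_
    rw [PMF.map_comp]
    congr 1
    funext b
    simp [Fin.sum_univ_castSucc]

theorem iid_uniform {ι α : Type} [Fintype ι] [DecidableEq ι] [Fintype α] [Nonempty α] :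
    (iid (PMF.uniformOfFintype α) : PMF (ι → α)) = PMF.uniformOfFintype (ι → α) := by
  ext f
  rw [iid_apply, PMF.uniformOfFintype_apply]
  simp only [PMF.uniformOfFintype_apply, Finset.prod_const, Finset.card_univ, Fintype.card_fun,
    Nat.cast_pow, ENNReal.inv_pow]

/-! ### The samples as images of independent families -/

/-- The law of three independent random variables. -/
noncomputable def triple {α β γ : Type*} (p : PMF α) (p' : PMF β) (p'' : PMF γ) :
    PMF (α × β × γ) :=
  p.bind fun a => p'.bind fun b => p''.map fun c => (a, b, c)

theorem triple_apply {α β γ : Type*} (p : PMF α) (p' : PMF β) (p'' : PMF γ) (a : α) (b : β)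
    (c : γ) : triple p p' p'' (a, b, c) = p a * (p' b * p'' c) := by
  rw [triple, PMF.bind_apply, tsum_eq_single a, PMF.bind_apply, tsum_eq_single b,
    map_apply_of_injective _ (fun c c' h => by simpa using h)]
  · intro b' hb'
    rw [PMF.map_apply, ENNReal.tsum_eq_zero.2, mul_zero]
    intro c'
    rw [if_neg]
    intro h
    exact hb' (by simpa using (congrArg (fun z => z.2.1) h).symm)
  · intro a' ha'
    rw [PMF.bind_apply, ENNReal.tsum_eq_zero.2, mul_zero]
    intro b'
    rw [PMF.map_apply, ENNReal.tsum_eq_zero.2, mul_zero]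
    intro c'
    rw [if_neg]
    intro h
    exact ha' (by simpa using (congrArg (fun z => z.1) h).symm)

/-- The type of the samples together with the secret. -/
abbrev Instance (q n m : ℕ) : Type :=
  Matrix (Fin m) (Fin n) (ZMod q) × (Fin m → ZMod q) × (Fin n → ZMod q)

/-- The instance with a given matrix, secret and noise. -/
def mkInstance {q n m : ℕ}
    (z : (Fin m → Fin n → ZMod q) × (Fin n → ZMod q) × (Fin m → ZMod q)) : Instance q n m :=
  (Matrix.of z.1, Matrix.mulVec (Matrix.of z.1) z.2.1 + z.2.2, z.2.1)

theorem mkInstance_injective {q n m : ℕ} :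
    Function.Injective (mkInstance : _ → Instance q n m) := by
  rintro ⟨a, t, e⟩ ⟨a', t', e'⟩ h
  simp only [mkInstance, Prod.mk.injEq] at h
  obtain ⟨h1, h2, h3⟩ := h
  have h1' : a = a' := h1
  subst h1' h3
  simpa using h2

/-- The entry distribution of the matrix. -/
noncomputable abbrev entryLaw (q n σ : ℕ) [NeZero q] : PMF (ZMod q) :=
  berQ q ((q : ℝ) * σ / (((q : ℝ) - 1) * n))

section
variable {q : ℕ} [NeZero q]

theorem lpn_eq_map (η : ℝ) (n m σ : ℕ) :
    lpn q η n m σ = (triple (iid (iid (entryLaw q n σ))) (iid (PMF.uniformOfFintype (ZMod q)))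
      (iid (berQ q η))).map mkInstance := by
  rw [lpn, PMF.bind_comm, triple, PMF.map_bind, iid_uniform]
  refine congrArg _ (funext fun a => ?_)
  rw [PMF.map_bind]
  refine congrArg _ (funext fun t => ?_)
  rw [PMF.map_comp, ← PMF.bind_pure_comp]
  rfl

theorem lpn_apply (η : ℝ) (n m σ : ℕ) (A : Matrix (Fin m) (Fin n) (ZMod q)) (b : Fin m → ZMod q)
    (s : Fin n → ZMod q) : lpn q η n m σ (A, b, s) =
      iid (iid (entryLaw q n σ)) (fun i j => A i j) * ((Fintype.card (Fin n → ZMod q) : ENNReal)⁻¹ *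
        ∏ r, berQ q η (b r - A.mulVec s r)) := by
  have h : (A, b, s) = mkInstance ((fun i j => A i j), s, b - A.mulVec s) := by
    simp only [mkInstance, Prod.mk.injEq, and_true]
    refine ⟨rfl, ?_⟩
    change b = A.mulVec s + _
    abel
  rw [h, lpn_eq_map, map_apply_of_injective _ mkInstance_injective, triple_apply, iid_uniform,
    PMF.uniformOfFintype_apply]
  rfl

/-- A secret that explains the samples with fewer errors is at least as likely. -/
theorem lpn_apply_le {η : ℝ} (h0 : 0 ≤ η) (h1 : η ≤ 1) {n m σ : ℕ}
    {A : Matrix (Fin m) (Fin n) (ZMod q)} {b : Fin m → ZMod q} {s s' : Fin n → ZMod q}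
    (h : hammingDist (A.mulVec s') b ≤ hammingDist (A.mulVec s) b) :
    lpn q η n m σ (A, b, s) ≤ lpn q η n m σ (A, b, s') := by
  rw [lpn_apply, lpn_apply]
  gcongr _ * (_ * ?_)
  set c0 : ENNReal := ENNReal.ofReal (1 - η + η / q)
  set c1 : ENNReal := ENNReal.ofReal (η / q)
  have hc : c1 ≤ c0 := ENNReal.ofReal_le_ofReal (by linarith)
  have hber : ∀ x : ZMod q, berQ q η x = if x = 0 then c0 else c1 := by
    intro x
    rw [berQ, dif_pos (berMass_nonneg h0 h1), PMF.ofFintype_apply, berMass]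
    split_ifs <;> rfl
  -- The likelihood depends on the secret only through the number of errors, and by `hc` an error
  -- never raises it.
  have hprod : ∀ s : Fin n → ZMod q, ∏ r, berQ q η (b r - A.mulVec s r) =
      c0 ^ (m - hammingDist (A.mulVec s) b) * c1 ^ hammingDist (A.mulVec s) b := by
    intro s
    have hcard := Finset.card_filter_add_card_filter_not (s := Finset.univ)
      fun r => A.mulVec s r ≠ b r
    have hd : hammingDist (A.mulVec s) b =
      (Finset.univ.filter fun r => A.mulVec s r ≠ b r).card := rfl
    rw [Finset.card_univ, Fintype.card_fin, ← hd] at hcard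
    have hm : m - hammingDist (A.mulVec s) b =
        (Finset.univ.filter fun r => ¬A.mulVec s r ≠ b r).card := by omega
    rw [hm, hd]
    simp only [hber, sub_eq_zero]
    rw [Finset.prod_ite, Finset.prod_const, Finset.prod_const]
    simp only [not_not, ne_eq, eq_comm]
  rw [hprod, hprod]
  have hle : ∀ s : Fin n → ZMod q, hammingDist (A.mulVec s) b ≤ m := fun s => by
    simpa using hammingDist_le_card_fintype (x := A.mulVec s) (y := b)
  have h2 := hle s
  generalize hammingDist (A.mulVec s') b = w' at *
  generalize hammingDist (A.mulVec s) b = w at *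
  obtain ⟨d, rfl⟩ := Nat.exists_eq_add_of_le h
  obtain ⟨e, rfl⟩ := Nat.exists_eq_add_of_le h2
  have e1 : w' + d + e - (w' + d) = e := by omega
  have e2 : w' + d + e - w' = d + e := by omega
  rw [e1, e2, pow_add, pow_add]
  calc c0 ^ e * (c1 ^ w' * c1 ^ d) ≤ c0 ^ e * (c1 ^ w' * c0 ^ d) := by gcongr
    _ = c0 ^ d * c0 ^ e * c1 ^ w' := by ring

/-! ### Splitting the samples of a trial into blocks -/

variable {n m k : ℕ}

/-- Rearrange matrices, secrets and noise into `k` blocks. -/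
def blocksEquiv {α : Type} (m n k : ℕ) :
    ((Fin m → Fin (k * n) → α) × (Fin (k * n) → α) × (Fin m → Fin k → α)) ≃
      (Fin k → (Fin m → Fin n → α) × (Fin n → α) × (Fin m → α)) where
  toFun ω i := (fun r => block i (ω.1 r), block i ω.2.1, fun r => ω.2.2 r i)
  invFun y := (fun r c => (y c.divNat).1 r c.modNat, fun c => (y c.divNat).2.1 c.modNat,
    fun r i => (y i).2.2 r)
  left_inv := by
    rintro ⟨M, t, W⟩
    have h : ∀ c : Fin (k * n), finProdFinEquiv (c.divNat, c.modNat) = c :=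
      fun c => finProdFinEquiv.apply_symm_apply c
    simp only [block, h]
  right_inv := by
    intro y
    have h : ∀ (i : Fin k) (j : Fin n), (finProdFinEquiv (i, j)).divNat = i ∧
        (finProdFinEquiv (i, j)).modNat = j := fun i j =>
      Prod.mk.inj (finProdFinEquiv.symm_apply_apply (i, j))
    funext i
    refine Prod.ext (funext fun r => funext fun j => ?_) (Prod.ext (funext fun j => ?_) rfl) <;>
      simp only [block, (h _ _).1, (h _ _).2]

theorem prod_blocks {M : Type*} [CommMonoid M] (f : Fin (k * n) → M) :
    ∏ c, f c = ∏ i : Fin k, ∏ j, block i f j := by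
  rw [← Fintype.prod_prod_type', ← Equiv.prod_comp finProdFinEquiv]
  rfl

/-- Both sides are products over all entries drawn; only the grouping of the factors differs. -/
theorem sampleLaw_map_blocks (χ ν : PMF (ZMod q)) :
    (sampleLaw χ ν m (k * n) k).map (blocksEquiv m n k) =
      iid (triple (iid (iid χ)) (iid (PMF.uniformOfFintype (ZMod q))) (iid ν)) := by
  ext y
  obtain ⟨ω, rfl⟩ := (blocksEquiv m n k).surjective y
  rw [map_apply_of_injective _ (blocksEquiv m n k).injective]
  obtain ⟨M, t, W⟩ := ω
  change triple _ _ _ (M, t, W) = _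
  simp only [triple_apply, iid_apply, blocksEquiv, Equiv.coe_fn_mk]
  rw [Finset.prod_mul_distrib, Finset.prod_mul_distrib,
    Finset.prod_comm (f := fun (i : Fin k) (r : Fin m) => ∏ j, χ (block i (M r) j)),
    prod_blocks fun c => (PMF.uniformOfFintype (ZMod q)) (t c),
    Finset.prod_comm (f := fun (i : Fin k) (r : Fin m) => ν (W r i))]
  congr 1
  exact Finset.prod_congr rfl fun r _ => prod_blocks fun c => χ (M r c)

/-- The `k` instances sampled in a trial. -/
def gather (ω : (Fin m → Fin (k * n) → ZMod q) × (Fin (k * n) → ZMod q) × (Fin m → Fin k → ZMod q))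
    (i : Fin k) : Instance q n m :=
  mkInstance (blocksEquiv m n k ω i)

theorem sampleLaw_map_gather (η : ℝ) (σ : ℕ) :
    (sampleLaw (entryLaw q n σ) (berQ q η) m (k * n) k).map gather =
      (iid (lpn q η n m σ) : PMF (Fin k → Instance q n m)) := by
  rw [lpn_eq_map, ← iid_map, ← sampleLaw_map_blocks, PMF.map_comp]
  rfl

/-- Put the matrices of `k` instances side by side, add their right-hand sides, and concatenate
their secrets. -/
def joinInstances (y : Fin k → Instance q n m) : Instance q (k * n) m :=
  (Matrix.of fun r c => (y c.divNat).1 r c.modNat, fun r => ∑ i, (y i).2.1 r,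
    fun c => (y c.divNat).2.2 c.modNat)

theorem sum_blocks {M : Type*} [AddCommMonoid M] (f : Fin (k * n) → M) :
    ∑ c, f c = ∑ i : Fin k, ∑ j : Fin n, f (finProdFinEquiv (i, j)) := by
  rw [← Fintype.sum_prod_type', ← Equiv.sum_comp finProdFinEquiv]

omit [NeZero q] in
theorem joinInstances_gather
    (ω : (Fin m → Fin (k * n) → ZMod q) × (Fin (k * n) → ZMod q) × (Fin m → Fin k → ZMod q)) :
    joinInstances (gather ω) = mkInstance (ω.1, ω.2.1, fun r => ∑ i, ω.2.2 r i) := by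
  have h : ∀ c : Fin (k * n), finProdFinEquiv (c.divNat, c.modNat) = c :=
    fun c => finProdFinEquiv.apply_symm_apply c
  simp only [joinInstances, gather, mkInstance, blocksEquiv, Equiv.coe_fn_mk, block, h,
    Matrix.of_apply, Prod.mk.injEq, true_and, and_true]
  funext r
  simp only [Pi.add_apply, Finset.sum_add_distrib, Matrix.mulVec, dotProduct, Matrix.of_apply, block,
    sum_blocks (k := k) (n := n)]

/-- The ratio `σ / n` is unchanged by the factor `k`, products of matrix and secret add up over the
blocks, and so do the noise vectors, whose sum has the oracle's rate. -/
theorem iid_lpn_map_joinInstances {η : ℝ} (h0 : 0 ≤ η) (h1 : η ≤ 1) (hk : 0 < k) (σ : ℕ) :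
    (iid (lpn q η n m σ) : PMF (Fin k → Instance q n m)).map joinInstances =
      lpn q (1 - (1 - η) ^ k) (k * n) m (k * σ) := by
  have hk' : (k : ℝ) ≠ 0 := by positivity
  have hχ : entryLaw q (k * n) (k * σ) = entryLaw q n σ := by
    rw [entryLaw, entryLaw]
    congr 1
    push_cast
    rw [show (q : ℝ) * (k * σ) = k * (q * σ) by ring,
      show ((q : ℝ) - 1) * (k * n) = k * (((q : ℝ) - 1) * n) by ring, mul_div_mul_left _ _ hk']
  rw [← sampleLaw_map_gather, PMF.map_comp, lpn_eq_map, hχ, ← iid_berQ_map_sum h0 h1 k, ← iid_map,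
    triple, sampleLaw, PMF.map_bind, PMF.map_bind]
  refine congrArg _ (funext fun M => ?_)
  rw [PMF.map_bind, PMF.map_bind]
  refine congrArg _ (funext fun t => ?_)
  rw [PMF.map_comp, PMF.map_comp, PMF.map_comp]
  congr 1
  funext W
  exact joinInstances_gather (M, t, W)

omit [NeZero q] in
/-- Hiding an instance among sampled ones replaces one of them. -/
theorem joinInstances_update_gather (i : Fin k) (x : Instance q n m)
    (ω : (Fin m → Fin (k * n) → ZMod q) × (Fin (k * n) → ZMod q) × (Fin m → Fin k → ZMod q)) :
    (joinInstances (Function.update (gather ω) i x)).1 = hideMat i x.1 ω.1 ∧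
      (joinInstances (Function.update (gather ω) i x)).2.1 = hideRhs i x.1 x.2.1 ω := by
  have h : ∀ c : Fin (k * n), finProdFinEquiv (c.divNat, c.modNat) = c :=
    fun c => finProdFinEquiv.apply_symm_apply c
  have h' : ∀ (i : Fin k) (j : Fin n), (finProdFinEquiv (i, j)).divNat = i :=
    fun i j => (Prod.mk.inj (finProdFinEquiv.symm_apply_apply (i, j))).1
  constructor
  · ext r c
    simp only [joinInstances, hideMat, Matrix.of_apply]
    by_cases hc : c.divNat = i
    · rw [if_pos hc, hc, Function.update_self]
    · rw [if_neg hc, Function.update_of_ne hc]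
      simp only [gather, mkInstance, blocksEquiv, Equiv.coe_fn_mk, block, Matrix.of_apply, h]
  · funext r
    simp only [joinInstances, hideRhs, hideMat, Matrix.of_apply]
    rw [sum_blocks, add_assoc, ← Finset.sum_add_distrib, ← Finset.add_sum_erase _ _
      (Finset.mem_univ i), Function.update_self, ← Finset.add_sum_erase _ _ (Finset.mem_univ i)]
    -- The block `i` has secret and noise zero, so beyond `b` it contributes nothing.
    have hi : (∑ j : Fin n, (if (finProdFinEquiv (i, j)).divNat = i then
        x.1 r (finProdFinEquiv (i, j)).modNat else ω.1 r (finProdFinEquiv (i, j))) *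
        (if (finProdFinEquiv (i, j)).divNat = i then 0 else ω.2.1 (finProdFinEquiv (i, j))) +
        if i = i then 0 else ω.2.2 r i) = 0 := by
      simp [h']
    rw [hi, zero_add]
    congr 1
    refine Finset.sum_congr rfl fun i' hi' => ?_
    have hne := Finset.ne_of_mem_erase hi'
    rw [Function.update_of_ne hne, if_neg hne]
    simp only [gather, mkInstance, blocksEquiv, Equiv.coe_fn_mk, block, h', if_neg hne,
      Pi.add_apply, Matrix.mulVec, dotProduct, Matrix.of_apply]

end

/-! ### The success probability of the reduction -/

theorem successProb_eq_expect {q : ℕ} [NeZero q] (η : ℝ) (n m σ : ℕ) (S : Solver q n m) :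
    successProb q η n m σ S =
      expect (lpn q η n m σ) fun x => (S x.1 x.2.1 x.2.2).toReal := by
  rw [successProb, PMF.bind_apply, tsum_fintype,
    ENNReal.toReal_sum fun x _ => ENNReal.mul_ne_top (PMF.apply_ne_top _ _) (PMF.apply_ne_top _ _),
    expect]
  refine Finset.sum_congr rfl fun x _ => ?_
  rw [ENNReal.toReal_mul, PMF.map_apply, tsum_eq_single x.2.2, if_pos (by simp)]
  intro z hz
  rw [if_neg (by simpa using hz)]

/-- Applied with `f` the indicator of not holding the secret: failure probabilities multiply along
the chain. -/
theorem expect_iterKernel_le {α : Type} [Fintype α] [DecidableEq α] (K : ℕ → α → PMF α)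
    (f : α → ℝ) (c : ℕ → ℝ) (hc : ∀ i, 0 ≤ c i) (h : ∀ i z, expect (K i z) f ≤ c i * f z) (z : α)
    (j : ℕ) : expect (iterKernel K z j) f ≤ (∏ i ∈ Finset.range j, c i) * f z := by
  induction j with
  | zero => simp [iterKernel, expect_pure]
  | succ j ih =>
    rw [iterKernel, expect_bind, Finset.prod_range_succ]
    calc _ ≤ expect (iterKernel K z j) (fun z' => c j * f z') := expect_mono (h j)
      _ = c j * expect (iterKernel K z j) f := expect_mul_left _ _ _
      _ ≤ c j * ((∏ i ∈ Finset.range j, c i) * f z) := mul_le_mul_of_nonneg_left ih (hc j)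
      _ = _ := by ring

theorem expect_indicator_ne {α : Type} [Fintype α] [DecidableEq α] (p : PMF α) (a : α) :
    expect p (fun z => if z = a then 0 else 1) = 1 - (p a).toReal := by
  have h : (fun z => if z = a then (0 : ℝ) else 1) = fun z => 1 - if z = a then 1 else 0 := by
    funext z
    split_ifs <;> norm_num
  rw [h, expect_sub, expect_const]
  simp [expect]

theorem one_sub_expect {α : Type} [Fintype α] (p : PMF α) (f : α → ℝ) :
    1 - expect p f = expect p fun x => 1 - f x := by
  rw [expect_sub, expect_const]

section
variable {q n m k : ℕ}

theorem block_joinInstances (y : Fin k → Instance q n m) (i : Fin k) :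
    block i (joinInstances y).2.2 = (y i).2.2 := by
  have h : ∀ (i : Fin k) (j : Fin n), (finProdFinEquiv (i, j)).divNat = i ∧
      (finProdFinEquiv (i, j)).modNat = j := fun i j =>
    Prod.mk.inj (finProdFinEquiv.symm_apply_apply (i, j))
  funext j
  simp only [block, joinInstances, (h _ _).1, (h _ _).2]

theorem blocks_injective {α : Type*} :
    Function.Injective fun (z : Fin (k * n) → α) (i : Fin k) => block i z := by
  intro z z' h
  funext c
  have h1 := congrFun (congrFun h c.divNat) c.modNat
  have h2 : finProdFinEquiv (c.divNat, c.modNat) = c := finProdFinEquiv.apply_symm_apply c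
  simpa only [block, h2] using h1

/-- Some other vector explains the samples with at most as many errors as the secret. -/
def Ambiguous (x : Instance q n m) : Prop :=
  ∃ z, z ≠ x.2.2 ∧ hammingDist (x.1.mulVec z) x.2.1 ≤ hammingDist (x.1.mulVec x.2.2) x.2.1

/-- Without ambiguity the secret has strictly fewer errors than any other vector, so it wins from
either side and ties cannot occur. -/
theorem better_self {A : Matrix (Fin m) (Fin n) (ZMod q)} {b : Fin m → ZMod q}
    {s : Fin n → ZMod q} (h : ¬Ambiguous (A, b, s)) (z : Fin n → ZMod q) :
    better A b z s = s ∧ better A b s z = s := by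
  simp only [Ambiguous, not_exists, not_and, not_le] at h
  by_cases hz : z = s
  · subst hz
    simp [better]
  · have := h z hz
    rw [better, better, if_neg (by omega), if_pos this]
    exact ⟨rfl, rfl⟩

variable (O : Solver q (k * n) m)

/-- The probability that the oracle finds all secrets of `k` joined instances. -/
noncomputable def jointSuccess (y : Fin k → Instance q n m) : ℝ :=
  (O (joinInstances y).1 (joinInstances y).2.1 (joinInstances y).2.2).toReal

theorem jointSuccess_le_one (y : Fin k → Instance q n m) : jointSuccess O y ≤ 1 :=
  ENNReal.toReal_le_of_le_ofReal zero_le_one (by simpa using PMF.coe_le_one _ _)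

variable [NeZero q]

/-- The probability that the oracle finds the secret of the instance `i`. -/
noncomputable def blockSuccess (i : Fin k) (y : Fin k → Instance q n m) : ℝ :=
  expect (O (joinInstances y).1 (joinInstances y).2.1) fun z =>
    if block i z = (y i).2.2 then 1 else 0

/-- The probability that the oracle finds the secret of `x` if `x` is hidden at the position `i`
among random instances. -/
noncomputable def hitProb (η : ℝ) (σ : ℕ) (i : Fin k) (x : Instance q n m) : ℝ :=
  expect (iid (lpn q η n m σ)) fun y => blockSuccess O i (Function.update y i x)

theorem blockSuccess_nonneg (i : Fin k) (y : Fin k → Instance q n m) : 0 ≤ blockSuccess O i y :=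
  expect_nonneg fun z => by split_ifs <;> norm_num

theorem blockSuccess_le_one (i : Fin k) (y : Fin k → Instance q n m) : blockSuccess O i y ≤ 1 :=
  (expect_mono fun z => by split_ifs <;> norm_num).trans (expect_const _ 1).le

theorem jointSuccess_le_blockSuccess (i : Fin k) (y : Fin k → Instance q n m) :
    jointSuccess O y ≤ blockSuccess O i y := by
  have h : ∀ z ∈ Finset.univ, 0 ≤ (O (joinInstances y).1 (joinInstances y).2.1 z).toReal *
      (if block i z = (y i).2.2 then 1 else 0) := fun z _ =>
    mul_nonneg ENNReal.toReal_nonneg (by split_ifs <;> norm_num)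
  refine le_trans ?_ (Finset.single_le_sum h (Finset.mem_univ (joinInstances y).2.2))
  rw [if_pos (block_joinInstances y i), mul_one, jointSuccess]

theorem hitProb_nonneg (η : ℝ) (σ : ℕ) (i : Fin k) (x : Instance q n m) :
    0 ≤ hitProb O η σ i x :=
  expect_nonneg fun _ => blockSuccess_nonneg O i _

theorem hitProb_le_one (η : ℝ) (σ : ℕ) (i : Fin k) (x : Instance q n m) :
    hitProb O η σ i x ≤ 1 :=
  (expect_mono fun _ => blockSuccess_le_one O i _).trans (expect_const _ 1).le

variable {O}

theorem successProb_eq_expect_jointSuccess {η : ℝ} (h0 : 0 ≤ η) (h1 : η ≤ 1) (hk : 0 < k) (σ : ℕ) :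
    successProb q (1 - (1 - η) ^ k) (k * n) m (k * σ) O =
      expect (iid (lpn q η n m σ)) (jointSuccess O) := by
  rw [successProb_eq_expect, ← iid_lpn_map_joinInstances h0 h1 hk, expect_map]
  rfl

/-- In an ambiguous instance some rival is at least as likely as the secret (`lpn_apply_le`), so
`expect_ambiguous_le` applies with the oracle as joint guesser. -/
theorem expect_ambiguous_le_of_oracle {η ε : ℝ} (h0 : 0 ≤ η) (h1 : η ≤ 1) (hk : 0 < k) (σ : ℕ)
    (hε : 0 < ε) (h : ε ≤ expect (iid (lpn q η n m σ)) (jointSuccess O))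
    [DecidablePred (Ambiguous : Instance q n m → Prop)] :
    expect (lpn q η n m σ) (fun x => if Ambiguous x then 1 else 0) ≤
      2 * (Real.log (1 / ε) / k) := by
  classical
  let assoc : Instance q n m → (Matrix (Fin m) (Fin n) (ZMod q) × (Fin m → ZMod q)) ×
    (Fin n → ZMod q) := fun x => ((x.1, x.2.1), x.2.2)
  have hassoc : Function.Injective assoc := by
    rintro ⟨A, b, s⟩ ⟨A', b', s'⟩ h
    simp only [assoc, Prod.mk.injEq] at h ⊢
    tauto
  have key := expect_ambiguous_le ((lpn q η n m σ).map assoc) hk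
    -- The secrets `0` are dummies: the query built by `joinInstances` does not depend on them.
    (fun o => (O (joinInstances fun i => ((o i).1, (o i).2, 0)).1
      (joinInstances fun i => ((o i).1, (o i).2, 0)).2.1).map fun z i => block i z) hε
    (by
      rw [← iid_map, expect_map]
      refine h.trans (le_of_eq (congrArg _ (funext fun y => ?_)))
      have e : (fun i => (assoc (y i)).2) = (fun i => block i (joinInstances y).2.2) :=
        funext fun i => (block_joinInstances y i).symm
      rw [e, map_apply_of_injective _ blocks_injective]
      rfl)
    (fun x => Ambiguous (x.1.1, x.1.2, x.2))
    (by
      rintro ⟨A, b⟩ s ⟨z, hz, hle⟩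
      refine ⟨z, hz, ?_⟩
      have e : ∀ s, (lpn q η n m σ).map assoc ((A, b), s) = lpn q η n m σ (A, b, s) :=
        fun s => map_apply_of_injective _ hassoc (A, b, s)
      rw [e, e]
      exact lpn_apply_le h0 h1 hle)
  rw [expect_map] at key
  exact key

/-- The secret is never given up once held, and a trial that hits it replaces any other candidate by
it. -/
theorem expect_trialKernel_le {η : ℝ} {σ : ℕ} (i : Fin k) {x : Instance q n m}
    (hx : ¬Ambiguous x) (z : Fin n → ZMod q) :
    expect (trialKernel (entryLaw q n σ) (berQ q η) O x.1 x.2.1 i z)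
      (fun z => if z = x.2.2 then 0 else 1) ≤
      (1 - hitProb O η σ i x) * (if z = x.2.2 then 0 else 1) := by
  have hP : hitProb O η σ i x = expect (sampleLaw (entryLaw q n σ) (berQ q η) m (k * n) k)
      fun ω => expect (O (hideMat i x.1 ω.1) (hideRhs i x.1 x.2.1 ω)) fun y =>
        if block i y = x.2.2 then 1 else 0 := by
    rw [hitProb, ← sampleLaw_map_gather, expect_map]
    refine congrArg _ (funext fun ω => ?_)
    have h := joinInstances_update_gather i x ω
    rw [blockSuccess, h.1, h.2, Function.update_self]
  rw [trialKernel, expect_bind]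
  simp only [expect_map]
  by_cases hz : z = x.2.2
  · simp only [hz, (better_self hx _).1, if_true, expect_const, mul_zero, le_refl]
  · rw [if_neg hz, mul_one, hP, one_sub_expect]
    refine expect_mono fun ω => ?_
    rw [one_sub_expect]
    refine expect_mono fun y => ?_
    by_cases hy : block i y = x.2.2
    · rw [hy, (better_self hx z).2]
      simp
    · rw [if_neg hy]
      split_ifs <;> norm_num

/-- One good position suffices, and the program need not know which: the other positions contribute
factors at most `1` to the failure probability. -/
theorem one_sub_pow_le_reduction {η θ : ℝ} {σ T : ℕ} (i : Fin k) {x : Instance q n m}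
    (hx : ¬Ambiguous x) (hθ : θ ≤ hitProb O η σ i x) :
    1 - (1 - θ) ^ T ≤ (iterKernel (positionKernel (entryLaw q n σ) (berQ q η) O x.1 x.2.1 T)
      0 k x.2.2).toReal := by
  classical
  let c : ℕ → ℝ := fun j => if h : j < k then (1 - hitProb O η σ ⟨j, h⟩ x) ^ T else 1
  have hc0 : ∀ j, 0 ≤ c j := fun j => by
    simp only [c]
    split_ifs
    · exact pow_nonneg (sub_nonneg.2 (hitProb_le_one O _ _ _ _)) _
    · exact zero_le_one
  have hc1 : ∀ j, c j ≤ 1 := fun j => by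
    simp only [c]
    split_ifs
    · exact pow_le_one₀ (sub_nonneg.2 (hitProb_le_one O _ _ _ _))
        (by linarith [hitProb_nonneg O η σ ⟨j, ‹_›⟩ x])
    · exact le_rfl
  have key := expect_iterKernel_le
    (positionKernel (entryLaw q n σ) (berQ q η) O x.1 x.2.1 T)
    (fun z => if z = x.2.2 then 0 else 1) c hc0 (fun j z => by
      by_cases hj : j < k
      · rw [show c j = (1 - hitProb O η σ ⟨j, hj⟩ x) ^ T from dif_pos hj, positionKernel, dif_pos hj]
        refine (expect_iterKernel_le _ _ (fun _ => 1 - hitProb O η σ ⟨j, hj⟩ x)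
          (fun _ => sub_nonneg.2 (hitProb_le_one O _ _ _ _))
          (fun _ z => expect_trialKernel_le ⟨j, hj⟩ hx z) z T).trans ?_
        rw [Finset.prod_const, Finset.card_range]
      · rw [show c j = 1 from dif_neg hj, positionKernel, dif_neg hj, expect_pure, one_mul]) 0 k
  rw [expect_indicator_ne] at key
  have hprod : ∏ j ∈ Finset.range k, c j ≤ (1 - θ) ^ T := by
    rw [← Finset.mul_prod_erase _ _ (Finset.mem_range.2 i.2)]
    calc c i * ∏ j ∈ (Finset.range k).erase i, c j ≤ c i * 1 :=
          mul_le_mul_of_nonneg_left (Finset.prod_le_one (fun j _ => hc0 j) fun j _ => hc1 j) (hc0 i)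
      _ = (1 - hitProb O η σ i x) ^ T := by simp [c]
      _ ≤ (1 - θ) ^ T :=
          pow_le_pow_left₀ (sub_nonneg.2 (hitProb_le_one O _ _ _ _)) (by linarith) T
  have hle : (∏ j ∈ Finset.range k, c j) * (if (0 : Fin n → ZMod q) = x.2.2 then (0 : ℝ) else 1) ≤
      ∏ j ∈ Finset.range k, c j := by
    have := Finset.prod_nonneg (s := Finset.range k) fun j _ => hc0 j
    split_ifs <;> linarith
  linarith

/-- The number of trials times `ε / (2 * k)` is at least `2 / δ`, and `exp (-(2 / δ)) ≤ δ / 2`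
because `exp t ≥ t`. -/
theorem pow_le_half {ε δ : ℝ} (hε : 0 < ε) (hε1 : ε ≤ 1) (hδ : 0 < δ) (hk : 0 < k) :
    (1 - ε / (2 * k)) ^ (4 * (k * (⌈1 / δ⌉₊ * ⌈1 / ε⌉₊))) ≤ δ / 2 := by
  have hk' : (1 : ℝ) ≤ k := by exact_mod_cast hk
  have hθ : ε / (2 * k) ≤ 1 := by rw [div_le_one (by positivity)]; linarith
  have hT : 2 / δ ≤ ε / (2 * k) * (4 * (k * (⌈1 / δ⌉₊ * ⌈1 / ε⌉₊)) : ℕ) := by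
    have h1 := Nat.le_ceil (1 / δ)
    have h2 := Nat.le_ceil (1 / ε)
    have h3 : ε / (2 * k) * (4 * (k * (⌈1 / δ⌉₊ * ⌈1 / ε⌉₊)) : ℕ) =
        2 * (ε * ⌈1 / ε⌉₊) * ⌈1 / δ⌉₊ := by
      push_cast
      field_simp
      norm_num
    have h4 : 1 ≤ ε * ⌈1 / ε⌉₊ := by
      rwa [div_le_iff₀ hε, mul_comm] at h2
    have h5 : 0 < 1 / δ := by positivity
    rw [h3, show 2 / δ = 2 * (1 / δ) by ring]
    nlinarith
  have h1 : (1 - ε / (2 * k)) ^ (4 * (k * (⌈1 / δ⌉₊ * ⌈1 / ε⌉₊))) ≤ Real.exp (-(2 / δ)) := by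
    calc _ ≤ Real.exp (-(ε / (2 * k))) ^ (4 * (k * (⌈1 / δ⌉₊ * ⌈1 / ε⌉₊))) :=
          pow_le_pow_left₀ (by linarith) (by linarith [Real.add_one_le_exp (-(ε / (2 * k)))]) _
      _ ≤ _ := by
          rw [← Real.exp_nat_mul]
          exact Real.exp_le_exp.2 (by linarith)
  refine h1.trans ?_
  rw [Real.exp_neg, inv_le_comm₀ (Real.exp_pos _) (by positivity), inv_div]
  linarith [Real.add_one_le_exp (2 / δ)]

/-- A union bound: unlucky repetitions cost `δ / 2`, bad instances at the chosen position at most `δ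
/ 192`, and ambiguous instances at most `2 * δ / 192`. -/
theorem successProb_reduction {η ε δ : ℝ} {σ : ℕ} (hq : 2 ≤ q) (hn : 0 < n) (hk : 0 < k)
    (hσ : σ ≤ n) (h0 : 0 ≤ η) (h1 : η ≤ 1) (hε : 0 < ε) (hδ : 0 < δ)
    (hlog : 192 / δ * Real.log (8 / ε) < k)
    (hO : ε ≤ successProb q (1 - (1 - η) ^ k) (k * n) m (k * σ) O) :
    1 - δ ≤ successProb q η n m σ
      (reduction.toSolver n [q, n, m, k, σ, ⌈1 / δ⌉₊, ⌈1 / ε⌉₊] (berQ q η) O) := by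
  classical
  have hk' : (0 : ℝ) < k := by exact_mod_cast hk
  rw [successProb_eq_expect_jointSuccess h0 h1 hk] at hO
  have hε1 : ε ≤ 1 :=
    hO.trans ((expect_mono (jointSuccess_le_one O)).trans (expect_const _ 1).le)
  have hlog' : Real.log (8 / ε) / k < δ / 192 := by
    rw [div_mul_eq_mul_div, div_lt_iff₀ hδ] at hlog
    rw [div_lt_iff₀ hk']
    linarith
  have hlog2 : Real.log (2 / ε) / k ≤ Real.log (8 / ε) / k := by
    gcongr
    norm_num
  have hlog1 : Real.log (1 / ε) / k ≤ Real.log (8 / ε) / k := by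
    gcongr
    norm_num
  obtain ⟨i, hi⟩ := exists_position (lpn q η n m σ) hk (jointSuccess O) (blockSuccess O)
    (jointSuccess_le_one O) (jointSuccess_le_blockSuccess O) (blockSuccess_nonneg O) hε hO
  have hamb := expect_ambiguous_le_of_oracle h0 h1 hk σ hε hO
  have hT := pow_le_half (k := k) hε hε1 hδ hk
  set T := 4 * (k * (⌈1 / δ⌉₊ * ⌈1 / ε⌉₊)) with hTdef
  have hpoint : ∀ x : Instance q n m,
      1 - (1 - ε / (2 * k)) ^ T - (if hitProb O η σ i x < ε / (2 * k) then 1 else 0) -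
        (if Ambiguous x then 1 else 0) ≤
      ((reduction.toSolver n [q, n, m, k, σ, ⌈1 / δ⌉₊, ⌈1 / ε⌉₊] (berQ q η) O) x.1 x.2.1
        x.2.2).toReal := by
    intro x
    have hpow0 : 0 ≤ (1 - ε / (2 * k)) ^ T := by
      have hk1 : (1 : ℝ) ≤ k := by exact_mod_cast hk
      refine pow_nonneg (sub_nonneg.2 ?_) T
      rw [div_le_one (by positivity)]
      linarith
    have hnn : 0 ≤ ((reduction.toSolver n [q, n, m, k, σ, ⌈1 / δ⌉₊, ⌈1 / ε⌉₊] (berQ q η) O)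
      x.1 x.2.1 x.2.2).toReal := ENNReal.toReal_nonneg
    by_cases hbad : hitProb O η σ i x < ε / (2 * k)
    · rw [if_pos hbad]
      split_ifs <;> linarith
    · by_cases hamb : Ambiguous x
      · rw [if_pos hamb, if_neg hbad]
        linarith
      · rw [if_neg hamb, if_neg hbad, sub_zero, sub_zero, reduction_law hq hn hσ]
        exact one_sub_pow_le_reduction i hamb (not_lt.1 hbad)
  rw [successProb_eq_expect]
  refine le_trans ?_ (expect_mono hpoint)
  rw [expect_sub, expect_sub, expect_const]
  change 1 - δ ≤ 1 - (1 - ε / (2 * k)) ^ T - expect (lpn q η n m σ) (fun x =>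
    if expect (iid (lpn q η n m σ)) (fun y => blockSuccess O i (Function.update y i x)) <
      ε / (2 * k) then 1 else 0) - _
  linarith

end

/-! ### The running time of the reduction -/

/-- Residues modulo `q` thus have `O(m)` bits, which is what keeps `q` out of the running time.
Since `n^3 / σ^2 ≥ 1`, the number of samples is at least `48 log q`. -/
theorem le_two_pow_of_samples {q n m σ : ℕ} (hq : 1 ≤ q) (hn : 0 < n) (hσ0 : 0 < σ) (hσ : σ ≤ n)
    (hm : 48 * ((n : ℝ) ^ 3 * Real.log q / (σ : ℝ) ^ 2) ≤ m) : q ≤ 2 ^ m := by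
  have hn' : (1 : ℝ) ≤ n := by exact_mod_cast hn
  have hσ' : (0 : ℝ) < σ := by exact_mod_cast hσ0
  have hσn : (σ : ℝ) ≤ n := by exact_mod_cast hσ
  have hlog : 0 ≤ Real.log q := Real.log_nonneg (by exact_mod_cast hq)
  have h1 : Real.log q ≤ (n : ℝ) ^ 3 * Real.log q / (σ : ℝ) ^ 2 := by
    rw [le_div_iff₀ (by positivity), mul_comm]
    refine mul_le_mul_of_nonneg_right ?_ hlog
    calc (σ : ℝ) ^ 2 ≤ (n : ℝ) ^ 2 := by gcongr
      _ ≤ (n : ℝ) ^ 3 := pow_le_pow_right₀ hn' (by norm_num)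
  have h2 : Real.log q ≤ Real.log ((2 : ℝ) ^ m) := by
    rw [Real.log_pow]
    nlinarith [Real.log_two_gt_d9, (Nat.cast_nonneg m : (0 : ℝ) ≤ m)]
  have h3 := (Real.log_le_log_iff (by exact_mod_cast hq) (by positivity)).1 h2
  exact_mod_cast h3

theorem reduction_time_le {q n m k σ D E : ℕ} [NeZero q] {ν : PMF (ZMod q)}
    {O : Solver q (k * n) m} {A : Matrix (Fin m) (Fin n) (ZMod q)} {b : Fin m → ZMod q}
    (hn : 0 < n) (hm : 0 < m) (hσ : σ ≤ n) (hq : q ≤ 2 ^ m) {s : State}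
    (hs : s ∈ (reduction.run ν O (initState [q, n, m, k, σ, D, E] A b)).support) :
    s.time ≤ reduction.ops (n + m + k + D + E) *
      ((n + m + k + D + E) + reduction.ops (n + m + k + D + E) + 1) := by
  set N := n + m + k + D + E with hN
  have hNlt : N < 2 ^ N := Nat.lt_two_pow_self
  have hqN : q ≤ 2 ^ N := hq.trans (Nat.pow_le_pow_right (by norm_num) (by omega))
  have hval : ∀ v : ZMod q, v.val ≤ 2 ^ N := fun v => (ZMod.val_lt v).le.trans hqN
  have hreg : ∀ x, (initState [q, n, m, k, σ, D, E] A b).reg (x + 1) ≤ N := by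
    intro x
    match x with
    | 0 => change n ≤ N; omega
    | 1 => change m ≤ N; omega
    | 2 => change k ≤ N; omega
    | 3 => change σ ≤ N; omega
    | 4 => change D ≤ N; omega
    | 5 => change E ≤ N; omega
    | x + 6 => change 0 ≤ N; omega
  have hbdd : (initState [q, n, m, k, σ, D, E] A b).Bdd N := by
    refine ⟨fun x => ?_, fun a i j => ?_⟩
    · match x with
      | 0 => exact hqN
      | x + 1 => exact (hreg x).trans hNlt.le
    · simp only [initState]
      split_ifs
      · exact hval _
      · exact Nat.zero_le _
      · exact hval _
      · exact Nat.zero_le _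
      · exact Nat.zero_le _
  -- `N` serves both as bound for the parameters and as initial bit length; `2 ≤ N` because `n` and
  -- `m` are positive.
  have h := Cmd.time_le (ν := ν) (O := O) (N := N) (by omega) reduction reduction_tame N _ hbdd rfl
    (fun x hx _ => by
      obtain ⟨y, rfl⟩ := Nat.exists_eq_add_of_le' hx
      exact hreg y) s hs
  simpa [initState] using h.2.2

theorem exists_reduction_time_le : ∃ C d : ℕ, ∀ N : ℕ, 1 ≤ N →
    reduction.ops N * (N + reduction.ops N + 1) ≤ C * N ^ d := by
  obtain ⟨a, b, h⟩ := reduction.exists_ops_le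
  refine ⟨a * (a + 2), 2 * b + 1, fun N hN => ?_⟩
  have h1 := h N hN
  have h2 : N ≤ N ^ (b + 1) := Nat.le_self_pow (by omega) N
  have h3 : N ^ b ≤ N ^ (b + 1) := Nat.pow_le_pow_right hN (by omega)
  have h4 : 1 ≤ N ^ (b + 1) := Nat.one_le_pow _ _ hN
  calc reduction.ops N * (N + reduction.ops N + 1)
      ≤ (a * N ^ b) * (N ^ (b + 1) + a * N ^ (b + 1) + N ^ (b + 1)) := by
        gcongr
        exact h1.trans (Nat.mul_le_mul_left a h3)
    _ = a * (a + 2) * N ^ (2 * b + 1) := by ring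

end SparseLPN

/-! ### The theorem -/

open SparseLPN in
theorem mainTheorem3 :
    ∃ (P : Cmd) (C d : ℕ),
      ∀ (q : ℕ) [Fact q.Prime] (n m k σ : ℕ) (η ε δ : ℝ),
        0 < n → 0 < m → 0 < k → 0 < σ → σ ≤ n →
        48 * ((n : ℝ) ^ 3 * Real.log q / (σ : ℝ) ^ 2) ≤ m →
        0 < ε →
        6 * (2 : ℝ) ^ (-(2 * (n : ℤ) - 1)) < δ →
        0 < η → η < 1 / 8 →
        192 / δ * Real.log (8 / ε) < k →
        (k : ℝ) < (2 : ℝ) ^ (2 * (n : ℤ) - 2) * ε →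
        ∀ O : Solver q (k * n) m,
          (∀ (A : Matrix (Fin m) (Fin n) (ZMod q)) (b : Fin m → ZMod q),
            ∀ s ∈ (P.run (berQ q η) O
                (initState [q, n, m, k, σ, ⌈1 / δ⌉₊, ⌈1 / ε⌉₊] A b)).support,
              (s.time : ℝ) ≤ C * (n + m + k + 1 / δ + 1 / ε) ^ d) ∧
          (ε ≤ successProb q (1 - (1 - η) ^ k) (k * n) m (k * σ) O →
            1 - δ ≤ successProb q η n m σ
              (P.toSolver n [q, n, m, k, σ, ⌈1 / δ⌉₊, ⌈1 / ε⌉₊] (berQ q η) O)) := by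
  obtain ⟨C, d, hCd⟩ := exists_reduction_time_le
  -- The factor `2 ^ d` absorbs the two ceilings: each adds at most `1`, and `n, m ≥ 1`, so the sum
  -- of the parameters at most doubles.
  refine ⟨reduction, C * 2 ^ d, d, ?_⟩
  intro q _ n m k σ η ε δ hn hm hk hσ0 hσ hsamples hε hδ' hη0 hη1 hlog _ O
  have hq := (Fact.out : q.Prime).two_le
  have hδ : 0 < δ := lt_trans (by positivity) hδ'
  refine ⟨fun A b s hs => ?_, fun hO =>
    successProb_reduction hq hn hk hσ hη0.le (by linarith) hε hδ hlog hO⟩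
  have h1 := (reduction_time_le hn hm hσ
    (le_two_pow_of_samples (by omega) hn hσ0 hσ hsamples) hs).trans (hCd _ (by omega))
  have hn' : (1 : ℝ) ≤ n := by exact_mod_cast hn
  have hm' : (1 : ℝ) ≤ m := by exact_mod_cast hm
  have hk' : (0 : ℝ) ≤ k := Nat.cast_nonneg k
  have hD0 : 0 < 1 / δ := by positivity
  have hE0 : 0 < 1 / ε := by positivity
  have hD := (Nat.ceil_lt_add_one hD0.le).le
  have hE := (Nat.ceil_lt_add_one hE0.le).le
  have hN : ((n + m + k + ⌈1 / δ⌉₊ + ⌈1 / ε⌉₊ : ℕ) : ℝ) ≤ 2 * (n + m + k + 1 / δ + 1 / ε) := by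
    push_cast
    linarith
  calc (s.time : ℝ) ≤ ((C * (n + m + k + ⌈1 / δ⌉₊ + ⌈1 / ε⌉₊) ^ d : ℕ) : ℝ) := by exact_mod_cast h1
    _ = C * ((n + m + k + ⌈1 / δ⌉₊ + ⌈1 / ε⌉₊ : ℕ) : ℝ) ^ d := by push_cast; rfl
    _ ≤ C * (2 * (n + m + k + 1 / δ + 1 / ε)) ^ d := by gcongr
    _ = ((C * 2 ^ d : ℕ) : ℝ) * (n + m + k + 1 / δ + 1 / ε) ^ d := by
        rw [mul_pow]; push_cast; ring
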